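/- All systems are finite-dimensional. A quantum instrument from $X$ to $Y$ is a countable family of completely positive maps from operators on $X$ to operators on $Y$ whose sum is trace-preserving; a quantum channel is a completely positive trace-preserving map. For bipartite systems, $\mathrm{LO}^\star(A;B)$ is the set of all maps $\sum_{i,j}\beta_{ij}\,\mathcal E_i\otimes\mathcal F_j$ on $AB$, where $(\mathcal E_i)_i$ and $(\mathcal F_j)_j$ are instruments on $A$ and on $B$ and $\beta_{ij}\in[-1,1]$; and $\mathrm{LOCC}^\star(A;B)$ is the set of all maps $\sum_i\beta_i\,\mathcal G_i$, where $(\mathcal G_i)_i$ is an LOCC instrument on $AB$ (with finitely or infinitely many rounds of classical communication between $A$ and $B$) and $\beta_i\in[-1,1]$. The quasiprobability extent of a linear map $\mathcal E$ with respect to a set $S$ of linear maps is $$\gamma_S(\mathcal E)=\inf\Big\{\sum_{i=1}^m|w_i| \;:\; \mathcal E=\sum_{i=1}^m w_i\mathcal F_i,\ m\ge 1,\ w_i\in\mathbb R,\ \mathcal F_i\in S\Big\},\qquad \inf\emptyset=\infty .$$ Let $S\in\{\mathrm{LO}^\star,\mathrm{LOCC}^\star\}$, $n\ge 1$, and let $\mathcal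 E_j$ be a linear map on the operators on $A_jB_j$ for $j=1,\dots,n$. The black-box extent $\gamma^{\mathrm{bb}}_{S}(\mathcal E_1,\dots,\mathcal E_n)$ is the infimum of $\sum_{i=1}^m|w_i|$ over all $m\ge1$, $w\in\mathbb R^m$, ancilla systems $E_A,E_B$ with initial product state $|0\rangle\langle 0|_{E_AE_B}$, and maps $\mathcal F^{(i)}_j\in S(A_jE_A;B_jE_B)$ such that for all systems $A,B$, all embeddings of each $A_j$ as a tensor factor of $A$ and of each $B_j$ as a tensor factor of $B$, all quantum channels $\mathcal B_1,\dots,\mathcal B_{n-1}$ on $AB$, and all operators $\rho$ on $AB$, $$(\mathcal E_n\circ\mathcal B_{n-1}\circ\mathcal E_{n-1}\circ\cdots\circ\mathcal B_1\circ\mathcal E_1)(\rho)=\sum_{i=1}^m w_i\,\mathrm{tr}_{E_AE_B}\Big[\big(\mathcal F^{(i)}_n\circ\mathcal B_{n-1}\circ\mathcal F^{(i)}_{n-1}\circ\cdots\circ\mathcal B_1\circ\mathcal F^{(i)}_1\big)\big(\rho\otimes|0\rangle\langle0|_{E_AE_B}\big)\Big],$$ where each map is tensored with the identity on the systems on which it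 does not act. **Theorem.** Let $n\ge1$ and let $\mathcal U_1,\dots,\mathcal U_n$ be two-qubit unitary channels, $\mathcal U_j(\rho)=U_j\rho U_j^\dagger$ with $U_j$ unitary on $\mathbb C^2\otimes\mathbb C^2$, the first qubit belonging to party $A$ and the second to party $B$. Then $$\gamma^{\mathrm{bb}}_{\mathrm{LO}^\star}(\mathcal U_1,\dots,\mathcal U_n)=\gamma^{\mathrm{bb}}_{\mathrm{LOCC}^\star}(\mathcal U_1,\dots,\mathcal U_n)=\gamma_{\mathrm{LO}^\star}(\mathcal U_1\otimes\cdots\otimes\mathcal U_n),$$ where on the right the bipartition is between the $n$ first qubits and the $n$ second qubits. -/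

import Mathlib

open Matrix Filter Topology
open scoped ComplexOrder Kronecker ENNReal

noncomputable section

namespace CircuitCut

/-! Finite-dimensional quantum systems are represented by finite types: the type `a` stands for the
Hilbert space `ℂ^a`, the type `a × b` for the tensor product of the systems `a` and `b`, and the
operators on `a` are the matrices `Matrix a a ℂ`. -/

section Superoperators

variable {a a' b b' c : Type} [Fintype a] [DecidableEq a] [Fintype a'] [DecidableEq a']
  [Fintype b] [DecidableEq b] [Fintype b'] [DecidableEq b'] [Fintype c] [DecidableEq c]

/-- Linear superoperators from the system `a` to the system `b`. -/
abbrev Superop (a b : Type) := Matrix a a ℂ →ₗ[ℂ] Matrix b b ℂ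

/-- The superoperator `X ↦ W X W†` induced by an operator `W` from `a` to `b`. -/
def conj (W : Matrix b a ℂ) : Superop a b where
  toFun X := W * X * Wᴴ
  map_add' X Y := by rw [Matrix.mul_add, Matrix.add_mul]
  map_smul' r X := by rw [Matrix.mul_smul, Matrix.smul_mul, RingHom.id_apply]

/-- The tensor product of two superoperators, given by its action on the matrix units
`|p⟩⟨q| = |p₁⟩⟨q₁| ⊗ |p₂⟩⟨q₂|`. -/
def tensor (E : Superop a a') (F : Superop b b') : Superop (a × b) (a' × b') :=
  ∑ p : a × b, ∑ q : a × b,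
    (Matrix.entryLinearMap ℂ ℂ p q).smulRight
      (E (Matrix.single p.1 q.1 1) ⊗ₖ F (Matrix.single p.2 q.2 1))

/-- The tensor product of a finite family of bipartite superoperators `E i` on `a × b`, as a
bipartite superoperator: the first halves are collected on one side and the second halves on
the other side. -/
def tensorFamily {n : ℕ} (E : Fin n → Superop (a × b) (a × b)) :
    Superop ((Fin n → a) × (Fin n → b)) ((Fin n → a) × (Fin n → b)) :=
  ∑ p : (Fin n → a) × (Fin n → b), ∑ q : (Fin n → a) × (Fin n → b),
    (Matrix.entryLinearMap ℂ ℂ p q).smulRight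
      (Matrix.of fun x y => ∏ i,
        E i (Matrix.single (p.1 i, p.2 i) (q.1 i, q.2 i) 1) (x.1 i, x.2 i) (y.1 i, y.2 i))

/-- The partial trace over the second tensor factor. -/
def traceOut : Superop (a × b) a where
  toFun X := Matrix.of fun i j => ∑ k, X (i, k) (j, k)
  map_add' X Y := by ext i j; simp [Finset.sum_add_distrib]
  map_smul' r X := by ext i j; simp [Finset.mul_sum]

/-- Adjoining an ancilla system in the pure basis state `|e⟩⟨e|`: `X ↦ X ⊗ |e⟩⟨e|`. -/
def adjoin (e : b) : Superop a (a × b) where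
  toFun X := X ⊗ₖ Matrix.single e e 1
  map_add' X Y := Matrix.add_kronecker X Y _
  map_smul' r X := Matrix.smul_kronecker r X _

/-- Complete positivity: `E ⊗ id` is positive for every (finite-dimensional) second system. -/
def IsCP (E : Superop a b) : Prop :=
  ∀ (k : ℕ) (X : Matrix (a × Fin k) (a × Fin k) ℂ), X.PosSemidef →
    (tensor E (LinearMap.id : Superop (Fin k) (Fin k)) X).PosSemidef

/-- Trace preservation. -/
def IsTP (E : Superop a b) : Prop := ∀ X, (E X).trace = X.trace

/-- Quantum channels. -/
def IsChannel (E : Superop a b) : Prop := IsCP E ∧ IsTP E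

/-- Quantum instruments: countable families of completely positive maps whose sum (a convergent
sum in the finite-dimensional space of superoperators) is trace-preserving. Outcomes with zero map
are allowed. -/
structure IsInstrument {ι : Type} (E : ι → Superop a b) : Prop where
  countable : Countable ι
  cp : ∀ i, IsCP (E i)
  tp : ∃ T : Superop a b, IsTP T ∧ ∀ X, HasSum (fun i => E i X) (T X)

/-- `F` is a coarse-graining of `E`: outcomes of `E` are merged along a map `f`. -/
def IsCoarseGraining {ι κ : Type} (E : ι → Superop a b) (F : κ → Superop a b) : Prop :=
  ∃ f : ι → κ, ∀ k X, HasSum (fun i : {i // f i = k} => E i X) (F k X)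

/-- The decomposition set of a class `Q` of instruments: all `∑ i, β i • E i` with
`E` in `Q` and `β i ∈ [-1, 1]`. -/
def weightedSums (Q : ∀ ι : Type, (ι → Superop a b) → Prop) : Set (Superop a b) :=
  {F | ∃ (ι : Type) (E : ι → Superop a b) (β : ι → ℝ), Q ι E ∧ (∀ i, β i ∈ Set.Icc (-1 : ℝ) 1) ∧
    ∀ X, HasSum (fun i => (β i : ℂ) • E i X) (F X)}

/-- The quasiprobability extent of `E` with respect to a decomposition set `S` (infinite if there
is no decomposition). -/
def extent (S : Set (Superop a b)) (E : Superop a b) : ℝ≥0∞ :=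
  sInf {t | ∃ (m : ℕ) (w : Fin m → ℝ) (F : Fin m → Superop a b), 1 ≤ m ∧ (∀ i, F i ∈ S) ∧
    E = ∑ i, (w i : ℂ) • F i ∧ t = ENNReal.ofReal (∑ i, |w i|)}

end Superoperators

section LocalOperations

variable {a a' a'' b b' b'' : Type} [Fintype a] [DecidableEq a] [Fintype a'] [DecidableEq a']
  [Fintype a''] [DecidableEq a''] [Fintype b] [DecidableEq b] [Fintype b'] [DecidableEq b']
  [Fintype b''] [DecidableEq b'']

/-- The LO instruments: products of an instrument on the first party and an instrument on the
second party, with the pair of the two outcomes as outcome. -/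
def IsLOInstrument (ι : Type) (G : ι → Superop (a × b) (a' × b')) : Prop :=
  ∃ (κ μ : Type) (e : ι ≃ κ × μ) (E : κ → Superop a a') (F : μ → Superop b b'),
    IsInstrument E ∧ IsInstrument F ∧ ∀ i, G i = tensor (E (e i).1) (F (e i).2)

/-- One-way local instruments: one of the parties performs an instrument and broadcasts its
outcome, the other party performs a channel that depends on this outcome. -/
def IsOneWayLocal {ι : Type} (G : ι → Superop (a × b) (a' × b')) : Prop :=
  (∃ (E : ι → Superop a a') (T : ι → Superop b b'),
    IsInstrument E ∧ (∀ i, IsChannel (T i)) ∧ ∀ i, G i = tensor (E i) (T i)) ∨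
  (∃ (T : ι → Superop a a') (E : ι → Superop b b'),
    IsInstrument E ∧ (∀ i, IsChannel (T i)) ∧ ∀ i, G i = tensor (T i) (E i))

/-- `H` is LOCC linked to `G`: conditioned on the outcome `i` of `G` one performs a one-way local
instrument `K i` (the measuring party may depend on `i`), followed by a coarse-graining. -/
def IsLOCCLinked {ι κ : Type} (G : ι → Superop (a × b) (a' × b'))
    (H : κ → Superop (a × b) (a'' × b'')) : Prop :=
  ∃ (μ : ι → Type) (K : ∀ i, μ i → Superop (a' × b') (a'' × b'')),
    (∀ i, IsOneWayLocal (K i)) ∧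
    IsCoarseGraining (fun p : Σ i, μ i => K p.1 p.2 ∘ₗ G p.1) H

/-- The LOCC instruments, with finitely or infinitely many rounds. There is a sequence
`P 0, P 1, …` in which `P 0` is one-way local and every `P (ν + 1)` is LOCC linked to `P ν`, that is,
`P ν` consists of the first `ν + 1` rounds of one and the same protocol; after these rounds the
parties hold the output systems `a'`, `b'` and local memories of dimensions `d ν`, `d' ν`.
For every `ν` some coarse-graining `Q ν` of the instrument obtained from `P ν` by discarding the
memories approximates `G`, and `Q ν → G`. As `G` and the `Q ν` are
instruments and everything is finite-dimensional, convergence for every single outcome is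
equivalent to convergence of `∑ k, Q ν k ⊗ |k⟩⟨k|` in diamond norm. -/
def IsLOCCInstrument (κ : Type) (G : κ → Superop (a × b) (a' × b')) : Prop :=
  IsInstrument G ∧
  ∃ (d d' : ℕ → ℕ) (ι : ℕ → Type)
    (P : ∀ ν, ι ν → Superop (a × b) ((a' × Fin (d ν)) × (b' × Fin (d' ν))))
    (Q : ℕ → κ → Superop (a × b) (a' × b')),
    IsOneWayLocal (P 0) ∧
    (∀ ν, Countable (ι ν)) ∧
    (∀ ν, IsLOCCLinked (P ν) (P (ν + 1))) ∧
    (∀ ν, IsCoarseGraining (fun i => tensor traceOut traceOut ∘ₗ P ν i) (Q ν)) ∧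
    ∀ k X, Tendsto (fun ν => Q ν k X) atTop (𝓝 (G k X))

/-- The decomposition set `LO⋆(a; b)`: local operations with classical side information. -/
def LOStar (a b : Type) [Fintype a] [DecidableEq a] [Fintype b] [DecidableEq b] :
    Set (Superop (a × b) (a × b)) :=
  weightedSums IsLOInstrument

/-- The decomposition set `LOCC⋆(a; b)`. -/
def LOCCStar (a b : Type) [Fintype a] [DecidableEq a] [Fintype b] [DecidableEq b] :
    Set (Superop (a × b) (a × b)) :=
  weightedSums IsLOCCInstrument

end LocalOperations

section BlackBox

variable {a b A B RA RB EA EB h r s : Type} [Fintype a] [DecidableEq a] [Fintype b] [DecidableEq b]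
  [Fintype A] [DecidableEq A] [Fintype B] [DecidableEq B] [Fintype RA] [DecidableEq RA]
  [Fintype RB] [DecidableEq RB] [Fintype EA] [DecidableEq EA] [Fintype EB] [DecidableEq EB]
  [Fintype h] [DecidableEq h] [Fintype r] [DecidableEq r] [Fintype s] [DecidableEq s]

/-- The alternating composition `g n ∘ B (n-1) ∘ g (n-1) ∘ ⋯ ∘ B 0 ∘ g 0`. -/
def alternate : ∀ {n : ℕ}, (Fin (n + 1) → Superop h h) → (Fin n → Superop h h) → Superop h h
  | 0, g, _ => g 0
  | n + 1, g, Bs =>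
      g (Fin.last (n + 1)) ∘ₗ Bs (Fin.last n) ∘ₗ
        alternate (fun i => g i.castSucc) (fun j => Bs j.castSucc)

/-- Unitary identifications between systems; a unitary `W` from `h` to `s × r` exhibits `s` as a
subsystem of `h`, with complementary system `r`. -/
def IsUnitaryMap (W : Matrix s h ℂ) : Prop := Wᴴ * W = 1 ∧ W * Wᴴ = 1

/-- `E` on the subsystem `s` of `h`, tensored with the identity channel on the rest `r`. -/
def onSubsystem (W : Matrix (s × r) h ℂ) (E : Superop s s) : Superop h h :=
  conj Wᴴ ∘ₗ tensor E (LinearMap.id : Superop r r) ∘ₗ conj W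

/-- From subsystems `a` of `A` and `b` of `B` to the subsystem `a b` of `A B`. -/
def gateFrame (VA : Matrix (a × RA) A ℂ) (VB : Matrix (b × RB) B ℂ) :
    Matrix ((a × b) × (RA × RB)) (A × B) ℂ :=
  (VA ⊗ₖ VB).submatrix (fun x => ((x.1.1, x.2.1), (x.1.2, x.2.2))) id

/-- From subsystems `a` of `A` and `b` of `B` to the subsystem `(a EA) (b EB)` of
`(A B) (EA EB)`. -/
def cutFrame (EA EB : Type) [Fintype EA] [DecidableEq EA] [Fintype EB] [DecidableEq EB]
    (VA : Matrix (a × RA) A ℂ) (VB : Matrix (b × RB) B ℂ) :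
    Matrix (((a × EA) × (b × EB)) × (RA × RB)) ((A × B) × (EA × EB)) ℂ :=
  ((VA ⊗ₖ VB) ⊗ₖ (1 : Matrix (EA × EB) (EA × EB) ℂ)).submatrix
    (fun x => (((x.1.1.1, x.2.1), (x.1.2.1, x.2.2)), (x.1.1.2, x.1.2.2))) id

/-- `∑ i, w i • (F i 0, …, F i n)` is a black box quasiprobability decomposition of the gates
`E 0, …, E n`, using ancillas `EA`, `EB` initialized in `|a₀⟩`, `|b₀⟩`: for all systems `A`, `B`, all
embeddings of the systems of the gates into `A` and `B` and all channels `Bs j` on `A B`, the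
circuit `E n ∘ Bs (n-1) ∘ ⋯ ∘ Bs 0 ∘ E 0` equals
`∑ i, w i • tr_{EA EB} (F i n ∘ Bs (n-1) ∘ ⋯ ∘ Bs 0 ∘ F i 0) (· ⊗ |a₀ b₀⟩⟨a₀ b₀|)`. -/
def IsBlackBoxQPD {n m : ℕ} (E : Fin (n + 1) → Superop (a × b) (a × b)) (a₀ : EA) (b₀ : EB)
    (w : Fin m → ℝ)
    (F : Fin m → Fin (n + 1) → Superop ((a × EA) × (b × EB)) ((a × EA) × (b × EB))) : Prop :=
  ∀ (A B : Type) [Fintype A] [DecidableEq A] [Fintype B] [DecidableEq B]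
    (RA RB : Fin (n + 1) → Type)
    [∀ j, Fintype (RA j)] [∀ j, DecidableEq (RA j)]
    [∀ j, Fintype (RB j)] [∀ j, DecidableEq (RB j)]
    (VA : ∀ j, Matrix (a × RA j) A ℂ) (VB : ∀ j, Matrix (b × RB j) B ℂ)
    (Bs : Fin n → Superop (A × B) (A × B)),
    (∀ j, IsUnitaryMap (VA j)) → (∀ j, IsUnitaryMap (VB j)) → (∀ j, IsChannel (Bs j)) →
    alternate (fun j => onSubsystem (gateFrame (VA j) (VB j)) (E j)) Bs =
      ∑ i, (w i : ℂ) •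
        ((traceOut : Superop ((A × B) × (EA × EB)) (A × B)) ∘ₗ
          alternate (fun j => onSubsystem (cutFrame EA EB (VA j) (VB j)) (F i j))
            (fun j => tensor (Bs j) LinearMap.id) ∘ₗ
          adjoin (a₀, b₀))

/-- The black box quasiprobability extent of the gates `E 0, …, E n` with respect to the
decomposition sets `DS (x; y)`. -/
def blackBoxExtent
    (DS : ∀ (x y : Type) [Fintype x] [DecidableEq x] [Fintype y] [DecidableEq y],
      Set (Superop (x × y) (x × y)))
    {n : ℕ} (E : Fin (n + 1) → Superop (a × b) (a × b)) : ℝ≥0∞ :=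
  sInf {t | ∃ (EA EB : Type) (_ : Fintype EA) (_ : DecidableEq EA) (_ : Fintype EB)
    (_ : DecidableEq EB) (a₀ : EA) (b₀ : EB) (m : ℕ) (w : Fin m → ℝ)
    (F : Fin m → Fin (n + 1) → Superop ((a × EA) × (b × EB)) ((a × EA) × (b × EB))),
    1 ≤ m ∧ (∀ i j, F i j ∈ DS (a × EA) (b × EB)) ∧ IsBlackBoxQPD E a₀ b₀ w F ∧
    t = ENNReal.ofReal (∑ i, |w i|)}

end BlackBox

end CircuitCut

end

open CircuitCut

/-! Every two-qubit unitary has an operator Schmidt decomposition `U = ∑ u k • L k ⊗ R k` in which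
all `L k` and `R k` are unitary (`exists_isUnitarySchmidt`). Such decompositions multiply under
tensor products (`IsUnitarySchmidt.bipartiteKron`). All three quantities equal `2 * (∑ u) ^ 2 - 1`,
where `u` are the Schmidt coefficients of the tensor product of all the gates.

Upper bounds: in `U X U†` the cross terms `(L k ⊗ R k) X (L l ⊗ R l)†` are obtained from two
settings, with relative phases `1` and `i`, of a product of signed local measurements
(`IsUnitarySchmidt.extent_conj_le`). The phase `i` setting vanishes for `k = l`; omitting it saves
`∑ u ^ 2 = 1`. In the black box setting each party keeps one ancilla qubit in a superposition of two
branches. It controls which of two sequences of local unitaries is applied, stays coherent through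
the unknown channels, and is measured only after the last gate, so the same cross terms appear for
whole sequences of Schmidt indices (`blackBoxExtent_LOStar_le`).

Lower bounds: every LO⋆ or LOCC⋆ map is a difference `P - M` of limits of sums of maps `K X K†` with
`K` a product operator, and adding a third such map to `P + M` makes it trace-preserving
(`SignedCone`). The linear functional `witness`, built from `Ω = ∑ L k ⊗ R k`, is at most `1` in
absolute value on these differences, by Cauchy–Schwarz and Bessel, and equals `2 * (∑ u) ^ 2 - 1` on
the unitary channel. For a black box decomposition, take all gates on distinct qubits and all
intermediate channels equal to the identity: this gives a decomposition of the tensor product into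
maps of the same signed class (`le_blackBoxExtent`). Since LO instruments are LOCC instruments, all
the inequalities close up. -/

set_option linter.unusedSectionVars false

/-! ### Simultaneous singular value decomposition of two real matrices. -/

section RealSVD

variable {ι : Type*} [Fintype ι] [DecidableEq ι]

theorem exists_orthonormalBasis_joint_eigenvectors {E κ : Type*} [NormedAddCommGroup E]
    [InnerProductSpace ℝ E] [FiniteDimensional ℝ E] (hcard : Module.finrank ℝ E = Fintype.card ι)
    (T : κ → E →ₗ[ℝ] E) (hT : ∀ i, (T i).IsSymmetric) (hC : ∀ i j, Commute (T i) (T j)) :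
    ∃ (b : OrthonormalBasis ι ℝ E) (γ : ι → κ → ℝ), ∀ k i, T i (b k) = γ k i • b k := by
  classical
  have hV := LinearMap.IsSymmetric.orthogonalFamily_iInf_eigenspaces hT
  have hI := LinearMap.IsSymmetric.directSum_isInternal_of_pairwise_commute hT
    (fun i j _ => hC i j)
  let v := fun γ : κ → ℝ => stdOrthonormalBasis ℝ
    (⨅ j, Module.End.eigenspace (T j) (γ j) : Submodule ℝ E)
  have hon := hV.orthonormal_sigma_orthonormal (fun γ => (v γ).orthonormal)
  let B := hI.collectedBasis fun γ => (v γ).toBasis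
  have : Finite (Σ γ : κ → ℝ, Fin (Module.finrank ℝ
    (⨅ j, Module.End.eigenspace (T j) (γ j) : Submodule ℝ E))) := Module.Finite.finite_basis B
  have := Fintype.ofFinite (Σ γ : κ → ℝ, Fin (Module.finrank ℝ
    (⨅ j, Module.End.eigenspace (T j) (γ j) : Submodule ℝ E)))
  have hB : Orthonormal ℝ B := by
    simpa only [B, DirectSum.IsInternal.collectedBasis_coe, OrthonormalBasis.coe_toBasis,
      Submodule.coe_subtypeₗᵢ, Submodule.coe_subtype] using hon
  let e := Fintype.equivOfCardEq ((Module.finrank_eq_card_basis B).symm.trans hcard)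
  refine ⟨(B.toOrthonormalBasis hB).reindex e, fun k => (e.symm k).1, fun k i => ?_⟩
  have hm : B (e.symm k) ∈ (⨅ j, Module.End.eigenspace (T j) ((e.symm k).1 j) : Submodule ℝ E) := by
    simp only [B, DirectSum.IsInternal.collectedBasis_coe]
    exact Submodule.coe_mem _
  simpa using Module.End.mem_eigenspace_iff.mp ((Submodule.mem_iInf _).mp hm i)

theorem exists_orthogonal_joint_isDiag {κ : Type*} (T : κ → Matrix ι ι ℝ) (hT : ∀ i, (T i)ᵀ = T i)
    (hC : ∀ i j, T i * T j = T j * T i) :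
    ∃ O : Matrix ι ι ℝ, Oᵀ * O = 1 ∧ ∀ i, (Oᵀ * T i * O).IsDiag := by
  obtain ⟨b, γ, hb⟩ := exists_orthonormalBasis_joint_eigenvectors (ι := ι)
    (E := EuclideanSpace ℝ ι) (by simp) (fun i => Matrix.toEuclideanLin (T i))
    (fun i => by
      rw [Matrix.isSymmetric_toEuclideanLin_iff, Matrix.IsHermitian,
        Matrix.conjTranspose_eq_transpose_of_trivial]
      exact hT i)
    (fun i j => by
      ext v x
      have := congrArg (fun M => (M *ᵥ v.ofLp) x) (hC i j)
      simpa [Matrix.toLpLin_apply, Matrix.mulVec_mulVec] using this)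
  have hO : (Matrix.of fun x k => b k x)ᵀ * (Matrix.of fun x k => b k x) = 1 := by
    ext k l
    have := (orthonormal_iff_ite.mp b.orthonormal) l k
    simp only [PiLp.inner_apply, RCLike.inner_apply, conj_trivial] at this
    simp only [mul_apply, transpose_apply, of_apply, this, one_apply, eq_comm]
  refine ⟨Matrix.of fun x k => b k x, hO, fun i => ?_⟩
  have hTO : T i * (Matrix.of fun x k => b k x) =
      (Matrix.of fun x k => b k x) * diagonal (fun k => γ k i) := by
    ext x k
    have := congrArg (fun v => v.ofLp x) (hb k i)
    simp only [Matrix.toLpLin_apply, PiLp.smul_apply, smul_eq_mul, Matrix.mulVec,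
      dotProduct] at this
    rw [mul_diagonal, mul_apply]
    simpa [mul_comm] using this
  rw [Matrix.mul_assoc, hTO, ← Matrix.mul_assoc, hO, Matrix.one_mul]
  exact isDiag_diagonal _

/-- The hypotheses say that the complex matrix `C = P + iQ` has real `C C†` and `C† C`. They make `P
Pᵀ`, `Q Qᵀ` and `P Qᵀ` commuting symmetric matrices; a common eigenbasis supplies `O`, and the rows
of `Oᵀ P` and `Oᵀ Q` supply `W`. -/
theorem exists_simultaneous_svd (P Q : Matrix ι ι ℝ) (h₁ : P * Qᵀ = Q * Pᵀ)
    (h₂ : Pᵀ * Q = Qᵀ * P) :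
    ∃ (O W : Matrix ι ι ℝ) (d e : ι → ℝ), Oᵀ * O = 1 ∧ Wᵀ * W = 1 ∧
      P = O * diagonal d * Wᵀ ∧ Q = O * diagonal e * Wᵀ := by
  have c₁ : (P * Pᵀ) * (Q * Qᵀ) = (Q * Qᵀ) * (P * Pᵀ) := by
    calc (P * Pᵀ) * (Q * Qᵀ) = P * (Pᵀ * Q) * Qᵀ := by simp only [Matrix.mul_assoc]
      _ = (P * Qᵀ) * (P * Qᵀ) := by rw [h₂]; simp only [Matrix.mul_assoc]
      _ = Q * (Pᵀ * Q) * Pᵀ := by rw [h₁]; simp only [Matrix.mul_assoc]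
      _ = (Q * Qᵀ) * (P * Pᵀ) := by rw [h₂]; simp only [Matrix.mul_assoc]
  have c₂ : (P * Pᵀ) * (P * Qᵀ) = (P * Qᵀ) * (P * Pᵀ) := by
    calc (P * Pᵀ) * (P * Qᵀ) = P * Pᵀ * (Q * Pᵀ) := by rw [h₁]
      _ = P * (Pᵀ * Q) * Pᵀ := by simp only [Matrix.mul_assoc]
      _ = (P * Qᵀ) * (P * Pᵀ) := by rw [h₂]; simp only [Matrix.mul_assoc]
  have c₃ : (Q * Qᵀ) * (P * Qᵀ) = (P * Qᵀ) * (Q * Qᵀ) := by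
    calc (Q * Qᵀ) * (P * Qᵀ) = Q * (Qᵀ * P) * Qᵀ := by simp only [Matrix.mul_assoc]
      _ = Q * Pᵀ * (Q * Qᵀ) := by rw [← h₂]; simp only [Matrix.mul_assoc]
      _ = _ := by rw [h₁]
  obtain ⟨O, hO, hd⟩ := exists_orthogonal_joint_isDiag ![P * Pᵀ, Q * Qᵀ, P * Qᵀ]
    (by
      intro i
      fin_cases i <;> simp [h₁])
    (by
      intro i j
      fin_cases i <;> fin_cases j <;>
        simp only [Fin.zero_eta, Fin.mk_one, Fin.reduceFinMk, cons_val] <;>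
        first | rfl | exact c₁ | exact c₂ | exact c₃ | exact c₁.symm | exact c₂.symm | exact c₃.symm)
  have hO' : O * Oᵀ = 1 := mul_eq_one_comm.mp hO
  obtain ⟨p, hp⟩ : ∃ p, p = Oᵀ * P := ⟨_, rfl⟩
  obtain ⟨q, hq⟩ : ∃ q, q = Oᵀ * Q := ⟨_, rfl⟩
  have dpp : (p * pᵀ).IsDiag := by
    have := hd 0
    simpa [hp, Matrix.transpose_mul, Matrix.mul_assoc] using this
  have dqq : (q * qᵀ).IsDiag := by
    have := hd 1
    simpa [hq, Matrix.transpose_mul, Matrix.mul_assoc] using this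
  have dpq : (p * qᵀ).IsDiag := by
    have := hd 2
    simpa [hp, hq, Matrix.transpose_mul, Matrix.mul_assoc] using this
  have hcomm : pᵀ * q = qᵀ * p := by
    rw [hp, hq, transpose_mul, transpose_mul, transpose_transpose, Matrix.mul_assoc,
      Matrix.mul_assoc, ← Matrix.mul_assoc O, ← Matrix.mul_assoc O, hO', Matrix.one_mul,
      Matrix.one_mul, h₂]
  -- For each `k` the rows `p k` and `q k` are parallel: since `pᵀ q` is symmetric, `(p pᵀ) q = (p
  -- qᵀ) p`, and both bracketed matrices are diagonal.
  have hpar : ∀ k x, (p * pᵀ) k k * q k x = (p * qᵀ) k k * p k x := by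
    intro k x
    have h : p * pᵀ * q = p * qᵀ * p := by rw [Matrix.mul_assoc, hcomm, Matrix.mul_assoc]
    rw [← dpp.diagonal_diag, ← dpq.diagonal_diag] at h
    simpa [diagonal_mul] using congrFun (congrFun h k) x
  -- One representative direction per row. Those of different rows are orthogonal because `p pᵀ`, `q
  -- qᵀ` and `p qᵀ` are all diagonal; rows where both vanish are filled in by extending to an
  -- orthonormal basis.
  let u : ι → EuclideanSpace ℝ ι := fun k => WithLp.toLp 2 (if p k = 0 then q k else p k)
  have hu : Pairwise fun i j => inner ℝ (u i) (u j) = 0 := by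
    intro i j hij
    have e1 := dpp hij
    have e2 := dqq hij
    have e3 := dpq hij
    have e4 := dpq hij.symm
    simp only [mul_apply, transpose_apply] at e1 e2 e3 e4
    simp only [u, PiLp.inner_apply, RCLike.inner_apply, conj_trivial]
    split_ifs
    · simpa only [mul_comm] using e2
    · simpa only [mul_comm] using e3
    · simpa only [mul_comm] using e4
    · simpa only [mul_comm] using e1
  have hfr : Module.finrank ℝ (EuclideanSpace ℝ ι) = Fintype.card ι := by simp
  have hc : ∃ b : OrthonormalBasis ι ℝ (EuclideanSpace ℝ ι), ∀ k, u k ≠ 0 →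
      b k = ‖u k‖⁻¹ • u k := by
    obtain ⟨b, hb⟩ := Orthonormal.exists_orthonormalBasis_extension_of_card_eq (𝕜 := ℝ) hfr
      (v := fun k => ‖u k‖⁻¹ • u k) (s := {k | u k ≠ 0}) (by
        rw [orthonormal_iff_ite]
        rintro ⟨i, hi⟩ ⟨j, hj⟩
        simp only [Set.domRestrict_apply, inner_smul_left, inner_smul_right, Subtype.mk.injEq]
        split_ifs with h
        · subst h
          have : ‖u i‖ ≠ 0 := norm_ne_zero_iff.mpr hi
          rw [real_inner_self_eq_norm_sq]
          simp; field_simp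
        · rw [hu h]; simp)
    exact ⟨b, fun k hk => hb k hk⟩
  obtain ⟨b, hb⟩ := hc
  have hub : ∀ k, ∃ r : ℝ, u k = r • b k := by
    intro k
    by_cases hk : u k = 0
    · exact ⟨0, by simp [hk]⟩
    · refine ⟨‖u k‖, ?_⟩
      rw [hb k hk, smul_smul, mul_inv_cancel₀ (norm_ne_zero_iff.mpr hk), one_smul]
  have hpb : ∀ k, ∃ r : ℝ, ∀ x, p k x = r * b k x := by
    intro k
    by_cases hk : p k = 0
    · exact ⟨0, by simp [hk]⟩
    · obtain ⟨r, hr⟩ := hub k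
      refine ⟨r, fun x => ?_⟩
      have := congrArg (fun v => v.ofLp x) hr
      simpa [u, hk] using this
  have hqb : ∀ k, ∃ r : ℝ, ∀ x, q k x = r * b k x := by
    intro k
    by_cases hk : p k = 0
    · obtain ⟨r, hr⟩ := hub k
      refine ⟨r, fun x => ?_⟩
      have := congrArg (fun v => v.ofLp x) hr
      simpa [u, hk] using this
    · obtain ⟨r, hr⟩ := hpb k
      have hne : (p * pᵀ) k k ≠ 0 := by
        intro h0
        apply hk
        rw [mul_apply] at h0
        simp only [transpose_apply] at h0
        rw [Finset.sum_eq_zero_iff_of_nonneg (fun _ _ => mul_self_nonneg _)] at h0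
        ext x
        simpa using h0 x (Finset.mem_univ x)
      refine ⟨(p * qᵀ) k k / (p * pᵀ) k k * r, fun x => ?_⟩
      rw [mul_assoc, ← hr x, div_mul_eq_mul_div, eq_div_iff hne, mul_comm, hpar]
  choose d hd' using hpb
  choose e he' using hqb
  refine ⟨O, Matrix.of fun x k => b k x, d, e, hO, ?_, ?_, ?_⟩
  · ext k l
    have := (orthonormal_iff_ite.mp b.orthonormal) l k
    simp only [PiLp.inner_apply, RCLike.inner_apply, conj_trivial] at this
    simp only [mul_apply, transpose_apply, of_apply, this, one_apply, eq_comm]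
  · have : diagonal d * (Matrix.of fun x k => b k x)ᵀ = p := by
      ext k x
      simp [diagonal_mul, hd']
    rw [Matrix.mul_assoc, this, hp, ← Matrix.mul_assoc, hO', Matrix.one_mul]
  · have : diagonal e * (Matrix.of fun x k => b k x)ᵀ = q := by
      ext k x
      simp [diagonal_mul, he']
    rw [Matrix.mul_assoc, this, hq, ← Matrix.mul_assoc, hO', Matrix.one_mul]

end RealSVD

namespace CircuitCut

/-! ### Operator Schmidt decomposition of two-qubit unitaries through quaternion coefficients. -/

section Cartan

open Complex

/-- The quaternion units `1, i, j, k` as complex `2 × 2` matrices. -/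
def quatUnit : Fin 4 → Matrix (Fin 2) (Fin 2) ℂ :=
  ![1, !![0, I; I, 0], !![0, 1; -1, 0], !![I, 0; 0, -I]]

/-- The quaternion units are fixed by the antilinear spin flip, which conjugates the entries, flips
both indices and inserts signs. Reality of coefficients in this basis thus becomes invariance under
the spin flip. -/
theorem star_quatUnit (μ : Fin 4) (x y : Fin 2) :
    star (quatUnit μ x y) = (-1) ^ (x + y : ℕ) * quatUnit μ (1 - x) (1 - y) := by
  fin_cases μ <;> fin_cases x <;> fin_cases y <;> simp [quatUnit]

theorem sum_quatUnit_mul_star (x y x' y' : Fin 2) :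
    ∑ μ, quatUnit μ x y * star (quatUnit μ x' y') = if x = x' ∧ y = y' then 2 else 0 := by
  fin_cases x <;> fin_cases y <;> fin_cases x' <;> fin_cases y' <;>
    simp [quatUnit, Fin.sum_univ_four] <;> norm_num

/-- Real unit quaternions form `SU(2)`; this is why real orthogonal changes of basis produce unitary
Schmidt operators. -/
theorem conjTranspose_sum_quatUnit_mul_self (v : Fin 4 → ℝ) (hv : ∑ μ, v μ * v μ = 1) :
    (∑ μ, (v μ : ℂ) • quatUnit μ)ᴴ * (∑ μ, (v μ : ℂ) • quatUnit μ) = 1 := by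
  have h : (v 0 : ℂ) * v 0 + v 1 * v 1 + v 2 * v 2 + v 3 * v 3 = 1 := by
    rw [Fin.sum_univ_four] at hv
    exact_mod_cast hv
  have hI := I_sq
  ext i j
  fin_cases i <;> fin_cases j <;>
    simp [quatUnit, Fin.sum_univ_four, mul_apply, conjTranspose_apply] <;> grind

theorem trace_conjTranspose_sum_quatUnit_mul (v w : Fin 4 → ℝ) :
    ((∑ μ, (v μ : ℂ) • quatUnit μ)ᴴ * (∑ μ, (w μ : ℂ) • quatUnit μ)).trace =
      2 * ((∑ μ, v μ * w μ : ℝ) : ℂ) := by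
  have hI := I_sq
  simp [quatUnit, Fin.sum_univ_four, mul_apply, conjTranspose_apply, trace]
  grind

/-- The coefficients of a two-qubit operator in the product basis of quaternion units. -/
noncomputable def quatCoeff (U : Fin 2 → Fin 2 → Fin 2 → Fin 2 → ℂ) (μ ν : Fin 4) : ℂ :=
  1 / 4 * ∑ x, ∑ y, ∑ x', ∑ y', star (quatUnit μ x y) * star (quatUnit ν x' y') * U x x' y y'

theorem quatCoeff_swap (U : Fin 2 → Fin 2 → Fin 2 → Fin 2 → ℂ) (μ ν : Fin 4) :
    quatCoeff (fun x x' y y' => U x' x y' y) μ ν = quatCoeff U ν μ := by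
  simp only [quatCoeff, Fin.sum_univ_two]
  ring

theorem sum_quatCoeff_mul (U : Fin 2 → Fin 2 → Fin 2 → Fin 2 → ℂ) (x x' y y' : Fin 2) :
    ∑ μ, ∑ ν, quatCoeff U μ ν * (quatUnit μ x y * quatUnit ν x' y') = U x x' y y' := by
  have : ∀ μ ν, quatCoeff U μ ν * (quatUnit μ x y * quatUnit ν x' y') =
      1 / 4 * ∑ a, ∑ b, ∑ a', ∑ b', U a a' b b' * ((quatUnit μ x y * star (quatUnit μ a b)) *
        (quatUnit ν x' y' * star (quatUnit ν a' b'))) := by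
    intro μ ν
    simp only [quatCoeff, Fin.sum_univ_two]
    ring
  simp only [this, ← Finset.mul_sum]
  have h : ∀ f : Fin 4 → Fin 4 → Fin 2 → Fin 2 → Fin 2 → Fin 2 → ℂ,
      ∑ μ, ∑ ν, ∑ a, ∑ b, ∑ a', ∑ b', f μ ν a b a' b' =
        ∑ a, ∑ b, ∑ a', ∑ b', ∑ μ, ∑ ν, f μ ν a b a' b' := by
    intro f
    simp only [Fin.sum_univ_two, Finset.sum_add_distrib]
  rw [h]
  simp only [← Finset.mul_sum, ← Finset.sum_mul, sum_quatUnit_mul_star]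
  fin_cases x <;> fin_cases y <;> fin_cases x' <;> fin_cases y' <;>
    simp [Fin.sum_univ_two] <;> ring

/-- The Gram matrix of the quaternion coefficients of a two-qubit unitary is real. -/
theorem star_sum_quatCoeff_mul_star (U : Fin 2 → Fin 2 → Fin 2 → Fin 2 → ℂ)
    (h₁ : ∀ x x' y y', ∑ a, ∑ b, star (U a b x x') * U a b y y' = if x = y ∧ x' = y' then 1 else 0)
    (h₂ : ∀ x x' y y', ∑ a, ∑ b, U x x' a b * star (U y y' a b) = if x = y ∧ x' = y' then 1 else 0)
    (μ μ' : Fin 4) :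
    star (∑ ν, quatCoeff U μ ν * star (quatCoeff U μ' ν)) =
      ∑ ν, quatCoeff U μ ν * star (quatCoeff U μ' ν) := by
  -- The matrix elements of the reduced map `ρ ↦ tr_B (U (ρ ⊗ 1) U†)` on the first qubit.
  let N : Fin 2 → Fin 2 → Fin 2 → Fin 2 → ℂ := fun x y x' y' =>
    ∑ b, ∑ b', U x b y b' * star (U x' b y' b')
  -- Up to the factor `2`, the reduced map is trace-preserving (`e₁`) and unital (`e₂`), and it
  -- preserves Hermiticity (`e₃`). The spin flip acts on Hermitian matrices as `ρ ↦ tr ρ - ρ`, so it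
  -- commutes with such a map.
  have hN : ∀ x y x' y', star (N x y x' y') =
      (-1) ^ (x + y + x' + y' : ℕ) * N (1 - x) (1 - y) (1 - x') (1 - y') := by
    have e₁ : ∀ y y', ∑ x, N x y x y' = if y = y' then 2 else 0 := by
      intro y y'
      have := h₁ y' 0 y 0
      have := h₁ y' 1 y 1
      simp only [N, Fin.sum_univ_two] at *
      split_ifs at * <;> grind
    have e₂ : ∀ x x', ∑ y, N x y x' y = if x = x' then 2 else 0 := by
      intro x x'
      have := h₂ x 0 x' 0
      have := h₂ x 1 x' 1
      simp only [N, Fin.sum_univ_two] at *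
      split_ifs at * <;> grind
    have e₃ : ∀ x y x' y', star (N x y x' y') = N x' y' x y := by
      intro x y x' y'
      simp only [N, Fin.sum_univ_two, star_add, star_mul', star_star]
      ring
    intro x y x' y'
    rw [e₃]
    have := e₁ 0 0
    have := e₁ 0 1
    have := e₁ 1 0
    have := e₁ 1 1
    have := e₂ 0 0
    have := e₂ 0 1
    have := e₂ 1 0
    have := e₂ 1 1
    clear e₁ e₂ e₃ h₁ h₂
    clear_value N
    simp only [Fin.sum_univ_two] at *
    fin_cases x <;> fin_cases y <;> fin_cases x' <;> fin_cases y' <;> simp at * <;> grind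
  -- Summing over the quaternion basis of the second qubit (Parseval) expresses the Gram matrix
  -- through `N` alone.
  have key : ∀ μ μ', ∑ ν, quatCoeff U μ ν * star (quatCoeff U μ' ν) =
      1 / 8 * ∑ x, ∑ y, ∑ x', ∑ y', star (quatUnit μ x y) * quatUnit μ' x' y' * N x y x' y' := by
    intro μ μ'
    let d : Fin 4 → Fin 2 → Fin 2 → ℂ := fun μ b b' => ∑ x, ∑ y, star (quatUnit μ x y) * U x b y b'
    have hc : ∀ μ ν, quatCoeff U μ ν = 1 / 4 * ∑ b, ∑ b', star (quatUnit ν b b') * d μ b b' := by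
      intro μ ν
      simp only [quatCoeff, d, Fin.sum_univ_two]
      ring
    have hp : ∀ f g : Fin 2 → Fin 2 → ℂ, ∑ ν, (1 / 4 * ∑ b, ∑ b', star (quatUnit ν b b') * f b b') *
        star (1 / 4 * ∑ b, ∑ b', star (quatUnit ν b b') * g b b') =
        1 / 8 * ∑ b, ∑ b', f b b' * star (g b b') := by
      intro f g
      have hI := I_sq
      simp [quatUnit, Fin.sum_univ_two, Fin.sum_univ_four]
      grind
    simp only [hc, hp]
    simp only [d, N, Fin.sum_univ_two, star_add, star_mul', star_star]
    ring
  rw [key]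
  simp only [star_mul', star_sum, star_star, hN]
  simp only [star_quatUnit]
  simp [Fin.sum_univ_two]
  ring

end Cartan

section UnitarySchmidt

variable {a b κ : Type} [Fintype a] [DecidableEq a] [Fintype b] [DecidableEq b] [Fintype κ]
  [DecidableEq κ]

/-- An operator Schmidt decomposition `U = ∑ k, u k • L k ⊗ R k` of a bipartite unitary into
orthogonal product unitaries. -/
structure IsUnitarySchmidt (U : Matrix (a × b) (a × b) ℂ) (u : κ → ℝ) (L : κ → Matrix a a ℂ)
    (R : κ → Matrix b b ℂ) : Prop where
  nonneg : ∀ k, 0 ≤ u k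
  sum_sq : ∑ k, u k ^ 2 = 1
  left_unitary : ∀ k, (L k)ᴴ * L k = 1
  right_unitary : ∀ k, (R k)ᴴ * R k = 1
  left_orthogonal : ∀ k l, ((L k)ᴴ * L l).trace = if k = l then (Fintype.card a : ℂ) else 0
  right_orthogonal : ∀ k l, ((R k)ᴴ * R l).trace = if k = l then (Fintype.card b : ℂ) else 0
  eq_sum : U = ∑ k, (u k : ℂ) • L k ⊗ₖ R k

end UnitarySchmidt

/-- Every two-qubit unitary has an operator Schmidt decomposition into product unitaries. -/
theorem exists_isUnitarySchmidt (U : Matrix.unitaryGroup (Fin 2 × Fin 2) ℂ) :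
    ∃ (u : Fin 4 → ℝ) (L R : Fin 4 → Matrix (Fin 2) (Fin 2) ℂ),
      IsUnitarySchmidt (U : Matrix (Fin 2 × Fin 2) (Fin 2 × Fin 2) ℂ) u L R := by
  obtain ⟨M, hM⟩ := U
  have hM₁ : Mᴴ * M = 1 := Matrix.mem_unitaryGroup_iff'.mp hM
  have hM₂ : M * Mᴴ = 1 := Matrix.mem_unitaryGroup_iff.mp hM
  let V : Fin 2 → Fin 2 → Fin 2 → Fin 2 → ℂ := fun x x' y y' => M (x, x') (y, y')
  have h₁ : ∀ x x' y y', ∑ a, ∑ b, star (V a b x x') * V a b y y' =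
      if x = y ∧ x' = y' then 1 else 0 := by
    intro x x' y y'
    have := congrFun (congrFun hM₁ (x, x')) (y, y')
    simpa [mul_apply, one_apply, Fintype.sum_prod_type, V] using this
  have h₂ : ∀ x x' y y', ∑ a, ∑ b, V x x' a b * star (V y y' a b) =
      if x = y ∧ x' = y' then 1 else 0 := by
    intro x x' y y'
    have := congrFun (congrFun hM₂ (x, x')) (y, y')
    simpa [mul_apply, one_apply, Fintype.sum_prod_type, V] using this
  -- For the coefficient matrix `C`, `g₁` says that `C C†` is real; `g₂`, the same statement with
  -- the two qubits exchanged, is the corresponding fact for `Cᵀ`. Their imaginary parts are the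
  -- hypotheses of `exists_simultaneous_svd`.
  have g₁ := star_sum_quatCoeff_mul_star V h₁ h₂
  have g₂ := star_sum_quatCoeff_mul_star (fun x x' y y' => V x' x y' y)
    (by
      intro x x' y y'
      rw [Finset.sum_comm, h₁]
      simp only [and_comm])
    (by
      intro x x' y y'
      rw [Finset.sum_comm, h₂]
      simp only [and_comm])
  simp only [quatCoeff_swap] at g₂
  let P : Matrix (Fin 4) (Fin 4) ℝ := of fun μ ν => (quatCoeff V μ ν).re
  let Q : Matrix (Fin 4) (Fin 4) ℝ := of fun μ ν => (quatCoeff V μ ν).im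
  obtain ⟨O, W, d, e, hO, hW, hP, hQ⟩ := exists_simultaneous_svd P Q
    (by
      ext μ μ'
      have := congrArg Complex.im (g₁ μ μ')
      simp [Finset.sum_add_distrib] at this
      simp [P, Q, mul_apply]
      linarith)
    (by
      ext μ μ'
      have := congrArg Complex.im (g₂ μ μ')
      simp [Finset.sum_add_distrib] at this
      simp [P, Q, mul_apply]
      linarith)
  let z : Fin 4 → ℂ := fun k => d k + e k * Complex.I
  have hc : ∀ μ ν, quatCoeff V μ ν = ∑ k, (O μ k : ℂ) * z k * W ν k := by
    intro μ ν
    have e₁ := congrFun (congrFun hP μ) ν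
    have e₂ := congrFun (congrFun hQ μ) ν
    simp only [P, Q, of_apply, mul_apply, transpose_apply] at e₁ e₂
    apply Complex.ext
    · rw [e₁]; simp [z, diagonal_apply]
    · rw [e₂]; simp [z, diagonal_apply]
  -- The diagonal factor of `C` is complex; its moduli become the Schmidt coefficients and its
  -- phases are absorbed into the left unitaries.
  have hphase : ∀ k, ∃ w : ℂ, star w * w = 1 ∧ z k = (‖z k‖ : ℂ) * w := by
    intro k
    by_cases hk : z k = 0
    · exact ⟨1, by simp, by simp [hk]⟩
    · have hn : (‖z k‖ : ℂ) ≠ 0 := by simpa using hk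
      refine ⟨z k / ‖z k‖, ?_, by field_simp⟩
      rw [star_div₀, div_mul_div_comm, Complex.star_def, Complex.conj_mul']
      simp
      field_simp
  choose w hw hz using hphase
  let A : Fin 4 → Matrix (Fin 2) (Fin 2) ℂ := fun k => ∑ μ, (O μ k : ℂ) • quatUnit μ
  let B : Fin 4 → Matrix (Fin 2) (Fin 2) ℂ := fun k => ∑ μ, (W μ k : ℂ) • quatUnit μ
  have hOk : ∀ k l, ∑ μ, O μ k * O μ l = if k = l then 1 else 0 := by
    intro k l
    have := congrFun (congrFun hO k) l
    simpa [mul_apply, one_apply] using this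
  have hWk : ∀ k l, ∑ μ, W μ k * W μ l = if k = l then 1 else 0 := by
    intro k l
    have := congrFun (congrFun hW k) l
    simpa [mul_apply, one_apply] using this
  have hLu : ∀ k, (w k • A k)ᴴ * (w k • A k) = 1 := by
    intro k
    rw [conjTranspose_smul, Matrix.smul_mul, Matrix.mul_smul, smul_smul, hw, one_smul]
    exact conjTranspose_sum_quatUnit_mul_self _ (by simpa using hOk k k)
  have hRu : ∀ k, (B k)ᴴ * B k = 1 := fun k =>
    conjTranspose_sum_quatUnit_mul_self _ (by simpa using hWk k k)
  have hLo : ∀ k l, (((fun k => w k • A k) k)ᴴ * ((fun k => w k • A k) l)).trace =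
      if k = l then (Fintype.card (Fin 2) : ℂ) else 0 := by
    intro k l
    beta_reduce
    rw [conjTranspose_smul, Matrix.smul_mul, Matrix.mul_smul, smul_smul, trace_smul,
      trace_conjTranspose_sum_quatUnit_mul, hOk]
    split_ifs with h
    · subst h; rw [hw]; simp
    · simp
  have hRo : ∀ k l, ((B k)ᴴ * B l).trace = if k = l then (Fintype.card (Fin 2) : ℂ) else 0 := by
    intro k l
    rw [trace_conjTranspose_sum_quatUnit_mul, hWk]
    split_ifs <;> simp
  have hsum : M = ∑ k, (‖z k‖ : ℂ) • (fun k => w k • A k) k ⊗ₖ B k := by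
    beta_reduce
    ext ⟨x, x'⟩ ⟨y, y'⟩
    have := sum_quatCoeff_mul V x x' y y'
    rw [show M (x, x') (y, y') = V x x' y y' from rfl, ← this]
    have hk : ∀ k, ((‖z k‖ : ℂ) • (w k • A k) ⊗ₖ B k) (x, x') (y, y') =
        ∑ μ, ∑ ν, (O μ k : ℂ) * z k * W ν k * (quatUnit μ x y * quatUnit ν x' y') := by
      intro k
      rw [Matrix.smul_apply, kronecker_apply, Matrix.smul_apply, smul_eq_mul, smul_eq_mul,
        ← mul_assoc, ← mul_assoc, ← hz]
      simp only [A, B, Matrix.sum_apply, Matrix.smul_apply, smul_eq_mul]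
      rw [mul_assoc, Finset.sum_mul_sum, Finset.mul_sum]
      simp only [Finset.mul_sum]
      exact Finset.sum_congr rfl fun μ _ => Finset.sum_congr rfl fun ν _ => by ring
    rw [Matrix.sum_apply]
    simp only [hk, hc, Finset.sum_mul]
    symm
    rw [Finset.sum_comm]
    refine Finset.sum_congr rfl fun μ _ => ?_
    rw [Finset.sum_comm]
  refine ⟨fun k => ‖z k‖, fun k => w k • A k, B, ⟨fun k => norm_nonneg _, ?_, hLu, hRu, hLo, hRo,
    hsum⟩⟩
  generalize (fun k => w k • A k) = L at hLo hsum
  -- Normalisation of the coefficients: the trace of `U† U = 1` is `4`, and by orthogonality it is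
  -- also `4 ∑ ‖z k‖ ^ 2`.
  have ht := congrArg trace hM₁
  rw [hsum] at ht
  simp only [conjTranspose_sum, conjTranspose_smul, conjTranspose_kronecker, Matrix.sum_mul,
    Matrix.mul_sum, Matrix.smul_mul, Matrix.mul_smul, ← mul_kronecker_mul, trace_sum, trace_smul,
    trace_kronecker, hLo, hRo] at ht
  have h4 : ∀ k, (‖z k‖ : ℂ) * ((‖z k‖ : ℂ) * ((2 : ℂ) * 2)) = 4 * ((‖z k‖ ^ 2 : ℝ) : ℂ) := by
    intro k; push_cast; ring
  simp [h4, ← Finset.mul_sum] at ht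
  exact_mod_cast ht

/-! ### Calculus of superoperators: tensor products, alternating circuits, subsystems. -/

section Sandwich

variable {a a' a'' b b' b'' c : Type} [Fintype a] [DecidableEq a] [Fintype a'] [DecidableEq a']
  [Fintype a''] [DecidableEq a''] [Fintype b] [DecidableEq b] [Fintype b'] [DecidableEq b']
  [Fintype b''] [DecidableEq b''] [Fintype c] [DecidableEq c]

/-- The superoperator `X ↦ K X M†`. -/
def sandwich (K M : Matrix a' a ℂ) : Superop a a' where
  toFun X := K * X * Mᴴ
  map_add' X Y := by rw [Matrix.mul_add, Matrix.add_mul]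
  map_smul' r X := by rw [Matrix.mul_smul, Matrix.smul_mul, RingHom.id_apply]

theorem sandwich_apply (K M : Matrix a' a ℂ) (X : Matrix a a ℂ) :
    sandwich K M X = K * X * Mᴴ := rfl

theorem conj_eq_sandwich (K : Matrix a' a ℂ) : conj K = sandwich K K := rfl

theorem sandwich_apply_single (K M : Matrix a' a ℂ) (p q : a) (x y : a') :
    sandwich K M (single p q 1) x y = K x p * star (M y q) := by
  rw [sandwich_apply, mul_apply, Finset.sum_eq_single q]
  · rw [mul_apply, Finset.sum_eq_single p] <;> simp +contextual [eq_comm]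
  · intro j _ hj
    rw [mul_apply, Finset.sum_eq_zero, zero_mul]
    intro i _
    simp [hj.symm]
  · simp

theorem sandwich_comp (K M : Matrix a'' a' ℂ) (K' M' : Matrix a' a ℂ) :
    sandwich K M ∘ₗ sandwich K' M' = sandwich (K * K') (M * M') := by
  ext1 X
  simp [sandwich_apply, Matrix.mul_assoc]

theorem sandwich_one : sandwich (1 : Matrix a a ℂ) 1 = LinearMap.id := by
  ext1 X
  simp [sandwich_apply]

theorem sandwich_sum_smul {κ μ : Type} [Fintype κ] [Fintype μ] (u : κ → ℂ) (v : μ → ℂ)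
    (K : κ → Matrix a' a ℂ) (M : μ → Matrix a' a ℂ) :
    sandwich (∑ k, u k • K k) (∑ l, v l • M l) =
      ∑ p : κ × μ, (u p.1 * star (v p.2)) • sandwich (K p.1) (M p.2) := by
  refine LinearMap.ext fun X => ?_
  simp only [sandwich_apply, LinearMap.sum_apply, LinearMap.smul_apply, conjTranspose_sum,
    conjTranspose_smul, Matrix.mul_sum, Matrix.sum_mul, Matrix.smul_mul, Matrix.mul_smul,
    Fintype.sum_prod_type, Finset.smul_sum, mul_smul]
  rw [Finset.sum_comm]
  exact Finset.sum_congr rfl fun k _ => Finset.sum_congr rfl fun l _ => smul_comm _ _ _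

theorem superop_ext_single {E F : Superop a b} (h : ∀ p q, E (single p q 1) = F (single p q 1)) :
    E = F := by
  refine LinearMap.ext fun X => ?_
  rw [matrix_eq_sum_single X]
  simp only [map_sum]
  refine Finset.sum_congr rfl fun p _ => Finset.sum_congr rfl fun q _ => ?_
  rw [show single p q (X p q) = X p q • single p q (1 : ℂ) by simp, map_smul, map_smul, h]

theorem superop_ext_kronecker {E F : Superop (a × b) c} (h : ∀ X Y, E (X ⊗ₖ Y) = F (X ⊗ₖ Y)) :
    E = F := by
  refine superop_ext_single fun p q => ?_
  have : single p q (1 : ℂ) = single p.1 q.1 1 ⊗ₖ single p.2 q.2 1 := by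
    rw [single_kronecker_single]; simp
  rw [this, h]

theorem tensor_apply_single (E : Superop a a') (F : Superop b b') (p q : a × b) :
    tensor E F (single p q 1) = E (single p.1 q.1 1) ⊗ₖ F (single p.2 q.2 1) := by
  simp only [tensor, LinearMap.sum_apply, LinearMap.smulRight_apply, entryLinearMap_apply]
  rw [Finset.sum_eq_single p, Finset.sum_eq_single q]
  · simp
  · intro j _ hj
    simp [hj.symm]
  · simp
  · intro i _ hi
    refine Finset.sum_eq_zero fun j _ => ?_
    simp [hi.symm]
  · simp

/-- The Kronecker product of operators as a bilinear map. -/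
def kron (a b : Type) : Matrix a a ℂ →ₗ[ℂ] Matrix b b ℂ →ₗ[ℂ] Matrix (a × b) (a × b) ℂ :=
  kroneckerBilinear

theorem kron_apply (X : Matrix a a ℂ) (Y : Matrix b b ℂ) : kron a b X Y = X ⊗ₖ Y := rfl

theorem tensor_kronecker (E : Superop a a') (F : Superop b b') (X : Matrix a a ℂ)
    (Y : Matrix b b ℂ) : tensor E F (X ⊗ₖ Y) = E X ⊗ₖ F Y := by
  have h₁ : ∀ p q, tensor E F ∘ₗ kron a b (single p q 1) =
      kron a' b' (E (single p q 1)) ∘ₗ F := by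
    intro p q
    refine superop_ext_single fun r s => ?_
    simp only [LinearMap.comp_apply, kron_apply]
    rw [single_kronecker_single, one_mul, tensor_apply_single]
  have h₂ : ∀ p q, tensor E F (single p q 1 ⊗ₖ Y) = E (single p q 1) ⊗ₖ F Y := fun p q =>
    LinearMap.congr_fun (h₁ p q) Y
  have h₃ : tensor E F ∘ₗ (kron a b).flip Y =
      (kron a' b').flip (F Y) ∘ₗ E := by
    refine superop_ext_single fun r s => ?_
    simp only [LinearMap.comp_apply, LinearMap.flip_apply, kron_apply]
    exact h₂ r s
  exact LinearMap.congr_fun h₃ X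

theorem tensor_sandwich (K M : Matrix a' a ℂ) (K' M' : Matrix b' b ℂ) :
    tensor (sandwich K M) (sandwich K' M') = sandwich (K ⊗ₖ K') (M ⊗ₖ M') := by
  refine superop_ext_kronecker fun X Y => ?_
  rw [tensor_kronecker]
  simp only [sandwich_apply, conjTranspose_kronecker, mul_kronecker_mul]

theorem tensor_comp (E : Superop a' a'') (E' : Superop a a') (F : Superop b' b'')
    (F' : Superop b b') : tensor E F ∘ₗ tensor E' F' = tensor (E ∘ₗ E') (F ∘ₗ F') := by
  refine superop_ext_kronecker fun X Y => ?_
  simp [tensor_kronecker]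

theorem tensor_sum_smul {κ μ : Type} [Fintype κ] [Fintype μ] (u : κ → ℂ) (v : μ → ℂ)
    (E : κ → Superop a a') (F : μ → Superop b b') :
    tensor (∑ k, u k • E k) (∑ l, v l • F l) =
      ∑ p : κ × μ, (u p.1 * v p.2) • tensor (E p.1) (F p.2) := by
  refine superop_ext_kronecker fun X Y => ?_
  simp only [LinearMap.sum_apply, LinearMap.smul_apply, tensor_kronecker]
  simp only [← kron_apply, LinearMap.sum_apply, LinearMap.smul_apply, map_sum, map_smul,
    Fintype.sum_prod_type, Finset.smul_sum, mul_smul]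
  rw [Finset.sum_comm]
  exact Finset.sum_congr rfl fun k _ => Finset.sum_congr rfl fun l _ => smul_comm _ _ _

theorem tensor_id_id : tensor (LinearMap.id : Superop a a) (LinearMap.id : Superop b b) =
    LinearMap.id := by
  refine superop_ext_kronecker fun X Y => ?_
  simp [tensor_kronecker]

theorem traceOut_kronecker (X : Matrix a a ℂ) (Y : Matrix b b ℂ) :
    traceOut (X ⊗ₖ Y) = Y.trace • X := by
  ext i j
  simp [traceOut, trace, ← Finset.mul_sum, mul_comm]

theorem trace_traceOut (X : Matrix (a × b) (a × b) ℂ) : (traceOut X).trace = X.trace := by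
  simp [traceOut, trace, Fintype.sum_prod_type]

theorem isTP_tensor (E : Superop a a') (F : Superop b b') (hE : IsTP E) (hF : IsTP F) :
    IsTP (tensor E F) := by
  intro X
  rw [matrix_eq_sum_single X]
  simp only [map_sum, trace_sum]
  refine Finset.sum_congr rfl fun p _ => Finset.sum_congr rfl fun q _ => ?_
  rw [show single p q (X p q) = X p q • (single p.1 q.1 (1 : ℂ) ⊗ₖ single p.2 q.2 (1 : ℂ)) by
    rw [single_kronecker_single]; simp, map_smul, trace_smul, trace_smul, tensor_kronecker,
    trace_kronecker, trace_kronecker, hE, hF]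

end Sandwich

section Alternate

variable {h h' : Type}

theorem alternate_succ {n : ℕ} (g : Fin (n + 2) → Superop h h) (Bs : Fin (n + 1) → Superop h h) :
    alternate g Bs = g (Fin.last (n + 1)) ∘ₗ Bs (Fin.last n) ∘ₗ
      alternate (fun i => g i.castSucc) (fun j => Bs j.castSucc) := rfl

theorem alternate_smul : ∀ {n : ℕ} (c : Fin (n + 1) → ℂ) (g : Fin (n + 1) → Superop h h)
    (Bs : Fin n → Superop h h),
    alternate (fun j => c j • g j) Bs = (∏ j, c j) • alternate g Bs
  | 0, c, g, Bs => by simp [alternate]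
  | n + 1, c, g, Bs => by
    rw [alternate_succ, alternate_succ, alternate_smul, Fin.prod_univ_castSucc (n := n + 1)]
    simp only [LinearMap.comp_smul, LinearMap.smul_comp, smul_smul]

theorem alternate_sum {ι : Type} [Fintype ι] : ∀ {n : ℕ} (g : Fin (n + 1) → ι → Superop h h)
    (Bs : Fin n → Superop h h),
    alternate (fun j => ∑ i, g j i) Bs =
      ∑ x : Fin (n + 1) → ι, alternate (fun j => g j (x j)) Bs
  | 0, g, Bs => by
    simp only [alternate]
    exact (Fintype.sum_equiv (Equiv.funUnique (Fin 1) ι) _ _ fun x => by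
      simp [Equiv.funUnique]).symm
  | n + 1, g, Bs => by
    rw [alternate_succ, alternate_sum, ← (Fin.snocEquiv fun _ : Fin (n + 2) => ι).sum_comp,
      Fintype.sum_prod_type]
    refine LinearMap.ext fun X => ?_
    simp only [alternate_succ, Fin.snocEquiv, LinearMap.sum_apply, map_sum, LinearMap.comp_apply,
      Equiv.coe_fn_mk, Fin.snoc_castSucc, Fin.snoc_last]
    rw [Finset.sum_comm]

/-- With `alternate_comp_last`, this allows an operation placed in the first or last gate to be
pulled out of the circuit: later, the ancilla preparation and measurement. -/
theorem alternate_comp_first : ∀ {n : ℕ} (g : Fin (n + 1) → Superop h h)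
    (Bs : Fin n → Superop h h) (p : Superop h h),
    alternate (fun j => g j ∘ₗ if j = 0 then p else LinearMap.id) Bs = alternate g Bs ∘ₗ p
  | 0, g, Bs, p => by simp [alternate]
  | n + 1, g, Bs, p => by
    rw [alternate_succ, alternate_succ]
    have := alternate_comp_first (fun j => g j.castSucc) (fun j => Bs j.castSucc) p
    simp only [Fin.castSucc_eq_zero_iff, Fin.last_eq_zero_iff, Nat.add_eq_zero_iff, one_ne_zero,
      and_false, if_false, LinearMap.comp_id, LinearMap.comp_assoc] at this ⊢
    rw [this]

theorem alternate_comp_last {n : ℕ} (g : Fin (n + 1) → Superop h h)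
    (Bs : Fin n → Superop h h) (p : Superop h h) :
    alternate (fun j => (if j = Fin.last n then p else LinearMap.id) ∘ₗ g j) Bs =
      p ∘ₗ alternate g Bs := by
  cases n with
  | zero => simp [alternate]
  | succ n =>
    rw [alternate_succ, alternate_succ]
    simp [Fin.castSucc_ne_last, LinearMap.comp_assoc]

/-- Applied with `Φ X = X ⊗ |s⟩⟨t|`, this reduces a circuit with coherently controlled gates to one
circuit without ancillas for each ancilla matrix unit. -/
theorem alternate_intertwine (Φ : Superop h h') : ∀ {n : ℕ} (g : Fin (n + 1) → Superop h h)
    (g' : Fin (n + 1) → Superop h' h') (Bs : Fin n → Superop h h) (Bs' : Fin n → Superop h' h'),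
    (∀ j, g' j ∘ₗ Φ = Φ ∘ₗ g j) → (∀ j, Bs' j ∘ₗ Φ = Φ ∘ₗ Bs j) →
    alternate g' Bs' ∘ₗ Φ = Φ ∘ₗ alternate g Bs
  | 0, g, g', Bs, Bs', hg, _ => hg 0
  | n + 1, g, g', Bs, Bs', hg, hB => by
    rw [alternate_succ, alternate_succ, LinearMap.comp_assoc, LinearMap.comp_assoc,
      alternate_intertwine Φ _ _ _ _ (fun j => hg j.castSucc) (fun j => hB j.castSucc),
      ← LinearMap.comp_assoc _ _ (Bs' _), hB, LinearMap.comp_assoc, ← LinearMap.comp_assoc, hg]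
    rfl

end Alternate

section Subsystem

variable {h r s : Type} [Fintype h] [DecidableEq h] [Fintype r] [DecidableEq r]
  [Fintype s] [DecidableEq s]

theorem onSubsystem_sandwich (W : Matrix (s × r) h ℂ) (K M : Matrix s s ℂ) :
    onSubsystem W (sandwich K M) = sandwich (Wᴴ * (K ⊗ₖ (1 : Matrix r r ℂ)) * W)
      (Wᴴ * (M ⊗ₖ (1 : Matrix r r ℂ)) * W) := by
  rw [onSubsystem, ← sandwich_one, tensor_sandwich, conj_eq_sandwich, conj_eq_sandwich,
    sandwich_comp, sandwich_comp, Matrix.mul_assoc, Matrix.mul_assoc]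

theorem onSubsystem_sum_smul {κ : Type} [Fintype κ] (W : Matrix (s × r) h ℂ) (u : κ → ℂ)
    (E : κ → Superop s s) : onSubsystem W (∑ k, u k • E k) = ∑ k, u k • onSubsystem W (E k) := by
  have := tensor_sum_smul u (fun _ : Unit => 1) E (fun _ => (LinearMap.id : Superop r r))
  simp only [Finset.univ_unique, Finset.sum_singleton, one_smul, mul_one,
    Fintype.sum_prod_type] at this
  refine LinearMap.ext fun X => ?_
  simp [onSubsystem, this, LinearMap.sum_apply, map_sum]

theorem onSubsystem_comp {W : Matrix (s × r) h ℂ} (hW : W * Wᴴ = 1) (E F : Superop s s) :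
    onSubsystem W (E ∘ₗ F) = onSubsystem W E ∘ₗ onSubsystem W F := by
  have hid : conj W ∘ₗ conj Wᴴ = LinearMap.id := by
    rw [conj_eq_sandwich, conj_eq_sandwich, sandwich_comp, hW, sandwich_one]
  calc onSubsystem W (E ∘ₗ F)
      = conj Wᴴ ∘ₗ (tensor E LinearMap.id ∘ₗ tensor F LinearMap.id) ∘ₗ conj W := by
        rw [tensor_comp]; rfl
    _ = conj Wᴴ ∘ₗ (tensor E LinearMap.id ∘ₗ (conj W ∘ₗ conj Wᴴ) ∘ₗ tensor F LinearMap.id) ∘ₗ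
          conj W := by rw [hid, LinearMap.id_comp]
    _ = _ := rfl

theorem onSubsystem_id {W : Matrix (s × r) h ℂ} (hW : Wᴴ * W = 1) :
    onSubsystem W LinearMap.id = LinearMap.id := by
  rw [onSubsystem, tensor_id_id, LinearMap.id_comp, conj_eq_sandwich, conj_eq_sandwich,
    sandwich_comp, hW, sandwich_one]

end Subsystem

/-! ### Signed local maps and the upper bound for a single unitary. -/

section LocalInstruments

variable {a a' b b' : Type} [Fintype a] [DecidableEq a] [Fintype a'] [DecidableEq a']
  [Fintype b] [DecidableEq b] [Fintype b'] [DecidableEq b']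

theorem isCP_conj (K : Matrix a' a ℂ) : IsCP (conj K) := by
  intro k X hX
  rw [conj_eq_sandwich, ← sandwich_one, tensor_sandwich, sandwich_apply]
  exact hX.mul_mul_conjTranspose_same _

theorem isTP_sum_conj {ι : Type} [Fintype ι] {K : ι → Matrix a' a ℂ}
    (hK : ∑ i, (K i)ᴴ * K i = 1) : IsTP (∑ i, conj (K i)) := by
  intro X
  simp only [LinearMap.sum_apply, conj_eq_sandwich, sandwich_apply, trace_sum]
  have : ∀ i, (K i * X * (K i)ᴴ).trace = ((K i)ᴴ * K i * X).trace := by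
    intro i
    rw [Matrix.mul_assoc, trace_mul_comm, Matrix.mul_assoc X, trace_mul_comm]
  simp only [this, ← trace_sum, ← Matrix.sum_mul, hK, Matrix.one_mul]

theorem isInstrument_conj {ι : Type} [Fintype ι] {K : ι → Matrix a' a ℂ}
    (hK : ∑ i, (K i)ᴴ * K i = 1) : IsInstrument fun i => conj (K i) where
  countable := inferInstance
  cp i := isCP_conj _
  tp := ⟨∑ i, conj (K i), isTP_sum_conj hK, fun X => by
    rw [LinearMap.sum_apply]; exact hasSum_fintype _⟩

theorem isChannel_conj {K : Matrix a' a ℂ} (hK : Kᴴ * K = 1) : IsChannel (conj K) := by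
  refine ⟨isCP_conj K, ?_⟩
  simpa using isTP_sum_conj (ι := Unit) (K := fun _ => K) (by simpa using hK)

/-- Differences of the two maps of a two-outcome instrument given by two Kraus operators. -/
def IsSignedLocal (G : Superop a a) : Prop :=
  ∃ K : Fin 2 → Matrix a a ℂ, ∑ x, (K x)ᴴ * K x = 1 ∧ G = conj (K 0) - conj (K 1)

theorem IsSignedLocal.comp_conj {G : Superop a a} (hG : IsSignedLocal G) {V : Matrix a a ℂ}
    (hV : Vᴴ * V = 1) : IsSignedLocal (G ∘ₗ conj V) := by
  obtain ⟨K, hK, rfl⟩ := hG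
  refine ⟨fun x => K x * V, ?_, ?_⟩
  · have : ∀ x, (K x * V)ᴴ * (K x * V) = Vᴴ * ((K x)ᴴ * K x) * V := by
      intro x; simp only [conjTranspose_mul, Matrix.mul_assoc]
    simp only [this, ← Matrix.mul_sum, ← Matrix.sum_mul, hK, Matrix.mul_one, hV]
  · simp only [conj_eq_sandwich, ← sandwich_comp, LinearMap.sub_comp]

theorem isSignedLocal_id : IsSignedLocal (LinearMap.id : Superop a a) := by
  refine ⟨![1, 0], by simp, ?_⟩
  refine LinearMap.ext fun X => ?_
  simp [conj]

/-- Both parties measure, and the coefficient of a pair of outcomes is the product of their two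
signs. -/
theorem tensor_mem_LOStar {G : Superop a a} {H : Superop b b} (hG : IsSignedLocal G)
    (hH : IsSignedLocal H) : tensor G H ∈ LOStar a b := by
  obtain ⟨K, hK, rfl⟩ := hG
  obtain ⟨M, hM, rfl⟩ := hH
  let s : Fin 2 → ℝ := ![1, -1]
  refine ⟨Fin 2 × Fin 2, fun p => tensor (conj (K p.1)) (conj (M p.2)), fun p => s p.1 * s p.2,
    ⟨Fin 2, Fin 2, Equiv.refl _, fun i => conj (K i), fun i => conj (M i), isInstrument_conj hK,
      isInstrument_conj hM, fun _ => rfl⟩, ?_, fun X => ?_⟩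
  · rintro ⟨i, j⟩
    fin_cases i <;> fin_cases j <;> simp [s]
  · have h := tensor_sum_smul (fun i => (s i : ℂ)) (fun i => (s i : ℂ)) (fun i => conj (K i))
      (fun i => conj (M i))
    have h₁ : ∀ (K : Fin 2 → Matrix a a ℂ), conj (K 0) - conj (K 1) = ∑ i, (s i : ℂ) • conj (K i) := by
      intro K; rw [Fin.sum_univ_two]; simp only [s, cons_val_zero, cons_val_one]; push_cast; module
    have h₂ : ∀ (K : Fin 2 → Matrix b b ℂ), conj (K 0) - conj (K 1) = ∑ i, (s i : ℂ) • conj (K i) := by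
      intro K; rw [Fin.sum_univ_two]; simp only [s, cons_val_zero, cons_val_one]; push_cast; module
    rw [h₁, h₂, h]
    simp only [LinearMap.sum_apply, LinearMap.smul_apply, Complex.ofReal_mul]
    exact hasSum_fintype _

end LocalInstruments

section Extent

variable {a b EA EB : Type} [Fintype a] [DecidableEq a] [Fintype b] [DecidableEq b]
  [Fintype EA] [DecidableEq EA] [Fintype EB] [DecidableEq EB]

theorem extent_le {ι : Type} [Fintype ι] [Nonempty ι] {S : Set (Superop a b)} {E : Superop a b}
    (w : ι → ℝ) (F : ι → Superop a b) (hF : ∀ i, F i ∈ S) (hE : E = ∑ i, (w i : ℂ) • F i) :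
    extent S E ≤ ENNReal.ofReal (∑ i, |w i|) := by
  refine sInf_le ⟨Fintype.card ι, w ∘ (Fintype.equivFin ι).symm, F ∘ (Fintype.equivFin ι).symm,
    Fintype.card_pos, fun i => hF _, ?_, ?_⟩
  · rw [hE]
    exact ((Fintype.equivFin ι).symm.sum_comp fun i => (w i : ℂ) • F i).symm
  · rw [← (Fintype.equivFin ι).symm.sum_comp]
    rfl

theorem blackBoxExtent_le {ι : Type} [Fintype ι] [Nonempty ι]
    {DS : ∀ (x y : Type) [Fintype x] [DecidableEq x] [Fintype y] [DecidableEq y],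
      Set (Superop (x × y) (x × y))} {n : ℕ} {E : Fin (n + 1) → Superop (a × b) (a × b)}
    (a₀ : EA) (b₀ : EB) (w : ι → ℝ)
    (F : ι → Fin (n + 1) → Superop ((a × EA) × (b × EB)) ((a × EA) × (b × EB)))
    (hF : ∀ i j, F i j ∈ DS (a × EA) (b × EB))
    (h : IsBlackBoxQPD E a₀ b₀ (w ∘ (Fintype.equivFin ι).symm) (F ∘ (Fintype.equivFin ι).symm)) :
    blackBoxExtent DS E ≤ ENNReal.ofReal (∑ i, |w i|) := by
  refine sInf_le ⟨EA, EB, inferInstance, inferInstance, inferInstance, inferInstance, a₀, b₀,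
    Fintype.card ι, w ∘ (Fintype.equivFin ι).symm, F ∘ (Fintype.equivFin ι).symm,
    Fintype.card_pos, fun i j => hF _ j, h, ?_⟩
  rw [← (Fintype.equivFin ι).symm.sum_comp]
  rfl

end Extent

section Weights

variable {κ : Type} [Fintype κ] [DecidableEq κ]

/-- The coefficients of the quasiprobability decomposition of a unitary with Schmidt
coefficients `u`. -/
def schmidtWeight (u : κ → ℝ) (p : (κ × κ) × Fin 2) : ℝ :=
  if p.2 = 0 then u p.1.1 * u p.1.2 else if p.1.1 = p.1.2 then 0 else -(u p.1.1 * u p.1.2)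

/-- Each of the two phases contributes `(∑ u) ^ 2`, except that the second omits the diagonal, of
weight `∑ u ^ 2 = 1`. -/
theorem sum_abs_schmidtWeight {u : κ → ℝ} (hu : ∀ k, 0 ≤ u k) (h : ∑ k, u k ^ 2 = 1) :
    ∑ p, |schmidtWeight u p| = 2 * (∑ k, u k) ^ 2 - 1 := by
  have h₀ : ∀ k l, |u k * u l| = u k * u l := fun k l => abs_of_nonneg (mul_nonneg (hu k) (hu l))
  have h₁ : ∀ k l, |schmidtWeight u ((k, l), 0)| + |schmidtWeight u ((k, l), 1)| =
      2 * (u k * u l) - if k = l then u k * u l else 0 := by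
    intro k l
    simp only [schmidtWeight, if_true, one_ne_zero, if_false]
    split_ifs with hkl
    · rw [h₀]; simp; ring
    · rw [abs_neg, h₀]; ring
  rw [Fintype.sum_prod_type]
  simp only [Fin.sum_univ_two, h₁, Finset.sum_sub_distrib, Fintype.sum_prod_type,
    Finset.sum_ite_eq, Finset.mem_univ, if_true, ← Finset.mul_sum, ← pow_two, h]
  rw [← Finset.sum_mul, ← pow_two]

/-- The difference of the two phase settings is the symmetrised cross term, and the weights `u k * u
l` are symmetric, so symmetrisation disappears in the sum. By `hR` the omitted diagonal terms do not
matter. The lemma serves the parallel and the black box decompositions alike. -/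
theorem sum_schmidtWeight_smul {V : Type*} [AddCommGroup V] [Module ℂ V] (u : κ → ℝ)
    (T : κ → κ → V) (R : (κ × κ) × Fin 2 → V)
    (h : ∀ k l, R ((k, l), 0) - R ((k, l), 1) = (1 / 2 : ℂ) • (T k l + T l k))
    (hR : ∀ k, R ((k, k), 1) = 0) :
    ∑ p, (schmidtWeight u p : ℂ) • R p = ∑ p : κ × κ, ((u p.1 : ℂ) * u p.2) • T p.1 p.2 := by
  have h₁ : ∀ k l, (schmidtWeight u ((k, l), 0) : ℂ) • R ((k, l), 0) +
      (schmidtWeight u ((k, l), 1) : ℂ) • R ((k, l), 1) =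
      (1 / 2 : ℂ) • (((u k : ℂ) * u l) • T k l) + (1 / 2 : ℂ) • (((u l : ℂ) * u k) • T l k) := by
    intro k l
    rw [smul_smul, smul_smul, mul_comm (u l : ℂ), ← smul_add,
      mul_comm _ ((u k : ℂ) * u l), mul_smul, ← h]
    by_cases hkl : k = l
    · subst hkl; simp [schmidtWeight, hR]
    · simp [schmidtWeight, hkl, sub_eq_add_neg]
  rw [Fintype.sum_prod_type]
  simp only [Fin.sum_univ_two, Fintype.sum_prod_type, h₁, Finset.sum_add_distrib,
    ← Finset.smul_sum]
  rw [Finset.sum_comm (f := fun k l => ((u l : ℂ) * u k) • T l k), ← add_smul]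
  norm_num

end Weights

section SchmidtUpperBound

variable {a b κ : Type} [Fintype a] [DecidableEq a] [Fintype b] [DecidableEq b] [Fintype κ]
  [DecidableEq κ]

/-- The phases `1` and `i`. -/
noncomputable def cutPhase : Fin 2 → ℂ := ![1, Complex.I]

theorem cutPhase_mul_star (τ : Fin 2) : cutPhase τ * star (cutPhase τ) = 1 := by
  fin_cases τ <;> simp [cutPhase]

/-- The Hermitian part of `c* K · M†`, as a difference of two completely positive maps. -/
noncomputable def crossMap (τ : Fin 2) (K M : Matrix a a ℂ) : Superop a a :=
  conj ((1 / 2 : ℂ) • (K + cutPhase τ • M)) - conj ((1 / 2 : ℂ) • (K - cutPhase τ • M))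

theorem crossMap_eq (τ : Fin 2) (K M : Matrix a a ℂ) : crossMap τ K M =
    ∑ x : Fin 2, ((1 / 2 : ℂ) * if x = 0 then star (cutPhase τ) else cutPhase τ) •
      if x = 0 then sandwich K M else sandwich M K := by
  refine LinearMap.ext fun X => ?_
  simp only [crossMap, conj_eq_sandwich, sandwich_apply, LinearMap.sub_apply, Fin.sum_univ_two,
    LinearMap.add_apply, LinearMap.smul_apply, if_true, one_ne_zero, if_false, conjTranspose_smul,
    conjTranspose_add, conjTranspose_sub, Matrix.smul_mul, Matrix.mul_smul, Matrix.add_mul,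
    Matrix.mul_add, Matrix.sub_mul, Matrix.mul_sub, smul_add, smul_sub, smul_smul]
  norm_num
  module

/-- By the parallelogram identity the cross terms cancel in `(K + cM)†(K + cM) + (K - cM)†(K - cM) =
2 (K†K + M†M)`, which is `4` for unitary `K` and `M`. -/
theorem isSignedLocal_crossMap (τ : Fin 2) {K M : Matrix a a ℂ} (hK : Kᴴ * K = 1)
    (hM : Mᴴ * M = 1) : IsSignedLocal (crossMap τ K M) := by
  refine ⟨![(1 / 2 : ℂ) • (K + cutPhase τ • M), (1 / 2 : ℂ) • (K - cutPhase τ • M)], ?_, rfl⟩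
  have h := cutPhase_mul_star τ
  have h₂ : star (1 / 2 : ℂ) = 1 / 2 := by simp
  simp only [Fin.sum_univ_two, cons_val_zero, cons_val_one, conjTranspose_smul, conjTranspose_add,
    conjTranspose_sub, h₂, Matrix.smul_mul, Matrix.mul_smul, Matrix.add_mul,
    Matrix.mul_add, Matrix.sub_mul, Matrix.mul_sub, smul_add, smul_sub, smul_smul, hK, hM, mul_assoc]
  have h₃ : (1 / 2 * (cutPhase τ * star (1 / 2 * cutPhase τ)) : ℂ) = 1 / 4 := by
    rw [star_mul, h₂]
    linear_combination (1 / 4 : ℂ) * h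
  rw [h₃]
  module

/-- Switching the phase from `1` to `i` reverses the sign of the wanted terms, where both parties
use the same branch, and keeps the mixed terms. Subtracting the two settings removes the latter. -/
theorem tensor_crossMap (τ : Fin 2) (K M : Matrix a a ℂ) (K' M' : Matrix b b ℂ) :
    tensor (crossMap τ K M) (crossMap τ K' M') = (1 / 4 : ℂ) •
      ((if τ = 0 then 1 else -1 : ℂ) •
        (sandwich (K ⊗ₖ K') (M ⊗ₖ M') + sandwich (M ⊗ₖ M') (K ⊗ₖ K')) +
        (sandwich (K ⊗ₖ M') (M ⊗ₖ K') + sandwich (M ⊗ₖ K') (K ⊗ₖ M'))) := by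
  rw [crossMap_eq, crossMap_eq, tensor_sum_smul]
  simp only [Fintype.sum_prod_type, Fin.sum_univ_two, if_true,
    one_ne_zero, if_false, tensor_sandwich]
  have hI : Complex.I * Complex.I = -1 := Complex.I_mul_I
  fin_cases τ
  · simp [cutPhase]
    module
  · simp [cutPhase]
    have e₁ : ∀ x : ℂ, x * Complex.I * (x * Complex.I) = -(x * x) := by
      intro x; linear_combination x * x * hI
    simp [e₁]
    module

theorem IsUnitarySchmidt.extent_conj_le {U : Matrix (a × b) (a × b) ℂ} {u : κ → ℝ}
    {L : κ → Matrix a a ℂ} {R : κ → Matrix b b ℂ} [Nonempty κ] (h : IsUnitarySchmidt U u L R) :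
    extent (LOStar a b) (conj U) ≤ ENNReal.ofReal (2 * (∑ k, u k) ^ 2 - 1) := by
  rw [← sum_abs_schmidtWeight h.nonneg h.sum_sq]
  refine extent_le _ (fun p => tensor (crossMap p.2 (L p.1.1) (L p.1.2))
    (crossMap p.2 (R p.1.1) (R p.1.2))) (fun p => tensor_mem_LOStar
      (isSignedLocal_crossMap _ (h.left_unitary _) (h.left_unitary _))
      (isSignedLocal_crossMap _ (h.right_unitary _) (h.right_unitary _))) ?_
  rw [sum_schmidtWeight_smul u (fun k l => sandwich (L k ⊗ₖ R k) (L l ⊗ₖ R l))]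
  · rw [conj_eq_sandwich, h.eq_sum, sandwich_sum_smul]
    simp
  · intro k l
    simp only [tensor_crossMap, if_true, one_ne_zero, if_false]
    module
  · intro k
    simp only [tensor_crossMap, one_ne_zero, if_false]
    module

end SchmidtUpperBound

/-! ### Tensor products of Schmidt decompositions. -/

section TensorPower

variable {a b κ : Type} [Fintype a] [DecidableEq a] [Fintype b] [DecidableEq b] [Fintype κ]
  [DecidableEq κ] {N : ℕ}

/-- The tensor product of a finite family of operators. -/
def piKron (M : Fin N → Matrix a a ℂ) : Matrix (Fin N → a) (Fin N → a) ℂ :=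
  of fun x y => ∏ i, M i (x i) (y i)

theorem prod_sum_pi {R : Type*} [CommSemiring R] (f : Fin N → κ → R) :
    ∏ i, ∑ k, f i k = ∑ x : Fin N → κ, ∏ i, f i (x i) := by
  rw [Finset.prod_univ_sum, Fintype.piFinset_univ]

theorem piKron_mul (M M' : Fin N → Matrix a a ℂ) :
    piKron M * piKron M' = piKron fun i => M i * M' i := by
  ext x y
  simp only [piKron, mul_apply, of_apply, prod_sum_pi, Finset.prod_mul_distrib]

theorem piKron_conjTranspose (M : Fin N → Matrix a a ℂ) :
    (piKron M)ᴴ = piKron fun i => (M i)ᴴ := by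
  ext x y
  simp [piKron, conjTranspose_apply]

theorem piKron_one : piKron (fun _ : Fin N => (1 : Matrix a a ℂ)) = 1 := by
  ext x y
  simp only [piKron, of_apply, one_apply, Finset.prod_ite_zero, Finset.prod_const_one,
    Finset.mem_univ, true_implies, funext_iff]

theorem trace_piKron (M : Fin N → Matrix a a ℂ) : (piKron M).trace = ∏ i, (M i).trace := by
  simp only [trace, diag_apply, prod_sum_pi, piKron, of_apply]

/-- The tensor product of a finite family of bipartite operators, with the halves collected. -/
def bipartiteKron (U : Fin N → Matrix (a × b) (a × b) ℂ) :
    Matrix ((Fin N → a) × (Fin N → b)) ((Fin N → a) × (Fin N → b)) ℂ :=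
  of fun x y => ∏ i, U i (x.1 i, x.2 i) (y.1 i, y.2 i)

theorem bipartiteKron_eq_submatrix (U : Fin N → Matrix (a × b) (a × b) ℂ) :
    bipartiteKron U = (piKron U).submatrix (Equiv.arrowProdEquivProdArrow _ _ _).symm
      (Equiv.arrowProdEquivProdArrow _ _ _).symm := rfl

theorem tensorFamily_conj (U : Fin N → Matrix (a × b) (a × b) ℂ) :
    tensorFamily (fun i => conj (U i)) = conj (bipartiteKron U) := by
  refine superop_ext_single fun p q => ?_
  simp only [tensorFamily, LinearMap.sum_apply, LinearMap.smulRight_apply, entryLinearMap_apply]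
  rw [Finset.sum_eq_single p, Finset.sum_eq_single q]
  · ext x y
    simp [conj_eq_sandwich, sandwich_apply_single, bipartiteKron, Finset.prod_mul_distrib]
  · intro j _ hj
    simp [hj.symm]
  · simp
  · intro i _ hi
    refine Finset.sum_eq_zero fun j _ => ?_
    simp [hi.symm]
  · simp

theorem IsUnitarySchmidt.bipartiteKron {U : Fin N → Matrix (a × b) (a × b) ℂ}
    {u : Fin N → κ → ℝ} {L : Fin N → κ → Matrix a a ℂ} {R : Fin N → κ → Matrix b b ℂ}
    (h : ∀ i, IsUnitarySchmidt (U i) (u i) (L i) (R i)) :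
    IsUnitarySchmidt (bipartiteKron U) (fun k : Fin N → κ => ∏ i, u i (k i))
      (fun k => piKron fun i => L i (k i)) (fun k => piKron fun i => R i (k i)) where
  nonneg k := Finset.prod_nonneg fun i _ => (h i).nonneg _
  sum_sq := by
    simp only [← Finset.prod_pow]
    rw [← prod_sum_pi fun i k => u i k ^ 2]
    simp [(h _).sum_sq]
  left_unitary k := by
    simp only [piKron_conjTranspose, piKron_mul, (h _).left_unitary, piKron_one]
  right_unitary k := by
    simp only [piKron_conjTranspose, piKron_mul, (h _).right_unitary, piKron_one]
  left_orthogonal k l := by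
    simp only [piKron_conjTranspose, piKron_mul, trace_piKron, (h _).left_orthogonal,
      Finset.prod_ite_zero, Finset.mem_univ, true_implies, funext_iff]
    simp
  right_orthogonal k l := by
    simp only [piKron_conjTranspose, piKron_mul, trace_piKron, (h _).right_orthogonal,
      Finset.prod_ite_zero, Finset.mem_univ, true_implies, funext_iff]
    simp
  eq_sum := by
    ext x y
    simp only [CircuitCut.bipartiteKron, of_apply, (h _).eq_sum, Matrix.sum_apply,
      Matrix.smul_apply, kroneckerMap_apply, smul_eq_mul, prod_sum_pi, piKron, Complex.ofReal_prod,
      Finset.prod_mul_distrib]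

end TensorPower

/-! ### Black box upper bound: controlled gates with coherent ancilla qubits. -/

section Frames

variable {a b A B RA RB EA EB h s : Type} [Fintype a] [DecidableEq a] [Fintype b] [DecidableEq b]
  [Fintype A] [DecidableEq A] [Fintype B] [DecidableEq B] [Fintype RA] [DecidableEq RA]
  [Fintype RB] [DecidableEq RB] [Fintype EA] [DecidableEq EA] [Fintype EB] [DecidableEq EB]
  [Fintype h] [DecidableEq h] [Fintype s] [DecidableEq s]

theorem submatrix_conjTranspose_mul_mul (N : Matrix s h ℂ) {t : Type} [Fintype t] [DecidableEq t]
    (σ : t ≃ s) (M : Matrix t t ℂ) :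
    (N.submatrix σ id)ᴴ * M * N.submatrix σ id = Nᴴ * M.submatrix σ.symm σ.symm * N := by
  have hM : M = (M.submatrix σ.symm σ.symm).submatrix σ σ := by simp
  conv_lhs => rw [hM]
  rw [conjTranspose_submatrix, submatrix_mul_equiv, submatrix_mul_equiv, submatrix_id_id]

/-- The reordering of tensor factors in `gateFrame`. -/
def gateEquiv (a b RA RB : Type) : (a × b) × (RA × RB) ≃ (a × RA) × (b × RB) :=
  Equiv.prodProdProdComm _ _ _ _

/-- The reordering of tensor factors in `cutFrame`. -/
def cutEquiv (a b RA RB EA EB : Type) :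
    ((a × EA) × (b × EB)) × (RA × RB) ≃ ((a × RA) × (b × RB)) × (EA × EB) where
  toFun x := (((x.1.1.1, x.2.1), (x.1.2.1, x.2.2)), (x.1.1.2, x.1.2.2))
  invFun y := (((y.1.1.1, y.2.1), (y.1.2.1, y.2.2)), (y.1.1.2, y.1.2.2))
  left_inv _ := rfl
  right_inv _ := rfl

theorem gateFrame_eq (VA : Matrix (a × RA) A ℂ) (VB : Matrix (b × RB) B ℂ) :
    gateFrame VA VB = (VA ⊗ₖ VB).submatrix (gateEquiv a b RA RB) id := rfl

theorem cutFrame_eq (VA : Matrix (a × RA) A ℂ) (VB : Matrix (b × RB) B ℂ) :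
    cutFrame EA EB VA VB = ((VA ⊗ₖ VB) ⊗ₖ (1 : Matrix (EA × EB) (EA × EB) ℂ)).submatrix
      (cutEquiv a b RA RB EA EB) id := rfl

theorem gateFrame_conj (VA : Matrix (a × RA) A ℂ) (VB : Matrix (b × RB) B ℂ)
    (X : Matrix a a ℂ) (Y : Matrix b b ℂ) :
    (gateFrame VA VB)ᴴ * ((X ⊗ₖ Y) ⊗ₖ (1 : Matrix (RA × RB) (RA × RB) ℂ)) * gateFrame VA VB =
      (VAᴴ * (X ⊗ₖ (1 : Matrix RA RA ℂ)) * VA) ⊗ₖ (VBᴴ * (Y ⊗ₖ (1 : Matrix RB RB ℂ)) * VB) := by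
  rw [gateFrame_eq, submatrix_conjTranspose_mul_mul]
  have : ((X ⊗ₖ Y) ⊗ₖ (1 : Matrix (RA × RB) (RA × RB) ℂ)).submatrix (gateEquiv a b RA RB).symm
      (gateEquiv a b RA RB).symm = (X ⊗ₖ (1 : Matrix RA RA ℂ)) ⊗ₖ (Y ⊗ₖ (1 : Matrix RB RB ℂ)) := by
    rw [← one_kronecker_one]
    ext x y
    simp only [gateEquiv, Equiv.prodProdProdComm, kroneckerMap_apply, submatrix_apply,
      Equiv.coe_fn_symm_mk]
    ring
  rw [this, conjTranspose_kronecker, mul_kronecker_mul, mul_kronecker_mul]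

theorem cutFrame_conj (VA : Matrix (a × RA) A ℂ) (VB : Matrix (b × RB) B ℂ)
    (X : Matrix a a ℂ) (Y : Matrix b b ℂ) (P : Matrix EA EA ℂ) (Q : Matrix EB EB ℂ) :
    (cutFrame EA EB VA VB)ᴴ * (((X ⊗ₖ P) ⊗ₖ (Y ⊗ₖ Q)) ⊗ₖ (1 : Matrix (RA × RB) (RA × RB) ℂ)) *
      cutFrame EA EB VA VB =
      ((gateFrame VA VB)ᴴ * ((X ⊗ₖ Y) ⊗ₖ (1 : Matrix (RA × RB) (RA × RB) ℂ)) *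
        gateFrame VA VB) ⊗ₖ (P ⊗ₖ Q) := by
  rw [gateFrame_conj, cutFrame_eq, submatrix_conjTranspose_mul_mul]
  have : (((X ⊗ₖ P) ⊗ₖ (Y ⊗ₖ Q)) ⊗ₖ (1 : Matrix (RA × RB) (RA × RB) ℂ)).submatrix
      (cutEquiv a b RA RB EA EB).symm (cutEquiv a b RA RB EA EB).symm =
      ((X ⊗ₖ (1 : Matrix RA RA ℂ)) ⊗ₖ (Y ⊗ₖ (1 : Matrix RB RB ℂ))) ⊗ₖ (P ⊗ₖ Q) := by
    rw [← one_kronecker_one]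
    ext x y
    simp only [cutEquiv, kroneckerMap_apply, submatrix_apply, Equiv.coe_fn_symm_mk]
    ring
  rw [this, conjTranspose_kronecker, conjTranspose_kronecker, conjTranspose_one,
    mul_kronecker_mul, mul_kronecker_mul, ← mul_kronecker_mul, ← mul_kronecker_mul,
    ← mul_kronecker_mul, ← mul_kronecker_mul, Matrix.one_mul, Matrix.mul_one]

theorem gateFrame_conjTranspose_mul {VA : Matrix (a × RA) A ℂ} {VB : Matrix (b × RB) B ℂ}
    (hA : IsUnitaryMap VA) (hB : IsUnitaryMap VB) :
    (gateFrame VA VB)ᴴ * gateFrame VA VB = 1 := by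
  have := gateFrame_conj VA VB 1 1
  simpa [one_kronecker_one, hA.1, hB.1] using this

theorem cutFrame_mul_conjTranspose {VA : Matrix (a × RA) A ℂ} {VB : Matrix (b × RB) B ℂ}
    (hA : IsUnitaryMap VA) (hB : IsUnitaryMap VB) :
    cutFrame EA EB VA VB * (cutFrame EA EB VA VB)ᴴ = 1 := by
  rw [cutFrame_eq, conjTranspose_submatrix, ← submatrix_mul _ _ _ _ _ Function.bijective_id,
    conjTranspose_kronecker, conjTranspose_kronecker, ← mul_kronecker_mul, ← mul_kronecker_mul,
    hA.2, hB.2, conjTranspose_one, Matrix.one_mul, one_kronecker_one, one_kronecker_one,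
    submatrix_one_equiv]

theorem cutFrame_conjTranspose_mul {VA : Matrix (a × RA) A ℂ} {VB : Matrix (b × RB) B ℂ}
    (hA : IsUnitaryMap VA) (hB : IsUnitaryMap VB) :
    (cutFrame EA EB VA VB)ᴴ * cutFrame EA EB VA VB = 1 := by
  have := cutFrame_conj (EA := EA) (EB := EB) VA VB 1 1 1 1
  simpa [one_kronecker_one, gateFrame_conjTranspose_mul hA hB] using this

/-- Product operators on gate systems and ancillas separate: the embedding concerns only the gate
systems and the ancilla factor passes through unchanged. -/
theorem onSubsystem_cutFrame (VA : Matrix (a × RA) A ℂ) (VB : Matrix (b × RB) B ℂ)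
    (X X' : Matrix a a ℂ) (Y Y' : Matrix b b ℂ) (P P' : Matrix EA EA ℂ) (Q Q' : Matrix EB EB ℂ) :
    onSubsystem (cutFrame EA EB VA VB)
      (tensor (sandwich (X ⊗ₖ P) (X' ⊗ₖ P')) (sandwich (Y ⊗ₖ Q) (Y' ⊗ₖ Q'))) =
    tensor (onSubsystem (gateFrame VA VB) (sandwich (X ⊗ₖ Y) (X' ⊗ₖ Y')))
      (sandwich (P ⊗ₖ Q) (P' ⊗ₖ Q')) := by
  rw [tensor_sandwich, onSubsystem_sandwich, onSubsystem_sandwich, cutFrame_conj, cutFrame_conj,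
    tensor_sandwich]

/-- A pair of gates controlled by an ancilla qubit. -/
def controlled (K : Fin 2 → Matrix a a ℂ) : Matrix (a × Fin 2) (a × Fin 2) ℂ :=
  ∑ e, K e ⊗ₖ single e e 1

theorem controlled_conjTranspose_mul {K : Fin 2 → Matrix a a ℂ} (hK : ∀ e, (K e)ᴴ * K e = 1) :
    (controlled K)ᴴ * controlled K = 1 := by
  simp only [controlled, Fin.sum_univ_two, conjTranspose_add, conjTranspose_kronecker,
    conjTranspose_single, star_one, Matrix.add_mul, Matrix.mul_add, ← mul_kronecker_mul,
    single_mul_single_same, hK, mul_one]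
  rw [single_mul_single_of_ne, single_mul_single_of_ne] <;> simp
  rw [← kronecker_add, ← one_kronecker_one]
  congr 1
  ext i j
  fin_cases i <;> fin_cases j <;> simp

/-- On the ancilla block `|s⟩⟨t|` the row index `s` selects the gates acting from the left and `t`
those acting from the right. The block itself is preserved, so coherence survives from one gate to
the next. -/
theorem onSubsystem_controlled (VA : Matrix (a × RA) A ℂ) (VB : Matrix (b × RB) B ℂ)
    (K : Fin 2 → Matrix a a ℂ) (M : Fin 2 → Matrix b b ℂ) (s t : Fin 2 × Fin 2)
    (X : Matrix (A × B) (A × B) ℂ) :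
    onSubsystem (cutFrame (Fin 2) (Fin 2) VA VB)
      (tensor (conj (controlled K)) (conj (controlled M))) (X ⊗ₖ single s t 1) =
    onSubsystem (gateFrame VA VB) (sandwich (K s.1 ⊗ₖ M s.2) (K t.1 ⊗ₖ M t.2)) X ⊗ₖ
      single s t 1 := by
  have hc : ∀ {c : Type} [Fintype c] [DecidableEq c] (K : Fin 2 → Matrix c c ℂ),
      conj (controlled K) = ∑ p : Fin 2 × Fin 2, (1 : ℂ) •
        sandwich (K p.1 ⊗ₖ single p.1 p.1 1) (K p.2 ⊗ₖ single p.2 p.2 1) := by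
    intro c _ _ K
    have := sandwich_sum_smul (fun _ : Fin 2 => (1 : ℂ)) (fun _ : Fin 2 => (1 : ℂ))
      (fun e => K e ⊗ₖ single e e (1 : ℂ)) (fun e => K e ⊗ₖ single e e (1 : ℂ))
    simpa [controlled, conj_eq_sandwich] using this
  rw [hc, hc, tensor_sum_smul, onSubsystem_sum_smul]
  simp only [onSubsystem_cutFrame, LinearMap.sum_apply, mul_one, one_smul,
    tensor_kronecker]
  rw [Finset.sum_eq_single ((s.1, t.1), (s.2, t.2))]
  · congr 1
    simp [sandwich_apply, single_kronecker_single]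
  · rintro ⟨⟨x, y⟩, ⟨z, w⟩⟩ _ hne
    have : sandwich (single x x (1 : ℂ) ⊗ₖ single z z (1 : ℂ))
        (single y y (1 : ℂ) ⊗ₖ single w w (1 : ℂ)) (single s t 1) = 0 := by
      rw [sandwich_apply, single_kronecker_single, single_kronecker_single, conjTranspose_single]
      by_cases h₁ : (x, z) = s
      · by_cases h₂ : t = (y, w)
        · subst h₁ h₂
          exact absurd rfl hne
        · rw [Matrix.mul_assoc, single_mul_single_of_ne _ _ _ _ h₂, Matrix.mul_zero]
      · rw [single_mul_single_of_ne _ _ _ _ h₁, Matrix.zero_mul]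
    rw [this, kronecker_zero]
  · simp

end Frames

section BlackBoxUpperBound

variable {a b κ : Type} [Fintype a] [DecidableEq a] [Fintype b] [DecidableEq b] [Fintype κ]
  [DecidableEq κ]

/-- The unitary preparing the ancilla state `(|0⟩ + c |1⟩) / √2` from `|0⟩`. -/
noncomputable def prepare (τ : Fin 2) : Matrix (Fin 2) (Fin 2) ℂ :=
  ((√2)⁻¹ : ℂ) • !![1, 1; cutPhase τ, -cutPhase τ]

/-- The Kraus operators of the measurement of the ancilla in the basis `(|0⟩ ± |1⟩) / √2`. -/
noncomputable def measure : Fin 2 → Matrix (Fin 2) (Fin 2) ℂ :=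
  ![((√2)⁻¹ : ℂ) • !![1, 1; 0, 0], ((√2)⁻¹ : ℂ) • !![0, 0; 1, -1]]

theorem inv_sqrt_two_mul_self : ((√2)⁻¹ : ℂ) * ((√2)⁻¹ : ℂ) = 1 / 2 := by
  rw [← mul_inv, ← Complex.ofReal_mul, Real.mul_self_sqrt (by norm_num)]
  norm_num

theorem star_inv_sqrt_two : star ((√2)⁻¹ : ℂ) = ((√2)⁻¹ : ℂ) := by
  simp

theorem prepare_conjTranspose_mul (τ : Fin 2) : (prepare τ)ᴴ * prepare τ = 1 := by
  have h := cutPhase_mul_star τ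
  rw [prepare, conjTranspose_smul, Matrix.smul_mul, Matrix.mul_smul, smul_smul,
    star_inv_sqrt_two, inv_sqrt_two_mul_self]
  generalize cutPhase τ = c at h
  have h' : (starRingEnd ℂ) c * c = 1 := by rw [mul_comm]; exact h
  ext i j
  fin_cases i <;> fin_cases j <;> simp [mul_apply, Fin.sum_univ_two, h'] <;> norm_num

theorem sum_measure_conjTranspose_mul : ∑ x, (measure x)ᴴ * measure x = 1 := by
  rw [Fin.sum_univ_two]
  simp only [measure, cons_val_zero, cons_val_one, conjTranspose_smul, Matrix.smul_mul,
    Matrix.mul_smul, smul_smul, star_inv_sqrt_two, inv_sqrt_two_mul_self]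
  ext i j
  fin_cases i <;> fin_cases j <;> simp [mul_apply, Fin.sum_univ_two] <;> norm_num

/-- The signed measurement of the ancilla. -/
noncomputable def signedMeasure : Superop (Fin 2) (Fin 2) := conj (measure 0) - conj (measure 1)

/-- Since `⟨+|Y|+⟩ - ⟨-|Y|-⟩ = Y₀₁ + Y₁₀`, the signed measurement keeps exactly the coherences
between the two branches. -/
theorem trace_signedMeasure (s t : Fin 2) :
    (signedMeasure (single s t 1)).trace = if s = t then 0 else 1 := by
  have h := inv_sqrt_two_mul_self
  have hs := star_inv_sqrt_two
  simp only [signedMeasure, LinearMap.sub_apply, trace, diag_apply, Fin.sum_univ_two,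
    Matrix.sub_apply, conj_eq_sandwich, sandwich_apply_single, measure, cons_val_zero,
    cons_val_one, Matrix.smul_apply, smul_eq_mul, star_mul, hs]
  fin_cases s <;> fin_cases t <;> simp <;> grind

theorem tensor_left_sum_smul {c c' d d' : Type} [Fintype c] [DecidableEq c] [Fintype c']
    [DecidableEq c'] [Fintype d] [DecidableEq d] [Fintype d'] [DecidableEq d'] {μ : Type} [Fintype μ]
    (E : Superop c c') (v : μ → ℂ) (F : μ → Superop d d') :
    tensor E (∑ l, v l • F l) = ∑ l, v l • tensor E (F l) := by
  have := tensor_sum_smul (fun _ : Unit => 1) v (fun _ => E) F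
  simpa [Fintype.sum_prod_type] using this

theorem signedMeasure_eq :
    signedMeasure = ∑ x : Fin 2, ((-1) ^ (x : ℕ) : ℂ) • sandwich (measure x) (measure x) := by
  rw [Fin.sum_univ_two, signedMeasure, conj_eq_sandwich, conj_eq_sandwich]
  simp only [Fin.val_zero, Fin.val_one, pow_zero, pow_one]
  module

theorem tensor_signedMeasure : tensor signedMeasure signedMeasure = ∑ p : Fin 2 × Fin 2,
    ((-1) ^ (p.1 : ℕ) * (-1) ^ (p.2 : ℕ) : ℂ) • sandwich (measure p.1 ⊗ₖ measure p.2)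
      (measure p.1 ⊗ₖ measure p.2) := by
  rw [signedMeasure_eq, tensor_sum_smul]
  simp only [tensor_sandwich]

theorem tensor_id_signedMeasure {c : Type} [Fintype c] [DecidableEq c] :
    tensor (LinearMap.id : Superop c c) signedMeasure = ∑ x : Fin 2, ((-1) ^ (x : ℕ) : ℂ) •
      sandwich ((1 : Matrix c c ℂ) ⊗ₖ measure x) ((1 : Matrix c c ℂ) ⊗ₖ measure x) := by
  rw [signedMeasure_eq, tensor_left_sum_smul]
  simp only [← sandwich_one, tensor_sandwich]

/-- The local operation at step `j` of the black box decomposition. -/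
noncomputable def cutStep {n : ℕ} (τ : Fin 2) (j : Fin (n + 1)) (K : Fin 2 → Matrix a a ℂ) :
    Superop (a × Fin 2) (a × Fin 2) :=
  (if j = Fin.last n then tensor LinearMap.id signedMeasure else LinearMap.id) ∘ₗ
    (conj (controlled K) ∘ₗ
      if j = 0 then conj ((1 : Matrix a a ℂ) ⊗ₖ prepare τ) else LinearMap.id)

/-- Preparation and controlled gate are unitary. Only the last step contains a measurement, and it
alone carries a sign. -/
theorem isSignedLocal_cutStep {n : ℕ} (τ : Fin 2) (j : Fin (n + 1)) {K : Fin 2 → Matrix a a ℂ}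
    (hK : ∀ e, (K e)ᴴ * K e = 1) : IsSignedLocal (cutStep τ j K) := by
  have h₁ : IsSignedLocal (if j = Fin.last n then tensor (LinearMap.id : Superop a a) signedMeasure
      else LinearMap.id) := by
    by_cases hj : j = Fin.last n
    · rw [if_pos hj]
      refine ⟨fun x => (1 : Matrix a a ℂ) ⊗ₖ measure x, ?_, ?_⟩
      · have : ∀ x, ((1 : Matrix a a ℂ) ⊗ₖ measure x)ᴴ * ((1 : Matrix a a ℂ) ⊗ₖ measure x) =
            kron a (Fin 2) 1 ((measure x)ᴴ * measure x) := by
          intro x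
          rw [conjTranspose_kronecker, ← mul_kronecker_mul, conjTranspose_one, Matrix.one_mul,
            kron_apply]
        simp only [this]
        rw [← map_sum, sum_measure_conjTranspose_mul, kron_apply, one_kronecker_one]
      · rw [tensor_id_signedMeasure, Fin.sum_univ_two]
        simp only [Fin.val_zero, Fin.val_one, pow_zero, pow_one, conj_eq_sandwich]
        module
    · rw [if_neg hj]
      exact isSignedLocal_id
  rw [cutStep, ← LinearMap.comp_assoc]
  have h₂ := h₁.comp_conj (controlled_conjTranspose_mul hK)
  by_cases hj : j = 0
  · rw [if_pos hj]
    refine h₂.comp_conj ?_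
    rw [conjTranspose_kronecker, ← mul_kronecker_mul, prepare_conjTranspose_mul]
    simp
  · rw [if_neg hj]
    exact h₂

variable {A B RA RB : Type} [Fintype A] [DecidableEq A] [Fintype B] [DecidableEq B]
  [Fintype RA] [DecidableEq RA] [Fintype RB] [DecidableEq RB]

theorem onSubsystem_tensor_cutStep {VA : Matrix (a × RA) A ℂ} {VB : Matrix (b × RB) B ℂ}
    (hA : IsUnitaryMap VA) (hB : IsUnitaryMap VB) {n : ℕ} (τ : Fin 2) (j : Fin (n + 1))
    (K : Fin 2 → Matrix a a ℂ) (M : Fin 2 → Matrix b b ℂ) :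
    onSubsystem (cutFrame (Fin 2) (Fin 2) VA VB) (tensor (cutStep τ j K) (cutStep τ j M)) =
      (if j = Fin.last n then tensor LinearMap.id (tensor signedMeasure signedMeasure)
        else LinearMap.id) ∘ₗ
      (onSubsystem (cutFrame (Fin 2) (Fin 2) VA VB)
        (tensor (conj (controlled K)) (conj (controlled M))) ∘ₗ
      if j = 0 then tensor LinearMap.id (tensor (conj (prepare τ)) (conj (prepare τ)))
        else LinearMap.id) := by
  have hid : onSubsystem (gateFrame VA VB) (sandwich ((1 : Matrix a a ℂ) ⊗ₖ (1 : Matrix b b ℂ))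
      ((1 : Matrix a a ℂ) ⊗ₖ (1 : Matrix b b ℂ))) = LinearMap.id := by
    rw [one_kronecker_one, sandwich_one, onSubsystem_id (gateFrame_conjTranspose_mul hA hB)]
  have h₁ : onSubsystem (cutFrame (Fin 2) (Fin 2) VA VB)
      (tensor (tensor LinearMap.id signedMeasure) (tensor LinearMap.id signedMeasure)) =
      tensor LinearMap.id (tensor signedMeasure signedMeasure) := by
    rw [tensor_id_signedMeasure, tensor_id_signedMeasure, tensor_sum_smul, onSubsystem_sum_smul,
      tensor_signedMeasure, tensor_left_sum_smul]
    simp only [onSubsystem_cutFrame, hid]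
  have h₂ : onSubsystem (cutFrame (Fin 2) (Fin 2) VA VB)
      (tensor (conj ((1 : Matrix a a ℂ) ⊗ₖ prepare τ)) (conj ((1 : Matrix b b ℂ) ⊗ₖ prepare τ))) =
      tensor LinearMap.id (tensor (conj (prepare τ)) (conj (prepare τ))) := by
    rw [conj_eq_sandwich, conj_eq_sandwich, onSubsystem_cutFrame, hid, conj_eq_sandwich,
      tensor_sandwich]
  have hc := cutFrame_mul_conjTranspose (EA := Fin 2) (EB := Fin 2) hA hB
  have hid' := onSubsystem_id (cutFrame_conjTranspose_mul (EA := Fin 2) (EB := Fin 2) hA hB)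
  rw [cutStep, cutStep, ← tensor_comp, ← tensor_comp, onSubsystem_comp hc, onSubsystem_comp hc]
  rw [apply_ite₂ tensor, apply_ite₂ tensor, apply_ite (onSubsystem _), apply_ite (onSubsystem _), h₁, h₂,
    tensor_id_id, hid']

end BlackBoxUpperBound

section BlackBoxDecomposition

variable {a b κ : Type} [Fintype a] [DecidableEq a] [Fintype b] [DecidableEq b] [Fintype κ]
  [DecidableEq κ] {A B : Type} [Fintype A] [DecidableEq A] [Fintype B] [DecidableEq B]

/-- Both ancillas must be off-diagonal, which leaves the four blocks `00,11`, `11,00`, `01,10` and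
`10,01`. -/
theorem traceOut_ancilla (Y : Matrix a a ℂ) (s t : Fin 2 × Fin 2) :
    traceOut (tensor LinearMap.id (tensor signedMeasure signedMeasure) (Y ⊗ₖ single s t 1)) =
      (if s.1 ≠ t.1 ∧ s.2 ≠ t.2 then 1 else 0 : ℂ) • Y := by
  have : single s t (1 : ℂ) = single s.1 t.1 1 ⊗ₖ single s.2 t.2 1 := by
    rw [single_kronecker_single]; simp
  rw [this, tensor_kronecker, tensor_kronecker, traceOut_kronecker, trace_kronecker,
    trace_signedMeasure, trace_signedMeasure]
  by_cases h₁ : s.1 = t.1 <;> by_cases h₂ : s.2 = t.2 <;> simp [h₁, h₂]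

theorem prepare_ancilla (τ : Fin 2) (X : Matrix a a ℂ) :
    tensor LinearMap.id (tensor (conj (prepare τ)) (conj (prepare τ))) (adjoin (0, 0) X) =
      ∑ p : (Fin 2 × Fin 2) × (Fin 2 × Fin 2),
        (prepare τ p.1.1 0 * prepare τ p.1.2 0 * star (prepare τ p.2.1 0 * prepare τ p.2.2 0)) •
          X ⊗ₖ single p.1 p.2 1 := by
  have : adjoin ((0 : Fin 2), (0 : Fin 2)) X = X ⊗ₖ single (0, 0) (0, 0) 1 := rfl
  rw [this, tensor_kronecker, ← kron_apply, matrix_eq_sum_single (tensor _ _ _)]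
  simp only [map_sum, Fintype.sum_prod_type]
  have hp : single (0, 0) (0, 0) (1 : ℂ) = single (0 : Fin 2) (0 : Fin 2) 1 ⊗ₖ
      single (0 : Fin 2) (0 : Fin 2) 1 := by
    rw [single_kronecker_single]; simp
  refine Finset.sum_congr rfl fun x _ => Finset.sum_congr rfl fun y _ =>
    Finset.sum_congr rfl fun z _ => Finset.sum_congr rfl fun w _ => ?_
  rw [hp, tensor_kronecker]
  simp only [kroneckerMap_apply, conj_eq_sandwich, sandwich_apply_single, LinearMap.id_apply]
  rw [← mul_one (prepare τ x 0 * _ * _), ← smul_eq_mul, ← smul_single, map_smul, kron_apply]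
  congr 1
  rw [star_mul]
  ring

/-- The analogue of `tensor_crossMap` for a whole circuit. The prepared ancillas give the blocks
`00,11` and `11,00` the square of the phase or its conjugate, a sign depending on `τ`, whereas in
`01,10` and `10,01` the phases cancel. -/
theorem cut_alternate_apply {n : ℕ} (τ : Fin 2)
    (T : Fin 2 × Fin 2 → Fin 2 × Fin 2 → Fin (n + 1) → Superop a a)
    (C : Fin (n + 1) → Superop (a × (Fin 2 × Fin 2)) (a × (Fin 2 × Fin 2)))
    (hC : ∀ j s t X, C j (X ⊗ₖ single s t 1) = T s t j X ⊗ₖ single s t 1)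
    (Bs : Fin n → Superop a a) :
    traceOut ∘ₗ alternate (fun j =>
      (if j = Fin.last n then tensor LinearMap.id (tensor signedMeasure signedMeasure)
        else LinearMap.id) ∘ₗ (C j ∘ₗ
      if j = 0 then tensor LinearMap.id (tensor (conj (prepare τ)) (conj (prepare τ)))
        else LinearMap.id)) (fun j => tensor (Bs j) LinearMap.id) ∘ₗ adjoin (0, 0) =
    (1 / 4 : ℂ) • ((if τ = 0 then 1 else -1 : ℂ) •
      (alternate (T (0, 0) (1, 1)) Bs + alternate (T (1, 1) (0, 0)) Bs) +
      (alternate (T (0, 1) (1, 0)) Bs + alternate (T (1, 0) (0, 1)) Bs)) := by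
  have hst : ∀ s t X, alternate C (fun j => tensor (Bs j) LinearMap.id) (X ⊗ₖ single s t 1) =
      alternate (T s t) Bs X ⊗ₖ single s t 1 := by
    intro s t X
    have := alternate_intertwine ((kron a (Fin 2 × Fin 2)).flip (single s t 1)) (T s t) C Bs
      (fun j => tensor (Bs j) LinearMap.id)
      (fun j => LinearMap.ext fun X => by simpa [kron_apply] using hC j s t X)
      (fun j => LinearMap.ext fun X => by simp [kron_apply, tensor_kronecker])
    exact LinearMap.congr_fun this X
  rw [alternate_comp_last (fun j => C j ∘ₗ _), alternate_comp_first]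
  refine LinearMap.ext fun X => ?_
  simp only [LinearMap.comp_apply, prepare_ancilla, map_sum, map_smul, hst, traceOut_ancilla]
  have h := inv_sqrt_two_mul_self
  have hs := star_inv_sqrt_two
  have h0 : prepare τ 0 0 = ((√2)⁻¹ : ℂ) := by simp [prepare]
  have h1 : prepare τ 1 0 = ((√2)⁻¹ : ℂ) * cutPhase τ := by simp [prepare]
  simp only [Fintype.sum_prod_type, Fin.sum_univ_two, h0, h1, star_mul, hs]
  simp only [ne_eq, not_true_eq_false, false_and, and_false, if_false, zero_smul, smul_zero,
    zero_add, add_zero, zero_ne_one, one_ne_zero, not_false_eq_true, and_self, if_true, one_smul,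
    LinearMap.add_apply, LinearMap.smul_apply]
  have hc := cutPhase_mul_star τ
  generalize ((√2)⁻¹ : ℂ) = r at h
  have hc2 : cutPhase τ * cutPhase τ = if τ = 0 then 1 else -1 := by
    fin_cases τ <;> simp [cutPhase]
  have hc3 : star (cutPhase τ) * star (cutPhase τ) = if τ = 0 then 1 else -1 := by
    rw [← star_mul, hc2]; split_ifs <;> simp
  generalize (if τ = 0 then 1 else -1 : ℂ) = ε at *
  generalize star (cutPhase τ) = d at *
  generalize cutPhase τ = c at *
  have e₁ : r * r * (d * r * (d * r)) = 1 / 4 * ε := by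
    linear_combination (r * r * d * d + 1 / 2 * d * d) * h + 1 / 4 * hc3
  have e₂ : r * (r * c) * (r * (d * r)) = 1 / 4 := by
    linear_combination (r * r * c * d + 1 / 2 * c * d) * h + 1 / 4 * hc
  have e₃ : r * c * r * (d * r * r) = 1 / 4 := by
    linear_combination (r * r * c * d + 1 / 2 * c * d) * h + 1 / 4 * hc
  have e₄ : r * c * (r * c) * (r * r) = 1 / 4 * ε := by
    linear_combination (r * r * c * c + 1 / 2 * c * c) * h + 1 / 4 * hc2
  rw [e₁, e₂, e₃, e₄]
  module

theorem alternate_onSubsystem_conj {n : ℕ} {U : Fin (n + 1) → Matrix (a × b) (a × b) ℂ}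
    {u : Fin (n + 1) → κ → ℝ} {L : Fin (n + 1) → κ → Matrix a a ℂ}
    {R : Fin (n + 1) → κ → Matrix b b ℂ} (h : ∀ i, IsUnitarySchmidt (U i) (u i) (L i) (R i))
    {H : Type} [Fintype H] [DecidableEq H] {r : Fin (n + 1) → Type} [∀ j, Fintype (r j)]
    [∀ j, DecidableEq (r j)] (W : ∀ j, Matrix ((a × b) × r j) H ℂ) (Bs : Fin n → Superop H H) :
    alternate (fun j => onSubsystem (W j) (conj (U j))) Bs =
      ∑ p : (Fin (n + 1) → κ) × (Fin (n + 1) → κ),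
        (((∏ j, u j (p.1 j) : ℝ) : ℂ) * ((∏ j, u j (p.2 j) : ℝ) : ℂ)) •
          alternate (fun j => onSubsystem (W j)
            (sandwich (L j (p.1 j) ⊗ₖ R j (p.1 j)) (L j (p.2 j) ⊗ₖ R j (p.2 j)))) Bs := by
  have hU : ∀ j, onSubsystem (W j) (conj (U j)) = ∑ p : κ × κ, ((u j p.1 : ℂ) * u j p.2) •
      onSubsystem (W j) (sandwich (L j p.1 ⊗ₖ R j p.1) (L j p.2 ⊗ₖ R j p.2)) := by
    intro j
    rw [← onSubsystem_sum_smul, conj_eq_sandwich, (h j).eq_sum, sandwich_sum_smul]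
    simp
  simp only [hU]
  rw [alternate_sum, ← (Equiv.arrowProdEquivProdArrow (Fin (n + 1)) (fun _ => κ)
    (fun _ => κ)).symm.sum_comp]
  refine Finset.sum_congr rfl fun p _ => ?_
  rw [alternate_smul]
  simp [Finset.prod_mul_distrib]

/-- A pair of index sequences `(k, l)` determines the two branches of controlled gates at all steps.
The circuit thus plays the role of one unitary whose Schmidt coefficients are the products `∏ i, u i
(k i)`, and the weights are those of the tensor product. -/
theorem blackBoxExtent_LOStar_le [Nonempty κ] {n : ℕ}
    {U : Fin (n + 1) → Matrix (a × b) (a × b) ℂ}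
    {u : Fin (n + 1) → κ → ℝ} {L : Fin (n + 1) → κ → Matrix a a ℂ}
    {R : Fin (n + 1) → κ → Matrix b b ℂ} (h : ∀ i, IsUnitarySchmidt (U i) (u i) (L i) (R i)) :
    blackBoxExtent LOStar (fun i => conj (U i)) ≤
      ENNReal.ofReal (2 * (∑ k : Fin (n + 1) → κ, ∏ i, u i (k i)) ^ 2 - 1) := by
  have hb := IsUnitarySchmidt.bipartiteKron h
  rw [← sum_abs_schmidtWeight hb.nonneg hb.sum_sq]
  let KA : ((Fin (n + 1) → κ) × (Fin (n + 1) → κ)) → Fin (n + 1) → Fin 2 → Matrix a a ℂ :=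
    fun p j => ![L j (p.1 j), L j (p.2 j)]
  let KB : ((Fin (n + 1) → κ) × (Fin (n + 1) → κ)) → Fin (n + 1) → Fin 2 → Matrix b b ℂ :=
    fun p j => ![R j (p.1 j), R j (p.2 j)]
  refine blackBoxExtent_le (0 : Fin 2) (0 : Fin 2) _
    (fun p j => tensor (cutStep p.2 j (KA p.1 j)) (cutStep p.2 j (KB p.1 j))) ?_ ?_
  · intro p j
    refine tensor_mem_LOStar (isSignedLocal_cutStep _ _ ?_) (isSignedLocal_cutStep _ _ ?_)
    · intro e
      fin_cases e
      · exact (h j).left_unitary _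
      · exact (h j).left_unitary _
    · intro e
      fin_cases e
      · exact (h j).right_unitary _
      · exact (h j).right_unitary _
  · intro A B _ _ _ _ RA RB _ _ _ _ VA VB Bs hA hB _
    let T : (Fin (n + 1) → κ) → (Fin (n + 1) → κ) → (Fin (n + 1) → κ) → (Fin (n + 1) → κ) →
        Superop (A × B) (A × B) := fun k k' l l' =>
      alternate (fun j => onSubsystem (gateFrame (VA j) (VB j))
        (sandwich (L j (k j) ⊗ₖ R j (k' j)) (L j (l j) ⊗ₖ R j (l' j)))) Bs
    let G : ((Fin (n + 1) → κ) × (Fin (n + 1) → κ)) × Fin 2 → Superop (A × B) (A × B) := fun p =>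
      traceOut ∘ₗ alternate (fun j => onSubsystem (cutFrame (Fin 2) (Fin 2) (VA j) (VB j))
        (tensor (cutStep p.2 j (KA p.1 j)) (cutStep p.2 j (KB p.1 j))))
        (fun j => tensor (Bs j) LinearMap.id) ∘ₗ adjoin ((0 : Fin 2), (0 : Fin 2))
    have hG : ∀ p, G p = (1 / 4 : ℂ) • ((if p.2 = 0 then 1 else -1 : ℂ) •
        (T p.1.1 p.1.1 p.1.2 p.1.2 + T p.1.2 p.1.2 p.1.1 p.1.1) +
        (T p.1.1 p.1.2 p.1.2 p.1.1 + T p.1.2 p.1.1 p.1.1 p.1.2)) := by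
      intro p
      simp only [G, onSubsystem_tensor_cutStep (hA _) (hB _)]
      exact cut_alternate_apply p.2
        (fun s t j => onSubsystem (gateFrame (VA j) (VB j))
          (sandwich (KA p.1 j s.1 ⊗ₖ KB p.1 j s.2) (KA p.1 j t.1 ⊗ₖ KB p.1 j t.2))) _
        (fun j s t X => onSubsystem_controlled (VA j) (VB j) (KA p.1 j) (KB p.1 j) s t X) Bs
    rw [alternate_onSubsystem_conj h]
    refine Eq.trans ?_ ((Fintype.equivFin _).symm.sum_comp fun p =>
      (schmidtWeight (fun k : Fin (n + 1) → κ => ∏ i, u i (k i)) p : ℂ) • G p).symm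
    symm
    refine sum_schmidtWeight_smul _ (fun k l => T k k l l) G ?_ ?_
    · intro k l
      simp only [hG, if_true, one_ne_zero, if_false]
      module
    · intro k
      simp only [hG, one_ne_zero, if_false]
      module

end BlackBoxDecomposition

/-! ### Completely positive maps and instruments. -/

section CompletelyPositive

variable {a a' a'' b b' b'' : Type} [Fintype a] [DecidableEq a] [Fintype a'] [DecidableEq a']
  [Fintype a''] [DecidableEq a''] [Fintype b] [DecidableEq b] [Fintype b'] [DecidableEq b']
  [Fintype b''] [DecidableEq b'']

theorem continuous_superop (E : Superop a b) : Continuous E :=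
  LinearMap.continuous_of_finiteDimensional E

/-- Kraus decomposition of completely positive maps. -/
theorem IsCP.exists_kraus {E : Superop a b} (hE : IsCP E) :
    ∃ (m : Type) (_ : Fintype m) (K : m → Matrix b a ℂ), E = ∑ i, conj (K i) := by
  let e := Fintype.equivFin a
  -- The unnormalised maximally entangled vector; a decomposition of the resulting Choi matrix into
  -- rank-one terms yields the Kraus operators.
  let ω : a × Fin (Fintype.card a) → ℂ := fun p => if e p.1 = p.2 then 1 else 0
  have hω : vecMulVec ω (star ω) = ∑ p, ∑ q, single p q (1 : ℂ) ⊗ₖ single (e p) (e q) (1 : ℂ) := by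
    ext ⟨x, i⟩ ⟨y, j⟩
    simp only [Matrix.sum_apply, single_kronecker_single, single_apply, vecMulVec_apply,
      Pi.star_apply, ω, Prod.mk.injEq, mul_one]
    rw [Finset.sum_eq_single x, Finset.sum_eq_single y]
    · split_ifs <;> simp_all
    · intro q _ hq; simp [hq]
    · simp
    · intro p _ hp
      refine Finset.sum_eq_zero fun q _ => ?_
      simp [hp]
    · simp
  have hC := hE _ _ (posSemidef_vecMulVec_self_star ω)
  rw [posSemidef_iff_eq_sum_vecMulVec] at hC
  obtain ⟨m, v, hv⟩ := hC
  refine ⟨Fin m, inferInstance, fun m => of fun x p => v m (x, e p),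
    superop_ext_single fun p q => ?_⟩
  ext x y
  have := congrFun (congrFun hv (x, e p)) (y, e q)
  rw [hω] at this
  simp only [map_sum, tensor_kronecker, LinearMap.id_apply, Matrix.sum_apply, kroneckerMap_apply,
    vecMulVec_apply, Pi.star_apply] at this
  rw [Finset.sum_eq_single p, Finset.sum_eq_single q] at this
  · simp only [single_apply_same, mul_one] at this
    simp [this, LinearMap.sum_apply, Matrix.sum_apply, conj_eq_sandwich, sandwich_apply_single]
  · intro q' _ hq; simp [hq]
  · simp
  · intro p' _ hp
    refine Finset.sum_eq_zero fun q' _ => ?_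
    simp [hp]
  · simp

theorem isCP_sum_conj {m : Type} [Fintype m] (K : m → Matrix b a ℂ) : IsCP (∑ i, conj (K i)) := by
  intro k X hX
  have h := tensor_sum_smul (fun _ : m => (1 : ℂ)) (fun _ : Unit => (1 : ℂ)) (fun i => conj (K i))
    (fun _ => (LinearMap.id : Superop (Fin k) (Fin k)))
  simp only [one_smul, Finset.univ_unique, Finset.sum_singleton, mul_one,
    Fintype.sum_prod_type] at h
  rw [h, LinearMap.sum_apply]
  exact posSemidef_sum _ fun i _ => isCP_conj (K i) k X hX

theorem IsCP.exists_kraus_tensor {E : Superop a a'} {F : Superop b b'} (hE : IsCP E)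
    (hF : IsCP F) : ∃ (m m' : Type) (_ : Fintype m) (_ : Fintype m') (K : m → Matrix a' a ℂ)
      (M : m' → Matrix b' b ℂ), tensor E F = ∑ p : m × m', conj (K p.1 ⊗ₖ M p.2) := by
  obtain ⟨m, _, K, rfl⟩ := hE.exists_kraus
  obtain ⟨m', _, M, rfl⟩ := hF.exists_kraus
  refine ⟨m, m', inferInstance, inferInstance, K, M, ?_⟩
  have h := tensor_sum_smul (fun _ : m => (1 : ℂ)) (fun _ : m' => (1 : ℂ)) (fun i => conj (K i))
    (fun i => conj (M i))
  simpa [conj_eq_sandwich, tensor_sandwich] using h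

theorem IsCP.tensor {E : Superop a a'} {F : Superop b b'} (hE : IsCP E) (hF : IsCP F) :
    IsCP (tensor E F) := by
  obtain ⟨m, m', _, _, K, M, h⟩ := hE.exists_kraus_tensor hF
  rw [h]
  exact isCP_sum_conj _

theorem IsCP.comp {E : Superop a' a''} {F : Superop a a'} (hE : IsCP E) (hF : IsCP F) :
    IsCP (E ∘ₗ F) := by
  intro k X hX
  have := tensor_comp E F (LinearMap.id : Superop (Fin k) (Fin k)) LinearMap.id
  rw [LinearMap.id_comp] at this
  rw [← this]
  exact hE k _ (hF k X hX)

theorem isChannel_id : IsChannel (LinearMap.id : Superop a a) := by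
  rw [← sandwich_one, ← conj_eq_sandwich]
  exact isChannel_conj (by simp)

theorem adjoin_eq_conj (e : b) :
    (adjoin e : Superop a (a × b)) = conj (of fun x y => if x = (y, e) then 1 else 0) := by
  refine superop_ext_single fun p q => ?_
  ext x y
  rw [conj_eq_sandwich, sandwich_apply_single]
  obtain ⟨x, x'⟩ := x
  obtain ⟨y, y'⟩ := y
  simp only [adjoin, LinearMap.coe_mk, AddHom.coe_mk, single_kronecker_single, single_apply,
    of_apply, Prod.mk.injEq]
  by_cases h₁ : p = x <;> by_cases h₂ : e = x' <;> by_cases h₃ : q = y <;> by_cases h₄ : e = y' <;>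
    simp [h₁, h₂, h₃, h₄, eq_comm]

theorem isChannel_adjoin (e : b) : IsChannel (adjoin e : Superop a (a × b)) := by
  refine ⟨by rw [adjoin_eq_conj]; exact isCP_conj _, fun X => ?_⟩
  change (X ⊗ₖ single e e (1 : ℂ)).trace = _
  rw [trace_kronecker]
  simp

theorem traceOut_comp_adjoin (e : b) :
    traceOut ∘ₗ (adjoin e : Superop a (a × b)) = LinearMap.id := by
  refine LinearMap.ext fun X => ?_
  change traceOut (X ⊗ₖ single e e (1 : ℂ)) = _
  rw [traceOut_kronecker]
  simp

theorem traceOut_eq_sum_conj : (traceOut : Superop (a × b) a) =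
    ∑ k, conj (of fun x y => if y = (x, k) then 1 else 0) := by
  refine superop_ext_kronecker fun X Y => ?_
  ext x y
  simp only [traceOut, LinearMap.coe_mk, AddHom.coe_mk, LinearMap.sum_apply, Matrix.sum_apply,
    conj_eq_sandwich, sandwich_apply, of_apply, mul_apply, conjTranspose_apply]
  refine Finset.sum_congr rfl fun k _ => ?_
  simp

theorem isChannel_traceOut : IsChannel (traceOut : Superop (a × b) a) :=
  ⟨by rw [traceOut_eq_sum_conj]; exact isCP_sum_conj _, trace_traceOut⟩

theorem IsInstrument.comp_channel {ι : Type} {E : ι → Superop a' a''} (hE : IsInstrument E)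
    {F : Superop a a'} (hF : IsChannel F) : IsInstrument fun i => E i ∘ₗ F where
  countable := hE.countable
  cp i := (hE.cp i).comp hF.1
  tp := by
    obtain ⟨T, hT, hs⟩ := hE.tp
    exact ⟨T ∘ₗ F, fun X => (hT _).trans (hF.2 X), fun X => hs (F X)⟩

theorem IsInstrument.channel_comp {ι : Type} {E : Superop a' a''} (hE : IsChannel E)
    {F : ι → Superop a a'} (hF : IsInstrument F) : IsInstrument fun i => E ∘ₗ F i where
  countable := hF.countable
  cp i := hE.1.comp (hF.cp i)
  tp := by
    obtain ⟨T, hT, hs⟩ := hF.tp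
    exact ⟨E ∘ₗ T, fun X => (hE.2 _).trans (hT X), fun X => (hs X).map E (continuous_superop E)⟩

theorem IsInstrument.nonempty [Nonempty a] {ι : Type} {E : ι → Superop a b}
    (hE : IsInstrument E) : Nonempty ι := by
  by_contra h
  rw [not_nonempty_iff] at h
  obtain ⟨T, hT, hs⟩ := hE.tp
  have h0 := (hs 1).unique hasSum_empty
  have := hT 1
  rw [h0, trace_zero, trace_one] at this
  exact Fintype.card_ne_zero (α := a) (by exact_mod_cast this.symm)

theorem hasSum_tensor {ι κ : Type} {E : ι → Superop a a'} {F : κ → Superop b b'}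
    {T : Superop a a'} {T' : Superop b b'} (hs : ∀ X, HasSum (fun i => E i X) (T X))
    (hs' : ∀ X, HasSum (fun i => F i X) (T' X)) (X : Matrix (a × b) (a × b) ℂ) :
    HasSum (fun i : ι × κ => tensor (E i.1) (F i.2) X) (tensor T T' X) := by
  have h₁ : ∀ p q : a × b, HasSum (fun i : ι × κ => tensor (E i.1) (F i.2) (single p q 1))
      (tensor T T' (single p q 1)) := by
    intro p q
    simp only [tensor_apply_single]
    refine Pi.hasSum.mpr fun x => Pi.hasSum.mpr fun y => ?_
    have e₁ := Pi.hasSum.mp (Pi.hasSum.mp (hs (single p.1 q.1 1)) x.1) y.1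
    have e₂ := Pi.hasSum.mp (Pi.hasSum.mp (hs' (single p.2 q.2 1)) x.2) y.2
    have e₃ := summable_mul_of_summable_norm e₁.summable.norm e₂.summable.norm
    have e₄ := HasSum.mul e₁ e₂ e₃
    exact e₄
  have h₂ : ∀ G : Superop (a × b) (a' × b'), G X = ∑ p, ∑ q, X p q • G (single p q 1) := by
    intro G
    conv_lhs => rw [matrix_eq_sum_single X]
    simp only [map_sum]
    refine Finset.sum_congr rfl fun p _ => Finset.sum_congr rfl fun q _ => ?_
    rw [← map_smul, smul_single, smul_eq_mul, mul_one]
  simp only [h₂]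
  exact hasSum_sum fun p _ => hasSum_sum fun q _ => (h₁ p q).const_smul _

theorem IsInstrument.tensor {ι κ : Type} {E : ι → Superop a a'} {F : κ → Superop b b'}
    (hE : IsInstrument E) (hF : IsInstrument F) :
    IsInstrument fun p : ι × κ => tensor (E p.1) (F p.2) where
  countable := by
    have := hE.countable
    have := hF.countable
    infer_instance
  cp p := (hE.cp _).tensor (hF.cp _)
  tp := by
    obtain ⟨T, hT, hs⟩ := hE.tp
    obtain ⟨T', hT', hs'⟩ := hF.tp
    exact ⟨CircuitCut.tensor T T', isTP_tensor _ _ hT hT', hasSum_tensor hs hs'⟩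

end CompletelyPositive

/-! ### LO instruments are LOCC instruments. -/

section LOSubsetLOCC

variable {a a' b b' : Type} [Fintype a] [DecidableEq a] [Fintype a'] [DecidableEq a']
  [Fintype b] [DecidableEq b] [Fintype b'] [DecidableEq b']

theorem isCoarseGraining_of_injective {ι κ : Type} {E : ι → Superop a b} {F : κ → Superop a b}
    {f : ι → κ} (hf : Function.Injective f) (h : ∀ i, F (f i) = E i)
    (h₀ : ∀ k, k ∉ Set.range f → F k = 0) : IsCoarseGraining E F := by
  refine ⟨f, fun k X => ?_⟩
  by_cases hk : k ∈ Set.range f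
  · obtain ⟨i, rfl⟩ := hk
    let _ : Unique {j // f j = f i} := ⟨⟨⟨i, rfl⟩⟩, fun j => Subtype.ext (hf j.2)⟩
    rw [h]
    exact hasSum_unique (fun j : {j // f j = f i} => E j X)
  · have : IsEmpty {j // f j = k} := ⟨fun j => hk ⟨j.1, j.2⟩⟩
    rw [h₀ k hk]
    exact hasSum_empty

theorem isInstrument_id : IsInstrument fun _ : Unit => (LinearMap.id : Superop a a) where
  countable := inferInstance
  cp _ := isChannel_id.1
  tp := ⟨LinearMap.id, isChannel_id.2, fun _ => hasSum_unique _⟩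

/-- The outcome sets of the rounds of the LOCC protocol implementing a product instrument. -/
def productRounds (κ μ : Type) : ℕ → Type
  | 0 => κ
  | _ + 1 => κ × μ

/-- The rounds of the LOCC protocol implementing a product instrument. -/
def productProtocol {κ μ : Type} (E : κ → Superop a a) (F : μ → Superop b b) :
    ∀ ν, productRounds κ μ ν → Superop (a × b) ((a × Fin 1) × (b × Fin 1))
  | 0, k => tensor (adjoin 0 ∘ₗ E k) (adjoin 0)
  | _ + 1, p => tensor (adjoin 0 ∘ₗ E p.1) (adjoin 0 ∘ₗ F p.2)

/-- In round `0` the first party measures, in round `1` the second party measures regardless of the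
announced outcome, and all later rounds are idle. The memories are trivial systems `Fin 1`. -/
theorem IsLOInstrument.isLOCCInstrument [Nonempty b] {ι : Type} {G : ι → Superop (a × b) (a × b)}
    (hG : IsLOInstrument ι G) : IsLOCCInstrument ι G := by
  obtain ⟨κ, μ, e, E, F, hE, hF, hG⟩ := hG
  have hGi : IsInstrument G := by
    have h := hE.tensor hF
    refine ⟨?_, fun i => by rw [hG]; exact h.cp (e i), ?_⟩
    · have := h.countable
      exact e.injective.countable
    · obtain ⟨T, hT, hs⟩ := h.tp
      refine ⟨T, hT, fun X => ?_⟩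
      simp only [hG]
      exact (Equiv.hasSum_iff e).mpr (hs X)
  obtain ⟨m₀⟩ := hF.nonempty
  classical
  let tr : Superop ((a × Fin 1) × (b × Fin 1)) (a × b) := tensor traceOut traceOut
  have htr : ∀ (E : Superop a a) (F : Superop b b), tensor traceOut traceOut ∘ₗ
      tensor (adjoin (0 : Fin 1) ∘ₗ E) (adjoin (0 : Fin 1) ∘ₗ F) = tensor E F := by
    intro E F
    rw [tensor_comp, ← LinearMap.comp_assoc, ← LinearMap.comp_assoc, traceOut_comp_adjoin,
      traceOut_comp_adjoin, LinearMap.id_comp, LinearMap.id_comp]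
  let Q : ℕ → ι → Superop (a × b) (a × b)
    | 0, i => if (e i).2 = m₀ then tr ∘ₗ tensor (adjoin 0 ∘ₗ E (e i).1) (adjoin 0) else 0
    | _ + 1, i => G i
  refine ⟨hGi, fun _ => 1, fun _ => 1, productRounds κ μ, productProtocol E F, Q,
    Or.inl ⟨fun k => adjoin 0 ∘ₗ E k, fun _ => adjoin 0,
      IsInstrument.channel_comp (isChannel_adjoin _) hE, fun _ => isChannel_adjoin _,
      fun _ => rfl⟩, ?_, ?_, ?_, ?_⟩
  · have := hE.countable
    have := hF.countable
    rintro (_ | ν)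
    · exact hE.countable
    · exact inferInstanceAs (Countable (κ × μ))
  · rintro (_ | ν)
    · refine ⟨fun _ => μ, fun _ m => tensor LinearMap.id (adjoin 0 ∘ₗ F m ∘ₗ traceOut),
        fun _ => Or.inr ⟨fun _ => LinearMap.id, fun m => adjoin 0 ∘ₗ F m ∘ₗ traceOut,
          IsInstrument.channel_comp (isChannel_adjoin _) (hF.comp_channel isChannel_traceOut),
          fun _ => isChannel_id, fun _ => rfl⟩, ?_⟩
      refine isCoarseGraining_of_injective (f := fun p : Σ _ : κ, μ => (p.1, p.2)) ?_ ?_ ?_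
      · rintro ⟨k, m⟩ ⟨k', m'⟩ h
        have h' : ((k, m) : κ × μ) = (k', m') := h
        cases h'
        rfl
      · rintro ⟨k, m⟩
        change tensor (adjoin 0 ∘ₗ E k) (adjoin 0 ∘ₗ F m) = tensor LinearMap.id _ ∘ₗ
          tensor (adjoin 0 ∘ₗ E k) (adjoin 0)
        rw [tensor_comp, LinearMap.id_comp, LinearMap.comp_assoc, LinearMap.comp_assoc,
          traceOut_comp_adjoin, LinearMap.comp_id]
      · rintro ⟨k, m⟩ h
        exact absurd ⟨⟨k, m⟩, rfl⟩ h
    · refine ⟨fun _ => Unit, fun _ _ => tensor LinearMap.id LinearMap.id,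
        fun _ => Or.inl ⟨fun _ => LinearMap.id, fun _ => LinearMap.id, isInstrument_id,
          fun _ => isChannel_id, fun _ => rfl⟩, ?_⟩
      refine isCoarseGraining_of_injective (f := fun p : Σ _ : κ × μ, Unit => p.1) ?_ ?_ ?_
      · rintro ⟨k, _⟩ ⟨k', _⟩ h
        have h' : k = k' := h
        cases h'
        rfl
      · rintro ⟨p, _⟩
        change tensor (adjoin 0 ∘ₗ E p.1) (adjoin 0 ∘ₗ F p.2) = tensor _ _ ∘ₗ
          tensor (adjoin 0 ∘ₗ E p.1) (adjoin 0 ∘ₗ F p.2)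
        rw [tensor_id_id, LinearMap.id_comp]
      · intro p h
        exact absurd ⟨⟨p, ()⟩, rfl⟩ h
  · rintro (_ | ν)
    · refine isCoarseGraining_of_injective (f := fun k : κ => e.symm (k, m₀)) ?_ ?_ ?_
      · intro k k' h
        exact congrArg Prod.fst (e.symm.injective h)
      · intro k
        simp only [Q, Equiv.apply_symm_apply, if_true]
        rfl
      · intro i h
        simp only [Q]
        refine if_neg fun hm => h ⟨(e i).1, ?_⟩
        change e.symm ((e i).1, m₀) = i
        rw [← hm, Prod.mk.eta, Equiv.symm_apply_apply]
    · refine isCoarseGraining_of_injective (f := fun p : κ × μ => e.symm p) e.symm.injective ?_ ?_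
      · intro (p : κ × μ)
        change G (e.symm p) = tensor traceOut traceOut ∘ₗ
          tensor (adjoin 0 ∘ₗ E p.1) (adjoin 0 ∘ₗ F p.2)
        rw [hG, htr, Equiv.apply_symm_apply]
      · intro i h
        exact absurd ⟨e i, e.symm_apply_apply i⟩ h
  · intro k X
    refine tendsto_const_nhds.congr' ?_
    filter_upwards [eventually_ge_atTop 1] with ν hν
    obtain ⟨ν, rfl⟩ := Nat.exists_eq_add_of_le' hν
    rfl

theorem LOStar_subset_LOCCStar [Nonempty b] : LOStar a b ⊆ LOCCStar a b := by
  rintro F ⟨ι, E, β, hE, hβ, hF⟩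
  exact ⟨ι, E, β, hE.isLOCCInstrument, hβ, hF⟩

theorem blackBoxExtent_LOCCStar_le [Nonempty b] {n : ℕ} (E : Fin (n + 1) → Superop (a × b) (a × b)) :
    blackBoxExtent LOCCStar E ≤ blackBoxExtent LOStar E := by
  refine sInf_le_sInf ?_
  rintro t ⟨EA, EB, _, _, _, _, a₀, b₀, m, w, F, hm, hF, h, ht⟩
  refine ⟨EA, EB, inferInstance, inferInstance, inferInstance, inferInstance, a₀, b₀, m, w, F, hm,
    fun i j => ?_, h, ht⟩
  have : Nonempty EB := ⟨b₀⟩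
  exact LOStar_subset_LOCCStar (hF i j)

end LOSubsetLOCC

/-! ### Closed cones of completely positive maps and their signed differences. -/

section KrausCone

variable {a a' b b' c c' : Type} [Fintype a] [DecidableEq a] [Fintype a'] [DecidableEq a']
  [Fintype b] [DecidableEq b] [Fintype b'] [DecidableEq b'] [Fintype c] [DecidableEq c]
  [Fintype c'] [DecidableEq c']

/-- The closed convex cone of superoperators generated by the maps `X ↦ K X K†`, `K ∈ 𝒦`. -/
inductive KrausCone (𝒦 : Set (Matrix b a ℂ)) : Superop a b → Prop
  | conj {K : Matrix b a ℂ} (hK : K ∈ 𝒦) : KrausCone 𝒦 (conj K)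
  | zero : KrausCone 𝒦 0
  | add {F G : Superop a b} : KrausCone 𝒦 F → KrausCone 𝒦 G → KrausCone 𝒦 (F + G)
  | smul {F : Superop a b} {r : ℝ} : 0 ≤ r → KrausCone 𝒦 F → KrausCone 𝒦 ((r : ℂ) • F)
  | limit {ι : Type} {l : Filter ι} [l.NeBot] {F : ι → Superop a b} {G : Superop a b} :
      (∀ i, KrausCone 𝒦 (F i)) → (∀ X, Tendsto (fun i => F i X) l (𝓝 (G X))) → KrausCone 𝒦 G

theorem KrausCone.sum {𝒦 : Set (Matrix b a ℂ)} {ι : Type} {E : ι → Superop a b} (s : Finset ι)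
    (hE : ∀ i, KrausCone 𝒦 (E i)) : KrausCone 𝒦 (∑ i ∈ s, E i) := by
  classical
  induction s using Finset.induction_on with
  | empty => exact KrausCone.zero
  | insert i s hi ih =>
    rw [Finset.sum_insert hi]
    exact (hE i).add ih

theorem KrausCone.hasSum {𝒦 : Set (Matrix b a ℂ)} {ι : Type} {E : ι → Superop a b}
    {G : Superop a b} (hE : ∀ i, KrausCone 𝒦 (E i)) (h : ∀ X, HasSum (fun i => E i X) (G X)) :
    KrausCone 𝒦 G := by
  refine KrausCone.limit (l := (atTop : Filter (Finset ι))) (F := fun s => ∑ i ∈ s, E i)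
    (fun s => KrausCone.sum s hE) fun X => ?_
  simpa [HasSum, LinearMap.sum_apply] using h X

theorem superop_eq_sum (F : Superop a b) : F = ∑ p, ∑ q, ∑ x, ∑ y, F (single p q 1) x y •
    (entryLinearMap ℂ ℂ p q).smulRight (single x y (1 : ℂ)) := by
  refine superop_ext_single fun p q => ?_
  simp only [LinearMap.sum_apply, LinearMap.smul_apply, LinearMap.smulRight_apply,
    entryLinearMap_apply]
  rw [Finset.sum_eq_single p, Finset.sum_eq_single q]
  · conv_lhs => rw [matrix_eq_sum_single (F (single p q 1))]
    simp
  · intro j _ hj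
    simp [hj.symm]
  · simp
  · intro i _ hi
    refine Finset.sum_eq_zero fun j _ => ?_
    simp [hi.symm]
  · simp

/-- Pointwise convergence suffices, since a linear functional of a superoperator is a finite
combination of the entries of its values on matrix units. -/
theorem tendsto_map_superop {V : Type} [AddCommGroup V] [Module ℂ V] [TopologicalSpace V]
    [ContinuousAdd V] [ContinuousSMul ℂ V] (Φ : Superop a b →ₗ[ℂ] V) {ι : Type} {l : Filter ι}
    {F : ι → Superop a b} {G : Superop a b} (h : ∀ X, Tendsto (fun i => F i X) l (𝓝 (G X))) :
    Tendsto (fun i => Φ (F i)) l (𝓝 (Φ G)) := by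
  have hΦ : ∀ F : Superop a b, Φ F = ∑ p, ∑ q, ∑ x, ∑ y, F (single p q 1) x y •
      Φ ((entryLinearMap ℂ ℂ p q).smulRight (single x y (1 : ℂ))) := by
    intro F
    conv_lhs => rw [superop_eq_sum F]
    simp only [map_sum, map_smul]
  rw [hΦ G]
  refine Tendsto.congr (fun i => (hΦ (F i)).symm) ?_
  refine tendsto_finsetSum _ fun p _ => tendsto_finsetSum _ fun q _ => tendsto_finsetSum _ fun x _ =>
    tendsto_finsetSum _ fun y _ => Tendsto.smul_const ?_ _
  exact tendsto_pi_nhds.mp (tendsto_pi_nhds.mp (h (single p q 1)) x) y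

/-- All closure operations of the cone are respected by linear maps, so only generators have to be
checked. -/
theorem KrausCone.map {𝒦 : Set (Matrix b a ℂ)} {𝒦' : Set (Matrix c' c ℂ)}
    (Φ : Superop a b →ₗ[ℂ] Superop c c') (hΦ : ∀ K ∈ 𝒦, KrausCone 𝒦' (Φ (CircuitCut.conj K)))
    {F : Superop a b} (hF : KrausCone 𝒦 F) : KrausCone 𝒦' (Φ F) := by
  induction hF with
  | conj hK => exact hΦ _ hK
  | zero => rw [map_zero]; exact KrausCone.zero
  | add _ _ ih₁ ih₂ => rw [map_add]; exact ih₁.add ih₂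
  | smul hr _ ih => rw [map_smul]; exact ih.smul hr
  | limit _ h ih =>
    exact KrausCone.limit ih fun X => tendsto_map_superop (LinearMap.applyₗ X ∘ₗ Φ) h

theorem KrausCone.comp {𝒦 : Set (Matrix c b ℂ)} {𝒦' : Set (Matrix b a ℂ)}
    {𝒦'' : Set (Matrix c a ℂ)} (h : ∀ K ∈ 𝒦, ∀ K' ∈ 𝒦', K * K' ∈ 𝒦'')
    {F : Superop b c} {G : Superop a b} (hF : KrausCone 𝒦 F) (hG : KrausCone 𝒦' G) :
    KrausCone 𝒦'' (F ∘ₗ G) := by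
  refine KrausCone.map (LinearMap.lcomp ℂ _ G) (fun K hK => ?_) hF
  refine KrausCone.map (LinearMap.compRight ℂ (CircuitCut.conj K)) (fun K' hK' => ?_) hG
  have : LinearMap.compRight ℂ (CircuitCut.conj K) (CircuitCut.conj K') =
      CircuitCut.conj (K * K') := sandwich_comp K K K' K'
  rw [this]
  exact KrausCone.conj (h K hK K' hK')

/-- Differences of two members of a cone of completely positive maps whose sum can be completed,
within the cone, to a trace-preserving map. -/
def SignedCone (𝒦 : Set (Matrix b a ℂ)) (F : Superop a b) : Prop :=
  ∃ P M R : Superop a b, KrausCone 𝒦 P ∧ KrausCone 𝒦 M ∧ KrausCone 𝒦 R ∧ F = P - M ∧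
    IsTP (P + M + R)

theorem SignedCone.comp {𝒦 : Set (Matrix c b ℂ)} {𝒦' : Set (Matrix b a ℂ)}
    {𝒦'' : Set (Matrix c a ℂ)} (h : ∀ K ∈ 𝒦, ∀ K' ∈ 𝒦', K * K' ∈ 𝒦'')
    {F : Superop b c} {G : Superop a b} (hF : SignedCone 𝒦 F) (hG : SignedCone 𝒦' G) :
    SignedCone 𝒦'' (F ∘ₗ G) := by
  obtain ⟨P, M, R, hP, hM, hR, rfl, hT⟩ := hF
  obtain ⟨P', M', R', hP', hM', hR', rfl, hT'⟩ := hG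
  -- Like signs go to the positive part and unlike signs to the negative part. The third map
  -- collects every term with `R` or `R'`, so that the total is the composition of two
  -- trace-preserving maps.
  refine ⟨P ∘ₗ P' + M ∘ₗ M', P ∘ₗ M' + M ∘ₗ P', (P + M) ∘ₗ R' + R ∘ₗ (P' + M' + R'),
    (hP.comp h hP').add (hM.comp h hM'), (hP.comp h hM').add (hM.comp h hP'),
    ((hP.add hM).comp h hR').add (hR.comp h ((hP'.add hM').add hR')), ?_, ?_⟩
  · simp only [LinearMap.sub_comp, LinearMap.comp_sub]
    abel
  · have : P ∘ₗ P' + M ∘ₗ M' + (P ∘ₗ M' + M ∘ₗ P') +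
        ((P + M) ∘ₗ R' + R ∘ₗ (P' + M' + R')) = (P + M + R) ∘ₗ (P' + M' + R') := by
      simp only [LinearMap.add_comp, LinearMap.comp_add]
      abel
    rw [this]
    exact fun X => (hT _).trans (hT' X)

theorem SignedCone.map {𝒦 : Set (Matrix b a ℂ)} {𝒦' : Set (Matrix c' c ℂ)}
    (Φ : Superop a b →ₗ[ℂ] Superop c c') (hΦ : ∀ K ∈ 𝒦, KrausCone 𝒦' (Φ (CircuitCut.conj K)))
    (hT : ∀ F, IsTP F → IsTP (Φ F)) {F : Superop a b} (hF : SignedCone 𝒦 F) :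
    SignedCone 𝒦' (Φ F) := by
  obtain ⟨P, M, R, hP, hM, hR, rfl, hTP⟩ := hF
  refine ⟨Φ P, Φ M, Φ R, hP.map Φ hΦ, hM.map Φ hΦ, hR.map Φ hΦ, map_sub _ _ _, ?_⟩
  rw [← map_add, ← map_add]
  exact hT _ hTP

/-- In finite dimensions the convergence of the outcome sum is absolute, so bounded coefficients
cannot destroy it. -/
theorem exists_superop_hasSum {ι : Type} {G : ι → Superop a b} {T : Superop a b}
    (hT : ∀ X, HasSum (fun i => G i X) (T X)) {r : ι → ℝ} (hr : ∀ i, |r i| ≤ 1) :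
    ∃ H : Superop a b, ∀ X, HasSum (fun i => (r i : ℂ) • G i X) (H X) := by
  have hs : ∀ X, Summable fun i => (r i : ℂ) • G i X := by
    intro X
    refine Pi.summable.mpr fun x => Pi.summable.mpr fun y => ?_
    have h₁ := (Pi.summable.mp (Pi.summable.mp (hT X).summable x) y).norm
    refine Summable.of_norm_bounded h₁ fun i => ?_
    change ‖(r i : ℂ) * G i X x y‖ ≤ ‖G i X x y‖
    rw [norm_mul, Complex.norm_real, Real.norm_eq_abs]
    exact mul_le_of_le_one_left (norm_nonneg _) (hr i)
  refine ⟨⟨⟨fun X => ∑' i, (r i : ℂ) • G i X, fun X Y => ?_⟩, fun z X => ?_⟩,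
    fun X => (hs X).hasSum⟩
  · simp only [map_add, smul_add]
    exact (hs X).tsum_add (hs Y)
  · simp only [map_smul, smul_comm _ z, RingHom.id_apply]
    exact (hs X).tsum_const_smul z

/-- `P`, `M` and `R` have coefficients `β⁺`, `β⁻` and `1 - |β|`, which add up to `1`; hence `P + M +
R` is the total map of the instrument. -/
theorem signedCone_of_hasSum {𝒦 : Set (Matrix b a ℂ)} {ι : Type} {G : ι → Superop a b}
    (hG : ∀ i, KrausCone 𝒦 (G i)) {T : Superop a b} (hTP : IsTP T)
    (hT : ∀ X, HasSum (fun i => G i X) (T X)) {β : ι → ℝ}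
    (hβ : ∀ i, β i ∈ Set.Icc (-1 : ℝ) 1) {F : Superop a b}
    (hF : ∀ X, HasSum (fun i => (β i : ℂ) • G i X) (F X)) : SignedCone 𝒦 F := by
  have hβ' : ∀ i, |β i| ≤ 1 := fun i => abs_le.mpr (hβ i)
  have key : ∀ r : ι → ℝ, (∀ i, 0 ≤ r i) → (∀ i, r i ≤ 1) → ∃ H : Superop a b, KrausCone 𝒦 H ∧
      ∀ X, HasSum (fun i => (r i : ℂ) • G i X) (H X) := by
    intro r h₀ h₁
    obtain ⟨H, hH⟩ := exists_superop_hasSum hT (r := r) fun i => abs_le.mpr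
      ⟨by linarith [h₀ i], h₁ i⟩
    exact ⟨H, KrausCone.hasSum (fun i => (hG i).smul (h₀ i)) hH, hH⟩
  obtain ⟨P, hP, hPs⟩ := key (fun i => (β i)⁺) (fun i => posPart_nonneg _)
    (fun i => sup_le (hβ i).2 zero_le_one)
  obtain ⟨M, hM, hMs⟩ := key (fun i => (β i)⁻) (fun i => negPart_nonneg _)
    (fun i => sup_le (by linarith [(hβ i).1]) zero_le_one)
  obtain ⟨R, hR, hRs⟩ := key (fun i => 1 - |β i|) (fun i => by linarith [hβ' i])
    (fun i => by linarith [abs_nonneg (β i)])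
  refine ⟨P, M, R, hP, hM, hR, LinearMap.ext fun X => ?_, ?_⟩
  · refine (hF X).unique ?_
    have := (hPs X).sub (hMs X)
    simp only [← sub_smul, ← Complex.ofReal_sub, posPart_sub_negPart] at this
    exact this
  · have : P + M + R = T := by
      refine LinearMap.ext fun X => ?_
      have := ((hPs X).add (hMs X)).add (hRs X)
      simp only [← add_smul, ← Complex.ofReal_add, posPart_add_negPart, add_sub_cancel,
        Complex.ofReal_one, one_smul] at this
      exact this.unique (hT X)
    rw [this]
    exact hTP

end KrausCone

/-! ### LOCC instruments have product Kraus operators, up to limits. -/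

section Separable

variable {a a' a'' b b' b'' : Type} [Fintype a] [DecidableEq a] [Fintype a'] [DecidableEq a']
  [Fintype a''] [DecidableEq a''] [Fintype b] [DecidableEq b] [Fintype b'] [DecidableEq b']
  [Fintype b''] [DecidableEq b'']

/-- The product operators. -/
def productOps (a b a' b' : Type) : Set (Matrix (a' × b') (a × b) ℂ) :=
  {K | ∃ M N, K = M ⊗ₖ N}

theorem productOps_mul {K : Matrix (a'' × b'') (a' × b') ℂ} {K' : Matrix (a' × b') (a × b) ℂ}
    (hK : K ∈ productOps a' b' a'' b'') (hK' : K' ∈ productOps a b a' b') :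
    K * K' ∈ productOps a b a'' b'' := by
  obtain ⟨M, N, rfl⟩ := hK
  obtain ⟨M', N', rfl⟩ := hK'
  exact ⟨M * M', N * N', (mul_kronecker_mul _ _ _ _).symm⟩

theorem krausCone_tensor {E : Superop a a'} {F : Superop b b'} (hE : IsCP E) (hF : IsCP F) :
    KrausCone (productOps a b a' b') (tensor E F) := by
  obtain ⟨m, m', _, _, K, M, h⟩ := hE.exists_kraus_tensor hF
  rw [h]
  exact KrausCone.sum _ fun p => KrausCone.conj ⟨_, _, rfl⟩

theorem IsOneWayLocal.krausCone {ι : Type} {G : ι → Superop (a × b) (a' × b')}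
    (hG : IsOneWayLocal G) (i : ι) : KrausCone (productOps a b a' b') (G i) := by
  rcases hG with ⟨E, T, hE, hT, h⟩ | ⟨T, E, hE, hT, h⟩
  · rw [h]
    exact krausCone_tensor (hE.cp i) (hT i).1
  · rw [h]
    exact krausCone_tensor (hT i).1 (hE.cp i)

theorem IsCoarseGraining.krausCone {𝒦 : Set (Matrix b a ℂ)} {ι κ : Type} {E : ι → Superop a b}
    {F : κ → Superop a b} (h : IsCoarseGraining E F) (hE : ∀ i, KrausCone 𝒦 (E i)) (k : κ) :
    KrausCone 𝒦 (F k) := by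
  obtain ⟨f, hf⟩ := h
  exact KrausCone.hasSum (E := fun i : {i // f i = k} => E i) (fun i => hE i) (hf k)

/-- Each round is a product map and products compose, so induction on rounds handles finite
protocols. Coarse-graining and infinitely many rounds use that the cone is closed. -/
theorem IsLOCCInstrument.krausCone {κ : Type} {G : κ → Superop (a × b) (a' × b')}
    (hG : IsLOCCInstrument κ G) (k : κ) : KrausCone (productOps a b a' b') (G k) := by
  obtain ⟨_, d, d', ι, P, Q, h0, _, hlink, hQ, hlim⟩ := hG
  have hP : ∀ ν i, KrausCone (productOps a b (a' × Fin (d ν)) (b' × Fin (d' ν))) (P ν i) := by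
    intro ν
    induction ν with
    | zero => exact h0.krausCone
    | succ ν ih =>
      obtain ⟨μ, K, hK, hc⟩ := hlink ν
      exact hc.krausCone fun p =>
        ((hK p.1).krausCone p.2).comp (fun _ h _ h' => productOps_mul h h') (ih p.1)
  refine KrausCone.limit (l := atTop) (F := fun ν => Q ν k) (fun ν => ?_) (hlim k)
  exact (hQ ν).krausCone (fun i => (krausCone_tensor isChannel_traceOut.1
    isChannel_traceOut.1).comp (fun _ h _ h' => productOps_mul h h') (hP ν i)) k

theorem signedCone_of_mem_LOCCStar {F : Superop (a × b) (a × b)} (hF : F ∈ LOCCStar a b) :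
    SignedCone (productOps a b a b) F := by
  obtain ⟨ι, G, β, hG, hβ, hs⟩ := hF
  obtain ⟨T, hTP, hT⟩ := hG.1.tp
  exact signedCone_of_hasSum hG.krausCone hTP hT hβ hs

end Separable

/-! ### The witness and the lower bound. -/

section Witness

variable {a b κ : Type} [Fintype a] [DecidableEq a] [Fintype b] [DecidableEq b] [Fintype κ]
  [DecidableEq κ]

/-- Bessel's inequality for the Hilbert–Schmidt inner product. -/
theorem sum_norm_trace_sq_le [Nonempty a] {L : κ → Matrix a a ℂ}
    (hL : ∀ k l, ((L k)ᴴ * L l).trace = if k = l then (Fintype.card a : ℂ) else 0)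
    (M : Matrix a a ℂ) :
    ∑ k, ‖((L k)ᴴ * M).trace‖ ^ 2 ≤ Fintype.card a * (Mᴴ * M).trace.re := by
  have hd : (0 : ℝ) < Fintype.card a := by exact_mod_cast Fintype.card_pos
  have hd' : (Fintype.card a : ℂ) ≠ 0 := by exact_mod_cast hd.ne'
  let c : κ → ℂ := fun k => ((L k)ᴴ * M).trace
  -- The orthogonal projection of `M` onto the span of the `L k`, whose squared norm is the
  -- dimension; the inequality is positivity of the squared norm of `M - N`.
  let N : Matrix a a ℂ := ∑ k, (c k / Fintype.card a) • L k
  have h₁ : (Nᴴ * M).trace = ((∑ k, ‖c k‖ ^ 2 / Fintype.card a : ℝ) : ℂ) := by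
    simp only [N, conjTranspose_sum, conjTranspose_smul, Matrix.sum_mul, Matrix.smul_mul,
      trace_sum, trace_smul, smul_eq_mul, Complex.ofReal_sum]
    refine Finset.sum_congr rfl fun k _ => ?_
    change star (c k / Fintype.card a) * c k = _
    rw [star_div₀, div_mul_eq_mul_div, Complex.star_def, Complex.conj_mul']
    simp
  have h₂ : (Mᴴ * N).trace = ((∑ k, ‖c k‖ ^ 2 / Fintype.card a : ℝ) : ℂ) := by
    have : Mᴴ * N = (Nᴴ * M)ᴴ := by rw [conjTranspose_mul, conjTranspose_conjTranspose]
    rw [this, trace_conjTranspose, h₁, Complex.star_def, Complex.conj_ofReal]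
  have h₃ : (Nᴴ * N).trace = ((∑ k, ‖c k‖ ^ 2 / Fintype.card a : ℝ) : ℂ) := by
    simp only [N, conjTranspose_sum, conjTranspose_smul, Matrix.sum_mul, Matrix.mul_sum,
      Matrix.smul_mul, Matrix.mul_smul, trace_sum, trace_smul, smul_eq_mul, Complex.ofReal_sum, hL]
    refine Finset.sum_congr rfl fun k _ => ?_
    simp only [mul_ite, mul_zero, Finset.sum_ite_eq', Finset.mem_univ, if_true]
    rw [star_div₀, star_natCast, div_mul_cancel₀ _ hd', div_mul_eq_mul_div, Complex.star_def,
      Complex.mul_conj']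
    simp
  have h₄ : 0 ≤ ((M - N)ᴴ * (M - N)).trace :=
    (posSemidef_conjTranspose_mul_self (M - N)).trace_nonneg
  rw [conjTranspose_sub, Matrix.sub_mul, Matrix.mul_sub, Matrix.mul_sub, trace_sub, trace_sub,
    trace_sub, h₁, h₂, h₃] at h₄
  have h₅ := (Complex.le_def.mp h₄).1
  simp only [Complex.zero_re, Complex.sub_re, Complex.ofReal_re, sub_self, sub_zero,
    ← Finset.sum_div] at h₅
  rw [sub_nonneg, div_le_iff₀ hd] at h₅
  rw [mul_comm]
  exact h₅

/-- The quadratic form `K ↦ |tr (Ω† K)|²`, as a linear functional of the map `X ↦ K X K†`. -/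
noncomputable def overlap (Ω : Matrix b a ℂ) : Superop a b →ₗ[ℂ] ℂ :=
  ∑ p, ∑ q, ∑ x, ∑ y, (star (Ω x p) * Ω y q) •
    ((entryLinearMap ℂ ℂ x y) ∘ₗ LinearMap.applyₗ (single p q (1 : ℂ)))

theorem overlap_conj (Ω K : Matrix b a ℂ) :
    overlap Ω (conj K) = ((‖(Ωᴴ * K).trace‖ ^ 2 : ℝ) : ℂ) := by
  have hz : (Ωᴴ * K).trace = ∑ p, ∑ x, star (Ω x p) * K x p := by
    simp [trace, mul_apply]
  have h₁ : overlap Ω (conj K) = ∑ p, ∑ q, ∑ x, ∑ y,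
      (star (Ω x p) * K x p) * (Ω y q * star (K y q)) := by
    simp only [overlap, LinearMap.sum_apply, LinearMap.smul_apply, LinearMap.comp_apply,
      LinearMap.applyₗ_apply_apply, entryLinearMap_apply, conj_eq_sandwich,
      sandwich_apply_single, smul_eq_mul]
    refine Finset.sum_congr rfl fun p _ => Finset.sum_congr rfl fun q _ =>
      Finset.sum_congr rfl fun x _ => Finset.sum_congr rfl fun y _ => by ring
  have h₂ : ((‖(Ωᴴ * K).trace‖ ^ 2 : ℝ) : ℂ) = (Ωᴴ * K).trace * star ((Ωᴴ * K).trace) := by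
    rw [Complex.star_def, Complex.mul_conj', Complex.ofReal_pow]
  rw [h₁, h₂, hz, star_sum, Finset.sum_mul_sum]
  refine Finset.sum_congr rfl fun p _ => Finset.sum_congr rfl fun q _ => ?_
  rw [star_sum, Finset.sum_mul_sum]
  simp only [star_mul', star_star]

theorem trace_conj_one (K : Matrix b a ℂ) : (conj K 1).trace = (Kᴴ * K).trace := by
  rw [conj_eq_sandwich, sandwich_apply, Matrix.mul_one, trace_mul_comm]

variable {U : Matrix (a × b) (a × b) ℂ} {u : κ → ℝ} {L : κ → Matrix a a ℂ} {R : κ → Matrix b b ℂ}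

/-- For a product `M ⊗ N` the overlap with `Ω` is `∑ tr (L k† M) tr (R k† N)`; Cauchy–Schwarz and
Bessel on each side bound its square. Both inequalities are linear and closed, hence pass to the
whole cone. -/
theorem IsUnitarySchmidt.overlap_bounds [Nonempty a] [Nonempty b] (h : IsUnitarySchmidt U u L R)
    {F : Superop (a × b) (a × b)} (hF : KrausCone (productOps a b a b) F) :
    0 ≤ (overlap (∑ k, L k ⊗ₖ R k) F).re ∧ (overlap (∑ k, L k ⊗ₖ R k) F).re ≤
      (Fintype.card a * Fintype.card b) * (F 1).trace.re := by
  induction hF with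
  | conj hK =>
    obtain ⟨M, N, rfl⟩ := hK
    rw [overlap_conj, Complex.ofReal_re, trace_conj_one, conjTranspose_kronecker,
      ← mul_kronecker_mul, trace_kronecker]
    refine ⟨by positivity, ?_⟩
    have hM := sum_norm_trace_sq_le h.left_orthogonal M
    have hN := sum_norm_trace_sq_le h.right_orthogonal N
    have e₁ : ((∑ k, L k ⊗ₖ R k)ᴴ * M ⊗ₖ N).trace =
        ∑ k, ((L k)ᴴ * M).trace * ((R k)ᴴ * N).trace := by
      simp only [conjTranspose_sum, Matrix.sum_mul, trace_sum, conjTranspose_kronecker,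
        ← mul_kronecker_mul, trace_kronecker]
    have e₂ : ‖((∑ k, L k ⊗ₖ R k)ᴴ * M ⊗ₖ N).trace‖ ≤
        ∑ k, ‖((L k)ᴴ * M).trace‖ * ‖((R k)ᴴ * N).trace‖ := by
      rw [e₁]
      refine (norm_sum_le _ _).trans_eq (Finset.sum_congr rfl fun k _ => norm_mul _ _)
    have e₃ := Finset.sum_mul_sq_le_sq_mul_sq Finset.univ (fun k => ‖((L k)ᴴ * M).trace‖)
      (fun k => ‖((R k)ᴴ * N).trace‖)
    have e₄ : ((Mᴴ * M).trace * (Nᴴ * N).trace).re = (Mᴴ * M).trace.re * (Nᴴ * N).trace.re := by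
      have := (Complex.le_def.mp (posSemidef_conjTranspose_mul_self M).trace_nonneg).2
      rw [Complex.mul_re, ← this]
      simp
    rw [e₄]
    calc _ ≤ (∑ k, ‖((L k)ᴴ * M).trace‖ * ‖((R k)ᴴ * N).trace‖) ^ 2 := by gcongr
      _ ≤ _ := e₃
      _ ≤ (Fintype.card a * (Mᴴ * M).trace.re) * (Fintype.card b * (Nᴴ * N).trace.re) :=
        mul_le_mul hM hN (by positivity) (le_trans (by positivity) hM)
      _ = _ := by ring
  | zero => simp
  | add _ _ ih₁ ih₂ =>
    simp only [map_add, LinearMap.add_apply, trace_add, Complex.add_re, mul_add]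
    exact ⟨add_nonneg ih₁.1 ih₂.1, add_le_add ih₁.2 ih₂.2⟩
  | @smul F r hr _ ih =>
    simp only [map_smul, LinearMap.smul_apply, trace_smul, smul_eq_mul, Complex.re_ofReal_mul]
    refine ⟨mul_nonneg hr ih.1, ?_⟩
    nlinarith [mul_le_mul_of_nonneg_left ih.2 hr]
  | limit _ hlim ih =>
    have t₁ := (Complex.continuous_re.tendsto _).comp
      (tendsto_map_superop (overlap (∑ k, L k ⊗ₖ R k)) hlim)
    have t₂ := (Complex.continuous_re.tendsto _).comp
      (tendsto_map_superop (traceLinearMap (a × b) ℂ ℂ ∘ₗ LinearMap.applyₗ 1) hlim)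
    exact ⟨ge_of_tendsto' t₁ fun i => (ih i).1,
      le_of_tendsto_of_tendsto' t₁ (t₂.const_mul _) fun i => (ih i).2⟩

/-- The entanglement witness of a unitary, as a functional of superoperators. -/
noncomputable def witness (Ω : Matrix (a × b) (a × b) ℂ) (F : Superop (a × b) (a × b)) : ℝ :=
  2 * (overlap Ω F).re / (Fintype.card a * Fintype.card b) ^ 2 -
    (F 1).trace.re / (Fintype.card a * Fintype.card b)

/-- With `d` the total dimension and `t = tr F(1)`, the first term of the witness lies between `0`
and `2 t / d` on the cone; subtracting `t / d` centres this interval. The traces of the three parts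
add up to `d`. -/
theorem IsUnitarySchmidt.abs_witness_le [Nonempty a] [Nonempty b] (h : IsUnitarySchmidt U u L R)
    {F : Superop (a × b) (a × b)} (hF : SignedCone (productOps a b a b) F) :
    |witness (∑ k, L k ⊗ₖ R k) F| ≤ 1 := by
  obtain ⟨P, M, Q, hP, hM, hQ, rfl, hT⟩ := hF
  have hd : (0 : ℝ) < Fintype.card a * Fintype.card b := by
    have h₁ : 0 < Fintype.card a := Fintype.card_pos
    have h₂ : 0 < Fintype.card b := Fintype.card_pos
    positivity
  have hw : ∀ {F : Superop (a × b) (a × b)}, KrausCone (productOps a b a b) F →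
      |witness (∑ k, L k ⊗ₖ R k) F| ≤ (F 1).trace.re / (Fintype.card a * Fintype.card b) := by
    intro F hF
    obtain ⟨h₁, h₂⟩ := h.overlap_bounds hF
    rw [abs_le, witness]
    generalize (overlap (∑ k, L k ⊗ₖ R k) F).re = g at *
    generalize (F 1).trace.re = t at *
    generalize (Fintype.card a * Fintype.card b : ℝ) = d at *
    have h₃ : 0 ≤ 2 * g / d ^ 2 := by positivity
    have h₄ : 2 * g / d ^ 2 ≤ 2 * (t / d) := by
      rw [div_le_iff₀ (by positivity)]
      have : 2 * (t / d) * d ^ 2 = 2 * (d * t) := by field_simp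
      rw [this]; linarith
    constructor <;> linarith
  have hsub : witness (∑ k, L k ⊗ₖ R k) (P - M) =
      witness (∑ k, L k ⊗ₖ R k) P - witness (∑ k, L k ⊗ₖ R k) M := by
    simp only [witness, map_sub, LinearMap.sub_apply, trace_sub, Complex.sub_re]
    ring
  have htr := congrArg Complex.re (hT 1)
  simp only [LinearMap.add_apply, trace_add, Complex.add_re, trace_one] at htr
  have hc : ((Fintype.card (a × b) : ℂ)).re = Fintype.card a * Fintype.card b := by
    rw [Fintype.card_prod]; simp
  rw [hc] at htr
  have h₁ := hw hP
  have h₂ := hw hM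
  have h₃ := (abs_nonneg _).trans (hw hQ)
  have h₄ : (P 1).trace.re / (Fintype.card a * Fintype.card b) +
      (M 1).trace.re / (Fintype.card a * Fintype.card b) +
      (Q 1).trace.re / (Fintype.card a * Fintype.card b) = 1 := by
    rw [← add_div, ← add_div, htr, div_self hd.ne']
  rw [hsub]
  refine (abs_sub _ _).trans ?_
  linarith

/-- By orthogonality `tr (Ω† U) = d ∑ u`, so `Ω` attains the sum of the Schmidt coefficients. -/
theorem IsUnitarySchmidt.witness_conj [Nonempty a] [Nonempty b] (h : IsUnitarySchmidt U u L R) :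
    witness (∑ k, L k ⊗ₖ R k) (conj U) = 2 * (∑ k, u k) ^ 2 - 1 := by
  have hd : (0 : ℝ) < Fintype.card a * Fintype.card b := by
    have h₁ : 0 < Fintype.card a := Fintype.card_pos
    have h₂ : 0 < Fintype.card b := Fintype.card_pos
    positivity
  have h₁ : ((∑ k, L k ⊗ₖ R k)ᴴ * U).trace =
      (((∑ k, u k) * (Fintype.card a * Fintype.card b) : ℝ) : ℂ) := by
    simp only [h.eq_sum, conjTranspose_sum, Matrix.sum_mul, Matrix.mul_sum, Matrix.mul_smul,
      trace_sum, trace_smul, conjTranspose_kronecker, ← mul_kronecker_mul, trace_kronecker,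
      h.left_orthogonal, h.right_orthogonal]
    simp [Finset.sum_mul]
  have h₂ : (Uᴴ * U).trace = ((Fintype.card a * Fintype.card b : ℝ) : ℂ) := by
    simp only [h.eq_sum, conjTranspose_sum, Matrix.sum_mul, Matrix.mul_sum, Matrix.mul_smul,
      Matrix.smul_mul, conjTranspose_smul, trace_sum, trace_smul, conjTranspose_kronecker,
      ← mul_kronecker_mul, trace_kronecker, h.left_orthogonal, h.right_orthogonal]
    have := congrArg (fun x : ℝ => (x : ℂ)) h.sum_sq
    simp only [Complex.ofReal_sum, Complex.ofReal_one, Complex.ofReal_pow] at this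
    simp [← mul_assoc, ← Finset.sum_mul, ← pow_two, this]
  rw [witness, overlap_conj, trace_conj_one, h₁, h₂, Complex.ofReal_re, Complex.ofReal_re,
    Complex.norm_real, Real.norm_eq_abs, sq_abs]
  field_simp

/-- A quasiprobability decomposition of a unitary into maps whose signed parts are generated by
product operators has weight at least the value of the witness. -/
theorem IsUnitarySchmidt.le_sum_abs [Nonempty a] [Nonempty b] (h : IsUnitarySchmidt U u L R)
    {m : ℕ} {w : Fin m → ℝ} {F : Fin m → Superop (a × b) (a × b)}
    (hF : ∀ i, SignedCone (productOps a b a b) (F i)) (hU : conj U = ∑ i, (w i : ℂ) • F i) :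
    2 * (∑ k, u k) ^ 2 - 1 ≤ ∑ i, |w i| := by
  have hlin : witness (∑ k, L k ⊗ₖ R k) (∑ i, (w i : ℂ) • F i) =
      ∑ i, w i * witness (∑ k, L k ⊗ₖ R k) (F i) := by
    simp only [witness, map_sum, map_smul, LinearMap.sum_apply, LinearMap.smul_apply, trace_sum,
      trace_smul, smul_eq_mul, Complex.re_sum, Complex.re_ofReal_mul, Finset.mul_sum,
      Finset.sum_div, ← Finset.sum_sub_distrib]
    exact Finset.sum_congr rfl fun i _ => by ring
  rw [← h.witness_conj, hU, hlin]
  refine Finset.sum_le_sum fun i _ => ?_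
  refine (le_abs_self _).trans ?_
  rw [abs_mul]
  exact mul_le_of_le_one_right (abs_nonneg _) (h.abs_witness_le (hF i))

theorem IsUnitarySchmidt.le_extent [Nonempty a] [Nonempty b] (h : IsUnitarySchmidt U u L R) :
    ENNReal.ofReal (2 * (∑ k, u k) ^ 2 - 1) ≤ extent (LOStar a b) (conj U) := by
  refine le_sInf ?_
  rintro t ⟨m, w, F, _, hF, hE, rfl⟩
  exact ENNReal.ofReal_le_ofReal (h.le_sum_abs
    (fun i => signedCone_of_mem_LOCCStar (LOStar_subset_LOCCStar (hF i))) hE)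

end Witness

/-! ### Black box lower bound: signed cones through circuits with ancillas. -/

section CutCone

variable {a b A B RA RB EA EB h r s : Type} [Fintype a] [DecidableEq a] [Fintype b] [DecidableEq b]
  [Fintype A] [DecidableEq A] [Fintype B] [DecidableEq B] [Fintype RA] [DecidableEq RA]
  [Fintype RB] [DecidableEq RB] [Fintype EA] [DecidableEq EA] [Fintype EB] [DecidableEq EB]
  [Fintype h] [DecidableEq h] [Fintype r] [DecidableEq r] [Fintype s] [DecidableEq s]

/-- The operators on `(A B) (EA EB)` that are products of operators on `A EA` and `B EB`. -/
def cutOps (A B EA EB : Type) : Set (Matrix ((A × B) × (EA × EB)) ((A × B) × (EA × EB)) ℂ) :=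
  {K | ∃ (M : Matrix (A × EA) (A × EA) ℂ) (N : Matrix (B × EB) (B × EB) ℂ),
    K = (M ⊗ₖ N).submatrix (Equiv.prodProdProdComm A B EA EB) (Equiv.prodProdProdComm A B EA EB)}

theorem cutOps_mul {K K' : Matrix ((A × B) × (EA × EB)) ((A × B) × (EA × EB)) ℂ}
    (hK : K ∈ cutOps A B EA EB) (hK' : K' ∈ cutOps A B EA EB) : K * K' ∈ cutOps A B EA EB := by
  obtain ⟨M, N, rfl⟩ := hK
  obtain ⟨M', N', rfl⟩ := hK'
  exact ⟨M * M', N * N', by rw [submatrix_mul_equiv, mul_kronecker_mul]⟩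

/-- `onSubsystem W` as a linear map. -/
def onSubsystemLinear (W : Matrix (s × r) h ℂ) : Superop s s →ₗ[ℂ] Superop h h where
  toFun := onSubsystem W
  map_add' E F := by
    have := onSubsystem_sum_smul W (fun _ : Fin 2 => 1) ![E, F]
    simpa [Fin.sum_univ_two] using this
  map_smul' z E := by
    have := onSubsystem_sum_smul W (fun _ : Unit => z) (fun _ => E)
    simpa using this

theorem IsTP.onSubsystem {W : Matrix (s × r) h ℂ} (hW : IsUnitaryMap W) {E : Superop s s}
    (hE : IsTP E) : IsTP (onSubsystem W E) := by
  intro X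
  have h₁ : IsChannel (conj W) := isChannel_conj hW.1
  have h₂ : IsChannel (conj Wᴴ) := isChannel_conj (by rw [conjTranspose_conjTranspose]; exact hW.2)
  exact (h₂.2 _).trans ((isTP_tensor _ _ hE (fun _ => rfl) _).trans (h₁.2 X))

/-- Each ancilla is regrouped with its party, so that operators which are products across the cut
remain products after the embedding. -/
theorem cutFrame_eq_gateFrame (VA : Matrix (a × RA) A ℂ) (VB : Matrix (b × RB) B ℂ) :
    cutFrame EA EB VA VB =
      (gateFrame ((VA ⊗ₖ (1 : Matrix EA EA ℂ)).submatrix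
          (fun x : (a × EA) × RA => ((x.1.1, x.2), x.1.2)) id)
        ((VB ⊗ₖ (1 : Matrix EB EB ℂ)).submatrix
          (fun x : (b × EB) × RB => ((x.1.1, x.2), x.1.2)) id)).submatrix id
        (Equiv.prodProdProdComm A B EA EB) := by
  ext x y
  rw [cutFrame, ← one_kronecker_one]
  simp only [gateFrame, submatrix_apply, kroneckerMap_apply, id, Equiv.prodProdProdComm,
    Equiv.coe_fn_mk]
  ring

theorem SignedCone.onSubsystem_cutFrame {VA : Matrix (a × RA) A ℂ} {VB : Matrix (b × RB) B ℂ}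
    (hA : IsUnitaryMap VA) (hB : IsUnitaryMap VB)
    {F : Superop ((a × EA) × (b × EB)) ((a × EA) × (b × EB))}
    (hF : SignedCone (productOps (a × EA) (b × EB) (a × EA) (b × EB)) F) :
    SignedCone (cutOps A B EA EB) (onSubsystem (cutFrame EA EB VA VB) F) := by
  refine hF.map (onSubsystemLinear (cutFrame EA EB VA VB)) ?_ fun F hF =>
    hF.onSubsystem ⟨cutFrame_conjTranspose_mul hA hB, cutFrame_mul_conjTranspose hA hB⟩
  rintro K ⟨M, N, rfl⟩
  change KrausCone _ (onSubsystem (cutFrame EA EB VA VB) (conj (M ⊗ₖ N)))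
  rw [conj_eq_sandwich, onSubsystem_sandwich, ← conj_eq_sandwich]
  refine KrausCone.conj ?_
  rw [cutFrame_eq_gateFrame]
  generalize (VA ⊗ₖ (1 : Matrix EA EA ℂ)).submatrix
    (fun x : (a × EA) × RA => ((x.1.1, x.2), x.1.2)) id = cA
  generalize (VB ⊗ₖ (1 : Matrix EB EB ℂ)).submatrix
    (fun x : (b × EB) × RB => ((x.1.1, x.2), x.1.2)) id = cB
  refine ⟨cAᴴ * (M ⊗ₖ (1 : Matrix RA RA ℂ)) * cA, cBᴴ * (N ⊗ₖ (1 : Matrix RB RB ℂ)) * cB, ?_⟩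
  rw [← gateFrame_conj]
  rfl

theorem signedCone_alternate {𝒦 : Set (Matrix h h ℂ)} (h𝒦 : ∀ K ∈ 𝒦, ∀ K' ∈ 𝒦, K * K' ∈ 𝒦) :
    ∀ {n : ℕ} (g : Fin (n + 1) → Superop h h), (∀ j, SignedCone 𝒦 (g j)) →
      SignedCone 𝒦 (alternate g fun _ => LinearMap.id)
  | 0, g, hg => hg 0
  | n + 1, g, hg => by
    rw [alternate_succ, LinearMap.id_comp]
    exact (hg _).comp h𝒦 (signedCone_alternate h𝒦 _ fun j => hg j.castSucc)

/-- Preparing `|e⟩` and tracing out replaces `K` by the operators `⟨k| K |e⟩`. These are products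
because `e` and the basis vectors `k` are product states of the two ancillas. -/
theorem SignedCone.traceOut_adjoin {G : Superop ((A × B) × (EA × EB)) ((A × B) × (EA × EB))}
    (hG : SignedCone (cutOps A B EA EB) G) (e : EA × EB) :
    SignedCone (productOps A B A B) (traceOut ∘ₗ G ∘ₗ adjoin e) := by
  refine hG.map (LinearMap.compRight ℂ (traceOut : Superop ((A × B) × (EA × EB)) (A × B)) ∘ₗ
    LinearMap.lcomp ℂ _ (adjoin e : Superop (A × B) ((A × B) × (EA × EB)))) ?_ ?_
  · rintro K ⟨M, N, rfl⟩
    change KrausCone _ (traceOut ∘ₗ conj _ ∘ₗ adjoin e)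
    have : (traceOut : Superop ((A × B) × (EA × EB)) (A × B)) ∘ₗ
        conj ((M ⊗ₖ N).submatrix (Equiv.prodProdProdComm A B EA EB)
          (Equiv.prodProdProdComm A B EA EB)) ∘ₗ adjoin e =
        ∑ k : EA × EB, conj ((of fun x y => M (x, k.1) (y, e.1)) ⊗ₖ
          (of fun x y => N (x, k.2) (y, e.2))) := by
      rw [adjoin_eq_conj, traceOut_eq_sum_conj]
      refine superop_ext_single fun p q => ?_
      simp only [LinearMap.comp_apply, LinearMap.sum_apply]
      refine Finset.sum_congr rfl fun k _ => ?_
      rw [← LinearMap.comp_apply, ← LinearMap.comp_apply, conj_eq_sandwich, conj_eq_sandwich,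
        conj_eq_sandwich, conj_eq_sandwich, sandwich_comp, sandwich_comp]
      congr 2 <;>
      · ext x y
        simp [mul_apply, Equiv.prodProdProdComm]
    rw [this]
    exact KrausCone.sum _ fun k => KrausCone.conj ⟨_, _, rfl⟩
  · intro F hF X
    exact (trace_traceOut _).trans ((hF _).trans ((isChannel_adjoin e).2 X))

end CutCone

/-! ### Gates on distinct sites compose to the tensor product. -/

section Parallel

variable {a b : Type} [Fintype a] [DecidableEq a] [Fintype b] [DecidableEq b]

theorem bipartiteKron_mul {N : ℕ} (U V : Fin N → Matrix (a × b) (a × b) ℂ) :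
    bipartiteKron U * bipartiteKron V = bipartiteKron fun i => U i * V i := by
  rw [bipartiteKron_eq_submatrix, bipartiteKron_eq_submatrix, submatrix_mul_equiv, piKron_mul]
  rfl

/-- Gates at distinct sites multiply site by site. The injective `σ` makes the induction possible,
since a shorter circuit covers only some of the `N` sites. -/
theorem alternate_conj_bipartiteKron {N : ℕ} (U : Fin N → Matrix (a × b) (a × b) ℂ) :
    ∀ {n : ℕ} (σ : Fin (n + 1) → Fin N), Function.Injective σ →
      alternate (fun j => conj (bipartiteKron (Function.update 1 (σ j) (U (σ j)))))
        (fun _ => LinearMap.id) =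
      conj (bipartiteKron fun i => open Classical in if i ∈ Set.range σ then U i else 1)
  | 0, σ, _ => by
    simp only [alternate]
    congr 2
    funext i
    by_cases hi : i = σ 0
    · subst hi; simp
    · rw [Function.update_of_ne hi, if_neg]
      · rfl
      · rintro ⟨j, rfl⟩
        exact hi (congrArg σ (Fin.fin_one_eq_zero j))
  | n + 1, σ, hσ => by
    rw [alternate_succ, LinearMap.id_comp, alternate_conj_bipartiteKron U (fun j => σ j.castSucc)
      (hσ.comp (Fin.castSucc_injective _)), conj_eq_sandwich, conj_eq_sandwich, sandwich_comp,
      bipartiteKron_mul, ← conj_eq_sandwich]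
    congr 2
    funext i
    by_cases hi : i = σ (Fin.last (n + 1))
    · subst hi
      rw [Function.update_self, if_neg, if_pos ⟨_, rfl⟩, Matrix.mul_one]
      rintro ⟨j, hj⟩
      exact (Fin.castSucc_lt_last j).ne (hσ hj)
    · rw [Function.update_of_ne hi, Pi.one_apply, Matrix.one_mul]
      congr 1
      refine propext ⟨fun ⟨j, hj⟩ => ⟨j.castSucc, hj⟩, fun ⟨j, hj⟩ => ?_⟩
      refine Fin.lastCases (fun hj => absurd hj.symm hi) (fun j hj => ⟨j, hj⟩) j hj

/-- The embedding of the system at site `j` into a family of systems. -/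
def siteFrame (a : Type) [DecidableEq a] {N : ℕ} (j : Fin N) :
    Matrix (a × ({i // i ≠ j} → a)) (Fin N → a) ℂ :=
  (1 : Matrix (Fin N → a) (Fin N → a) ℂ).submatrix (Equiv.funSplitAt j a).symm id

theorem isUnitaryMap_siteFrame {N : ℕ} (j : Fin N) : IsUnitaryMap (siteFrame a j) := by
  constructor
  · have := submatrix_conjTranspose_mul_mul (1 : Matrix (Fin N → a) (Fin N → a) ℂ)
      (Equiv.funSplitAt j a).symm 1
    rw [Matrix.mul_one] at this
    rw [siteFrame, this]
    simp
  · rw [siteFrame, conjTranspose_submatrix, ← submatrix_mul _ _ _ _ _ Function.bijective_id]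
    simp

theorem onSubsystem_siteFrame {N : ℕ} (j : Fin N) (U : Matrix (a × b) (a × b) ℂ) :
    onSubsystem (gateFrame (siteFrame a j) (siteFrame b j)) (conj U) =
      conj (bipartiteKron (Function.update 1 j U)) := by
  rw [conj_eq_sandwich, onSubsystem_sandwich, ← conj_eq_sandwich]
  congr 1
  have : gateFrame (siteFrame a j) (siteFrame b j) =
      (1 : Matrix ((Fin N → a) × (Fin N → b)) ((Fin N → a) × (Fin N → b)) ℂ).submatrix
        ((gateEquiv _ _ _ _).trans ((Equiv.funSplitAt j a).symm.prodCongr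
          (Equiv.funSplitAt j b).symm)) id := by
    rw [← one_kronecker_one, gateFrame_eq, siteFrame, siteFrame]
    rfl
  rw [this, submatrix_conjTranspose_mul_mul, conjTranspose_one, Matrix.one_mul, Matrix.mul_one]
  ext x y
  rw [bipartiteKron, of_apply, ← Finset.mul_prod_erase _ _ (Finset.mem_univ j)]
  have hprod : ∏ i ∈ Finset.univ.erase j, Function.update (1 : Fin N → Matrix (a × b) (a × b) ℂ) j U i
      (x.1 i, x.2 i) (y.1 i, y.2 i) =
      ∏ i ∈ Finset.univ.erase j, if (x.1 i, x.2 i) = (y.1 i, y.2 i) then (1 : ℂ) else 0 := by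
    refine Finset.prod_congr rfl fun i hi => ?_
    rw [Function.update_of_ne (Finset.ne_of_mem_erase hi), Pi.one_apply, one_apply]
  rw [hprod, Function.update_self, submatrix_apply, kroneckerMap_apply, one_apply]
  congr 1
  by_cases hxy : ∀ i ∈ Finset.univ.erase j, (x.1 i, x.2 i) = (y.1 i, y.2 i)
  · rw [Finset.prod_congr rfl fun i hi => if_pos (hxy i hi), Finset.prod_const_one, if_pos]
    have hxy (i : {i // i ≠ j}) := Prod.ext_iff.1 (hxy i (Finset.mem_erase.2 ⟨i.2, Finset.mem_univ _⟩))
    exact Prod.ext (funext fun i => (hxy i).1) (funext fun i => (hxy i).2)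
  · push Not at hxy
    obtain ⟨i, hi, hne⟩ := hxy
    rw [Finset.prod_eq_zero hi (if_neg hne), if_neg]
    intro h
    have hi : i ≠ j := Finset.ne_of_mem_erase hi
    exact hne (Prod.ext (congrFun (congrArg Prod.fst h) ⟨i, hi⟩)
      (congrFun (congrArg Prod.snd h) ⟨i, hi⟩))

theorem le_blackBoxExtent [Nonempty a] [Nonempty b] {κ : Type} [Fintype κ] [DecidableEq κ] {n : ℕ}
    {U : Fin (n + 1) → Matrix (a × b) (a × b) ℂ} {u : Fin (n + 1) → κ → ℝ}
    {L : Fin (n + 1) → κ → Matrix a a ℂ} {R : Fin (n + 1) → κ → Matrix b b ℂ}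
    (h : ∀ i, IsUnitarySchmidt (U i) (u i) (L i) (R i)) :
    ENNReal.ofReal (2 * (∑ k : Fin (n + 1) → κ, ∏ i, u i (k i)) ^ 2 - 1) ≤
      blackBoxExtent LOCCStar fun i => conj (U i) := by
  refine le_sInf ?_
  rintro t ⟨EA, EB, _, _, _, _, a₀, b₀, m, w, F, _, hF, hqpd, rfl⟩
  -- A black box decomposition must work for every circuit, in particular for the one placing the
  -- gates on different pairs of sites with nothing in between.
  have hE := hqpd (Fin (n + 1) → a) (Fin (n + 1) → b) (fun j => {i // i ≠ j} → a)
    (fun j => {i // i ≠ j} → b) (fun j => siteFrame a j) (fun j => siteFrame b j)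
    (fun _ => LinearMap.id) isUnitaryMap_siteFrame isUnitaryMap_siteFrame (fun _ => isChannel_id)
  have hU := alternate_conj_bipartiteKron U (fun j : Fin (n + 1) => j) Function.injective_id
  have hU' : (fun i => open Classical in if i ∈ Set.range (fun j : Fin (n + 1) => j) then U i else 1)
      = U := by
    funext i
    exact if_pos ⟨i, rfl⟩
  rw [hU'] at hU
  simp only [onSubsystem_siteFrame] at hE
  rw [hU] at hE
  -- The composed maps need not be shown to lie in LOCC⋆: the witness bound only needs the signed
  -- cone, which is stable under composition and removal of the ancillas.
  refine ENNReal.ofReal_le_ofReal ((IsUnitarySchmidt.bipartiteKron h).le_sum_abs (fun i => ?_) hE)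
  rw [tensor_id_id]
  exact (signedCone_alternate (fun _ h _ h' => cutOps_mul h h') _ fun j =>
    (signedCone_of_mem_LOCCStar (hF i j)).onSubsystem_cutFrame (isUnitaryMap_siteFrame j)
      (isUnitaryMap_siteFrame j)).traceOut_adjoin _

end Parallel

end CircuitCut

open CircuitCut
theorem mainTheorem2 (n : ℕ) (U : Fin (n + 1) → Matrix.unitaryGroup (Fin 2 × Fin 2) ℂ) :
    blackBoxExtent LOStar (fun i => conj (U i : Matrix (Fin 2 × Fin 2) (Fin 2 × Fin 2) ℂ)) =
      blackBoxExtent LOCCStar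
        (fun i => conj (U i : Matrix (Fin 2 × Fin 2) (Fin 2 × Fin 2) ℂ)) ∧
    blackBoxExtent LOCCStar
        (fun i => conj (U i : Matrix (Fin 2 × Fin 2) (Fin 2 × Fin 2) ℂ)) =
      extent (LOStar (Fin (n + 1) → Fin 2) (Fin (n + 1) → Fin 2))
        (tensorFamily fun i => conj (U i : Matrix (Fin 2 × Fin 2) (Fin 2 × Fin 2) ℂ)) := by
  choose u L R h using fun i => exists_isUnitarySchmidt (U i)
  have h₁ := blackBoxExtent_LOCCStar_le
    fun i => conj (U i : Matrix (Fin 2 × Fin 2) (Fin 2 × Fin 2) ℂ)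
  have h₂ := blackBoxExtent_LOStar_le h
  have h₃ := le_blackBoxExtent h
  have h₄ := (IsUnitarySchmidt.bipartiteKron h).extent_conj_le
  have h₅ := (IsUnitarySchmidt.bipartiteKron h).le_extent
  rw [tensorFamily_conj]
  -- With `V` the common value: `V ≤ bb(LOCC⋆) ≤ bb(LO⋆) ≤ V`, and the extent of the tensor product
  -- lies between `V` and `V`.
  exact ⟨le_antisymm (h₂.trans h₃) h₁, le_antisymm (h₁.trans (h₂.trans h₅)) (h₄.trans h₃)⟩
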